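/- Let $n\ge 1$. Let $\mathbb S^{n+1}=\{x\in\mathbb R^{n+2}:\langle x,x\rangle_0=1\}$ and endow $\mathbb S^{n+1}\times\mathbb R$ with the Lorentzian metric $\langle\cdot,\cdot\rangle_1=\langle\cdot,\cdot\rangle_0-dt^2$. For an immersion of an $n$-manifold with non-degenerate induced metric, the second fundamental form is $h(X,Y)=(D_XY)^\perp$ ($D$ the Levi-Civita connection of the ambient space) and the mean curvature vector $\vec H$ is its trace with respect to the induced metric. An immersion into $\mathbb S^{n+1}\times\mathbb R$ is *spacelike* if the induced metric is positive definite; it has *null second fundamental form* if $\langle h(X,Y),h(X,Y)\rangle_1=0$ for all $X,Y$; it is *marginally trapped* if it is spacelike and $\langle\vec H,\vec H\rangle_1\equiv 0$. Let $\mathcal M$ be a smooth $n$-dimensional manifold. 1. If $n\ge 2$, every $C^2$ immersion $\mathcal M\to\mathbb S^{n+1}\times\mathbb R$ with non-degenerate induced metric and null second fundamental form is totally geodesic ($h\equiv 0$). 2. Let $\varphi:\mathcal M\to\mathbb S^{n+1}$ be a $C^4$ immersion with Gauss map $\nu$ (a $C^3$ unit normal field), let $\kappa_1,\dots,\kappa_p$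 be its distinct principal curvatures at a point $x$ (the eigenvalues of the shape operator $A=-d\nu$; $p$ may depend on $x$), with multiplicities $m_1,\dots,m_p$, and put $$P_x(s)=\sum_{i=1}^p m_i(\kappa_i s+1)\prod_{j\ne i}(s-\kappa_j).$$ Then $P_x$ has exactly $p-1$ distinct real roots if the mean curvature of $\varphi$ vanishes at $x$, and exactly $p$ otherwise. For every continuous function $s$ with $P_x(s(x))=0$ for all $x\in\mathcal M$, the map $$\bar\varphi_s=\Big(\frac{s\varphi+\nu}{\sqrt{1+s^2}},\ \cot^{-1}s\Big):\mathcal M\to\mathbb S^{n+1}\times\mathbb R,\qquad \cot^{-1}:\mathbb R\to(0,\pi),$$ is a marginally trapped immersion of class $C^2$. If the number $p$ of distinct principal curvatures is constant on $\mathcal M$, then the roots of $P_x$ are the values at $x$ of continuous functions $s_1,\dots,s_{p-1}$ on $\mathcal M$ if $\varphi$ is minimal, and $s_1,\dots,s_p$ if the mean curvature of $\varphi$ vanishes nowhere, these values being pairwise distinct at each point; so one gets $p-1$, respectively $p$, marginally trapped immersions $\bar\varphi_{s_i}$. 3. Conversely, let $\bar\varphi:\mathcal M\to\mathbb S^{n+1}\times\mathbb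 R$ be a marginally trapped immersion of class $C^5$. Let $x\in\mathcal M$ be a point near which $\langle\vec H,\xi\rangle_1=0$ for some continuous nowhere vanishing null normal field $\xi$ along $\bar\varphi$. Then near $x$ the immersion $\bar\varphi$ coincides, up to a vertical translation $(q,t)\mapsto(q,t+c)$, with some $\bar\varphi_s$ as in part 2, where $\varphi$ is a $C^4$ immersion into $\mathbb S^{n+1}$ with Gauss map $\nu$ and $s$ is a continuous root of its polynomial. The points near which $\bar\varphi$ is of this form contain an open dense subset of $\mathcal M$ which contains every point where $\vec H\ne 0$. 4. Let $n=2$, and let $\varphi$ be a $C^4$ immersion of a surface $\mathcal M$ into $\mathbb S^3$ with Gauss map $\nu$, without umbilic points and with nowhere vanishing mean curvature, with principal curvatures $\kappa_1\neq\kappa_2$. With $a=\dfrac{\kappa_1\kappa_2-1}{\kappa_1+\kappa_2}$, the two maps into $\mathbb S^3\times\mathbb R$ $$\bar\varphi_\pm=\Big(\frac{(a\pm\sqrt{a^2+1})\varphi+\nu}{\sqrt2\sqrt{a^2+1\pm a\sqrt{a^2+1}}},\ \cot^{-1}\big(a\pm\sqrt{a^2+1}\big)\Big)$$ are marginally trapped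 immersions. All of this holds as well with any open subset of $\mathcal M$ in place of $\mathcal M$. -/

import Mathlib

open scoped Manifold ContDiff
open Polynomial

noncomputable section

namespace MarginallyTrapped

/-! ### Extrinsic geometry of immersions into a submanifold of a flat pseudo-Euclidean space

`V` is a vector space with a symmetric bilinear form `B`; the ambient manifold `𝒩 ⊆ V` enters only
through its tangent spaces `W p ⊆ V`.  Its Levi-Civita connection is the tangential part of the flat
derivative of `V`. -/

section Extrinsic

variable {n : ℕ} {M : Type*} [TopologicalSpace M] [ChartedSpace (EuclideanSpace ℝ (Fin n)) M]
variable {V : Type*} [NormedAddCommGroup V] [NormedSpace ℝ V]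

/-- The differential of `f : M → V` at `x`; the tangent space at `x` is identified with `ℝⁿ` by the
preferred chart at `x`, as everywhere in Mathlib. -/
def diff (f : M → V) (x : M) : EuclideanSpace ℝ (Fin n) →L[ℝ] V :=
  mfderiv (𝓡 n) 𝓘(ℝ, V) f x

/-- The second derivative of `f : M → V` at `x` in the preferred chart at `x`, that is, the flat
derivative `D_X (df (Y))` for the coordinate vector fields `X`, `Y` with values `v`, `w` at `x`.
Another extension of `w` changes it by a vector tangent to `f` only. -/
def diff2 (f : M → V) (x : M) (v w : EuclideanSpace ℝ (Fin n)) : V :=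
  fderiv ℝ (fderiv ℝ (f ∘ (extChartAt (𝓡 n) x).symm)) (extChartAt (𝓡 n) x x) v w

/-- First fundamental form of `f` at `x`. -/
def firstForm (B : LinearMap.BilinForm ℝ V) (f : M → V) (x : M)
    (v w : EuclideanSpace ℝ (Fin n)) : ℝ :=
  B (diff f x v) (diff f x w)

/-- The normal space of `f` at `x`: the vectors tangent to the ambient manifold at `f x` which are
`B`-orthogonal to the image of the differential. -/
def normalSpace (n : ℕ) [ChartedSpace (EuclideanSpace ℝ (Fin n)) M]
    (B : LinearMap.BilinForm ℝ V) (W : V → Submodule ℝ V)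
    (f : M → V) (x : M) : Submodule ℝ V :=
  W (f x) ⊓ B.orthogonal (LinearMap.range (diff (n := n) f x).toLinearMap)

open Classical in
/-- `B`-orthogonal projection to `N`: the vector of `N` whose `B`-products with the elements of `N`
are those of `u` (it exists and is unique when `B` is nondegenerate on `N`). -/
def orthProj (B : LinearMap.BilinForm ℝ V) (N : Submodule ℝ V) (u : V) : V :=
  if h : ∃ ξ ∈ N, ∀ η ∈ N, B ξ η = B u η then h.choose else 0

/-- Second fundamental form `h(v, w) = (D_v w)^⊥`.  (The component of the flat derivative normal to
the ambient manifold is orthogonal to the normal space, so that projecting it out first makes no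
difference.) -/
def secondForm (B : LinearMap.BilinForm ℝ V) (W : V → Submodule ℝ V) (f : M → V) (x : M)
    (v w : EuclideanSpace ℝ (Fin n)) : V :=
  orthProj B (normalSpace n B W f x) (diff2 f x v w)

/-- Gram matrix of the first fundamental form in the standard basis. -/
def gram (B : LinearMap.BilinForm ℝ V) (f : M → V) (x : M) : Matrix (Fin n) (Fin n) ℝ :=
  Matrix.of fun i j => firstForm B f x (EuclideanSpace.single i 1) (EuclideanSpace.single j 1)

/-- Mean curvature vector: the trace of the second fundamental form with respect to the first. -/
def meanCurvature (n : ℕ) [ChartedSpace (EuclideanSpace ℝ (Fin n)) M]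
    (B : LinearMap.BilinForm ℝ V) (W : V → Submodule ℝ V) (f : M → V) (x : M) : V :=
  ∑ i : Fin n, ∑ j : Fin n, (gram B f x)⁻¹ i j •
    secondForm B W f x (EuclideanSpace.single i 1) (EuclideanSpace.single j 1)

end Extrinsic

/-! ### The sphere `𝕊ⁿ⁺¹ ⊆ ℝⁿ⁺²` and the Lorentzian product `𝕊ⁿ⁺¹ × ℝ ⊆ ℝⁿ⁺² × ℝ` -/

/-- `ℝⁿ⁺²` with the Euclidean inner product. -/
abbrev Euc (n : ℕ) : Type := EuclideanSpace ℝ (Fin (n + 2))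

/-- The inner product of `ℝⁿ⁺²` as a bilinear form. -/
def eucForm (n : ℕ) : LinearMap.BilinForm ℝ (Euc n) := innerₗ (Euc n)

/-- The tangent space of `𝕊ⁿ⁺¹` at `p`. -/
def sphereTangent (n : ℕ) (p : Euc n) : Submodule ℝ (Euc n) := (ℝ ∙ p)ᗮ

/-- The Lorentzian form `⟨u, v⟩ - a b` on `ℝⁿ⁺² × ℝ`. -/
def lorForm (n : ℕ) : LinearMap.BilinForm ℝ (Euc n × ℝ) :=
  (eucForm n).comp (LinearMap.fst ℝ _ _) (LinearMap.fst ℝ _ _) -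
    (LinearMap.mul ℝ ℝ).compl₁₂ (LinearMap.snd ℝ _ _) (LinearMap.snd ℝ _ _)

/-- The tangent space of `𝕊ⁿ⁺¹ × ℝ` at `q`. -/
def productTangent (n : ℕ) (q : Euc n × ℝ) : Submodule ℝ (Euc n × ℝ) :=
  (sphereTangent n q.1).prod ⊤

section Geometry

variable {n : ℕ} {M : Type*} [TopologicalSpace M] [ChartedSpace (EuclideanSpace ℝ (Fin n)) M]

/-- On `U`, `F` is an immersion of class `C^k` into `𝕊ⁿ⁺¹ × ℝ` with nondegenerate induced
metric (nondegeneracy makes the differential injective). -/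
structure IsNondegenerateOn (k : WithTop ℕ∞) (F : M → Euc n × ℝ) (U : Set M) : Prop where
  contMDiffOn : ContMDiffOn (𝓡 n) 𝓘(ℝ, Euc n × ℝ) k F U
  mem : ∀ x ∈ U, ‖(F x).1‖ = 1
  nondegenerate : ∀ x ∈ U, ∀ v : EuclideanSpace ℝ (Fin n),
    (∀ w, firstForm (lorForm n) F x v w = 0) → v = 0

/-- On `U`, `F` is a spacelike immersion of class `C^k` into `𝕊ⁿ⁺¹ × ℝ`. -/
structure IsSpacelikeOn (k : WithTop ℕ∞) (F : M → Euc n × ℝ) (U : Set M) : Prop where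
  contMDiffOn : ContMDiffOn (𝓡 n) 𝓘(ℝ, Euc n × ℝ) k F U
  mem : ∀ x ∈ U, ‖(F x).1‖ = 1
  spacelike : ∀ x ∈ U, ∀ v : EuclideanSpace ℝ (Fin n), v ≠ 0 → 0 < firstForm (lorForm n) F x v v

/-- The second fundamental form of `F` in `𝕊ⁿ⁺¹ × ℝ`. -/
abbrev secondFormL (F : M → Euc n × ℝ) (x : M) (v w : EuclideanSpace ℝ (Fin n)) : Euc n × ℝ :=
  secondForm (lorForm n) (productTangent n) F x v w

/-- The mean curvature vector of `F` in `𝕊ⁿ⁺¹ × ℝ`. -/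
abbrev meanCurvatureL (F : M → Euc n × ℝ) (x : M) : Euc n × ℝ :=
  meanCurvature n (lorForm n) (productTangent n) F x

/-- On `U`, the second fundamental form of `F` takes null values. -/
def HasNullSecondFormOn (F : M → Euc n × ℝ) (U : Set M) : Prop :=
  ∀ x ∈ U, ∀ v w, lorForm n (secondFormL F x v w) (secondFormL F x v w) = 0

/-- On `U`, `F` is totally geodesic. -/
def IsTotallyGeodesicOn (F : M → Euc n × ℝ) (U : Set M) : Prop :=
  ∀ x ∈ U, ∀ v w, secondFormL F x v w = 0

/-- On `U`, `F` is a spacelike marginally trapped immersion of class `C^k`: the mean curvature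
vector is null (possibly zero). -/
def IsMarginallyTrappedOn (k : WithTop ℕ∞) (F : M → Euc n × ℝ) (U : Set M) : Prop :=
  IsSpacelikeOn k F U ∧
    ∀ x ∈ U, lorForm n (meanCurvatureL F x) (meanCurvatureL F x) = 0

/-- On `U`, `ξ` is a continuous nowhere vanishing null normal field along `F`. -/
def IsNullNormalOn (F ξ : M → Euc n × ℝ) (U : Set M) : Prop :=
  ContinuousOn ξ U ∧ ∀ x ∈ U, ξ x ≠ 0 ∧ lorForm n (ξ x) (ξ x) = 0 ∧
    ξ x ∈ normalSpace n (lorForm n) (productTangent n) F x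

/-- On `U`, `φ` is an immersion of class `C⁴` into `𝕊ⁿ⁺¹` with Gauss map `ν` (a unit normal field of
class `C³`). -/
structure IsHypersurfaceOn (φ ν : M → Euc n) (U : Set M) : Prop where
  contMDiffOn : ContMDiffOn (𝓡 n) 𝓘(ℝ, Euc n) 4 φ U
  mem : ∀ x ∈ U, ‖φ x‖ = 1
  immersion : ∀ x ∈ U, Function.Injective (diff (n := n) φ x)
  gauss_contMDiffOn : ContMDiffOn (𝓡 n) 𝓘(ℝ, Euc n) 3 ν U
  gauss_unit : ∀ x ∈ U, ‖ν x‖ = 1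
  gauss_normal : ∀ x ∈ U, ν x ∈ normalSpace n (eucForm n) (sphereTangent n) φ x

/-- The mean curvature vector of `φ` in `𝕊ⁿ⁺¹`. -/
abbrev meanCurvatureS (φ : M → Euc n) (x : M) : Euc n :=
  meanCurvature n (eucForm n) (sphereTangent n) φ x

/-- The eigenspace `{v | A v = κ v}` of the shape operator `A`, which is given by
`dφ (A v) = - dν (v)`. -/
def principalSpace (φ ν : M → Euc n) (x : M) (κ : ℝ) : Submodule ℝ (EuclideanSpace ℝ (Fin n)) :=
  LinearMap.ker ((diff ν x).toLinearMap + κ • (diff φ x).toLinearMap)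

/-- The set of (distinct) principal curvatures at `x`. -/
def principalCurvatures (φ ν : M → Euc n) (x : M) : Set ℝ :=
  {κ | principalSpace φ ν x κ ≠ ⊥}

/-- The multiplicity of a principal curvature. -/
def principalMult (φ ν : M → Euc n) (x : M) (κ : ℝ) : ℕ :=
  Module.finrank ℝ (principalSpace φ ν x κ)

/-- The polynomial `P(s) = ∑ᵢ mᵢ (κᵢ s + 1) ∏_{j ≠ i} (s - κⱼ)` at the point `x`. -/
def trapPoly (φ ν : M → Euc n) (x : M) : ℝ[X] :=
  ∑ᶠ κ ∈ principalCurvatures φ ν x,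
    C (principalMult φ ν x κ : ℝ) * (C κ * X + 1) *
      ∏ᶠ μ ∈ principalCurvatures φ ν x \ {κ}, (X - C μ)

/-- The inverse cotangent with values in `(0, π)`. -/
def arccot (s : ℝ) : ℝ := Real.pi / 2 - Real.arctan s

/-- The map `((s φ + ν) / √(1 + s²), cot⁻¹ s)`. -/
def nullLift (φ ν : M → Euc n) (s : M → ℝ) (x : M) : Euc n × ℝ :=
  ((Real.sqrt (1 + s x ^ 2))⁻¹ • (s x • φ x + ν x), arccot (s x))

/-- On `U`, `s` is a continuous root of `P`. -/
def IsRootFunctionOn (φ ν : M → Euc n) (s : M → ℝ) (U : Set M) : Prop :=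
  ContinuousOn s U ∧ ∀ x ∈ U, (trapPoly φ ν x).IsRoot (s x)

/-- Near `x`, up to a vertical translation of `𝕊ⁿ⁺¹ × ℝ`, `F` is the map associated with a
hypersurface of `𝕊ⁿ⁺¹` and a root of its polynomial. -/
def IsLocallyNullLift (F : M → Euc n × ℝ) (x : M) : Prop :=
  ∃ N : Set M, IsOpen N ∧ x ∈ N ∧ ∃ (φ ν : M → Euc n) (s : M → ℝ) (c : ℝ),
    IsHypersurfaceOn φ ν N ∧ IsRootFunctionOn φ ν s N ∧
      ∀ y ∈ N, ((F y).1, (F y).2 + c) = nullLift φ ν s y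

/-- `a = (κ₁ κ₂ - 1) / (κ₁ + κ₂)`. -/
def surfaceParam (κ₁ κ₂ : M → ℝ) (x : M) : ℝ :=
  (κ₁ x * κ₂ x - 1) / (κ₁ x + κ₂ x)

/-- The explicit map of the surface case, where `ε = 1` or `ε = -1` is the sign. -/
def surfaceLift (ε : ℝ) (φ ν : M → Euc n) (a : M → ℝ) (x : M) : Euc n × ℝ :=
  ((Real.sqrt 2 * Real.sqrt (a x ^ 2 + 1 + ε * (a x * Real.sqrt (a x ^ 2 + 1))))⁻¹ •
      ((a x + ε * Real.sqrt (a x ^ 2 + 1)) • φ x + ν x),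
    arccot (a x + ε * Real.sqrt (a x ^ 2 + 1)))

end Geometry

end MarginallyTrapped

end

/-! A null normal direction of F = (F₁, t) can be scaled to (N, 1). Then N is a unit vector
orthogonal to F₁ with ⟨N, dF₁⟩ = dt. Two maps from the tangent space to ℝⁿ⁺² carry the geometry. The
first, P = dF₁ - dt·N (`reduced`), induces the same metric as F. The second, Q = dN + dt·F₁
(`twist`), is the derivative of the null field made tangent to the sphere. Both take values in {F₁,
N}^⊥, which is the range of P when the metric is nondegenerate. Differentiating ⟨N, dF₁⟩ = dt gives
⟨h(v, w), (N, 1)⟩ = -⟨Qv, Pw⟩, hence ⟨H, (N, 1)⟩ = -tr(P⁻¹Q) (`IsNullField.lorForm_meanCurvature`).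
The normal space is a Lorentzian plane with two null lines, so a normal vector is null exactly when
it is orthogonal to one of them (`null_iff`).

For a lift, F = (cos θ φ + sin θ ν, θ) with cot θ = s, and N = cos θ ν - sin θ φ. Here P = sin θ (s
dφ + dν) and Q = sin θ (s dν - dφ). On the eigenspace of κ these are (s - κ) and -(κs + 1) times sin
θ dφ, so the trace is -∑ m (κs + 1)/(s - κ). After clearing denominators this is the polynomial of
the statement. No κ is a root, since the value at κ is m(κ² + 1)∏(κ - μ). Hence P is injective at
every root, and roots are exactly the zeros of the trace. The polynomial changes sign between
consecutive principal curvatures, and its coefficient of degree p is ∑ mκ; this gives the root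
count. The rational function has negative derivative, so zeros are simple. The implicit function
theorem applies to the trace, which is C² in the point even where p jumps, and it makes every
continuous root function C² (`IsHypersurfaceOn.exists_rootFunction`).

Conversely, a null normal field with ⟨H, (N, 1)⟩ = 0 is rotated back by θ = t + c: φ = cos θ F₁ -
sin θ N and ν = sin θ F₁ + cos θ N. Then dφ = cos θ P - sin θ Q, which is injective at the point for
a suitable c, and the same computation read backwards shows that cot θ is a root
(`IsNullField.isLocallyNullLift`). Such a field exists near every point with H ≠ 0, and also where H
vanishes on a neighbourhood; these points are dense.

If h takes only null values, one of the two maps Q vanishes at each point. If h ≠ 0 at x along (N,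
1), the other Q is nonzero near x, so dN = -dt·F₁ near x. Symmetry of second derivatives then gives
dt ∧ dF₁ = 0, which forces dt = 0 for n ≥ 2. So (0, 1) is normal and orthogonal to h, contradicting
h ∥ (N, 1). -/

noncomputable section

set_option linter.unusedSectionVars false

namespace MarginallyTrapped

open ContinuousLinearMap (adjoint)
open scoped RealInnerProductSpace Topology

/-! ### Real roots of `∑ m (κ X + 1) ∏ (X - μ)` -/

section Roots

/-- The polynomial `∑ m(κ) (κ X + 1) ∏_{μ ≠ κ} (X - μ)`, the sum and product over `K`. -/
def weightedPoly (K : Finset ℝ) (m : ℝ → ℕ) : ℝ[X] :=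
  ∑ κ ∈ K, C (m κ : ℝ) * (C κ * X + 1) * ∏ μ ∈ K.erase κ, (X - C μ)

variable {K : Finset ℝ} {m : ℝ → ℕ}

theorem eval_weightedPoly (s : ℝ) :
    (weightedPoly K m).eval s = ∑ κ ∈ K, m κ * (κ * s + 1) * ∏ μ ∈ K.erase κ, (s - μ) := by
  simp [weightedPoly, eval_finsetSum, eval_prod]

theorem eval_weightedPoly_of_mem {κ : ℝ} (hκ : κ ∈ K) :
    (weightedPoly K m).eval κ = m κ * (κ ^ 2 + 1) * ∏ μ ∈ K.erase κ, (κ - μ) := by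
  rw [eval_weightedPoly, Finset.sum_eq_single_of_mem κ hκ, sq]
  intro μ hμ hne
  rw [Finset.prod_eq_zero (Finset.mem_erase.2 ⟨hne.symm, hκ⟩) (sub_self κ), mul_zero]

theorem eval_weightedPoly_ne_zero (hm : ∀ κ ∈ K, 0 < m κ) {κ : ℝ} (hκ : κ ∈ K) :
    (weightedPoly K m).eval κ ≠ 0 := by
  rw [eval_weightedPoly_of_mem hκ]
  have := hm κ hκ
  refine mul_ne_zero (by positivity) (Finset.prod_ne_zero_iff.2 fun μ hμ => ?_)
  exact sub_ne_zero.2 (Finset.ne_of_mem_erase hμ).symm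

theorem eval_weightedPoly_of_notMem {s : ℝ} (hs : s ∉ K) :
    (weightedPoly K m).eval s =
      (∏ μ ∈ K, (s - μ)) * ∑ κ ∈ K, m κ * ((κ * s + 1) / (s - κ)) := by
  rw [eval_weightedPoly, Finset.mul_sum]
  refine Finset.sum_congr rfl fun κ hκ => ?_
  have : s - κ ≠ 0 := sub_ne_zero.2 fun h => hs (h ▸ hκ)
  rw [← Finset.mul_prod_erase K _ hκ]
  field_simp

/-- Off `K` the polynomial is ∏ (s - μ) times the rational function; on `K` it never vanishes. So
clearing denominators neither creates nor loses zeros. -/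
theorem isRoot_weightedPoly_iff (hm : ∀ κ ∈ K, 0 < m κ) {s : ℝ} :
    (weightedPoly K m).IsRoot s ↔
      s ∉ K ∧ ∑ κ ∈ K, m κ * ((κ * s + 1) / (s - κ)) = 0 := by
  rw [IsRoot.def]
  by_cases hs : s ∈ K
  · simp [hs, eval_weightedPoly_ne_zero hm hs]
  · have h1 : ∏ μ ∈ K, (s - μ) ≠ 0 :=
      Finset.prod_ne_zero_iff.2 fun μ hμ => sub_ne_zero.2 fun h => hs (h ▸ hμ)
    rw [eval_weightedPoly_of_notMem hs, mul_eq_zero, or_iff_right h1]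
    simp [hs]

theorem natDegree_weightedPoly_le : (weightedPoly K m).natDegree ≤ K.card := by
  refine natDegree_sum_le_of_forall_le _ _ fun κ hκ => ?_
  have h1 : (∏ μ ∈ K.erase κ, (X - C μ)).natDegree = (K.erase κ).card :=
    natDegree_finsetProd_X_sub_C_eq_card _ _
  have h2 : (C (m κ : ℝ) * (C κ * X + 1)).natDegree ≤ 1 := by
    compute_degree
  have := Finset.card_erase_add_one hκ
  refine natDegree_mul_le.trans ?_
  omega

/-- Each summand contributes m κ, its other factor being monic of degree `K.card - 1`. For principal
curvatures this coefficient is the trace of the shape operator, which is why minimality decides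
whether a root is lost. -/
theorem coeff_card_weightedPoly :
    (weightedPoly K m).coeff K.card = ∑ κ ∈ K, m κ * κ := by
  rw [weightedPoly, finsetSum_coeff]
  refine Finset.sum_congr rfl fun κ hκ => ?_
  have hmon : (∏ μ ∈ K.erase κ, (X - C μ)).Monic := monic_prod_X_sub_C _ _
  have h1 : (∏ μ ∈ K.erase κ, (X - C μ)).natDegree = (K.erase κ).card :=
    natDegree_finsetProd_X_sub_C_eq_card _ _
  have h2 : (∏ μ ∈ K.erase κ, (X - C μ)).coeff ((K.erase κ).card + 1) = 0 :=
    coeff_eq_zero_of_natDegree_lt (by omega)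
  rw [← Finset.card_erase_add_one hκ, mul_assoc, coeff_C_mul, add_mul, coeff_add, one_mul,
    mul_assoc, coeff_C_mul, coeff_X_mul, h2, ← h1, hmon.coeff_natDegree]
  ring

theorem weightedPoly_ne_zero (hK : K.Nonempty) (hm : ∀ κ ∈ K, 0 < m κ) :
    weightedPoly K m ≠ 0 := by
  obtain ⟨κ, hκ⟩ := hK
  intro h
  exact eval_weightedPoly_ne_zero hm hκ (by simp [h])

/-- In the product of the values at two neighbours a, b every factor is positive except (a - b)(b -
a): each remaining μ lies on the same side of a and b. -/
theorem exists_root_between (hm : ∀ κ ∈ K, 0 < m κ) {a b : ℝ} (ha : a ∈ K) (hb : b ∈ K)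
    (hab : a < b) (hK : ∀ κ ∈ K, κ ≤ a ∨ b ≤ κ) :
    ∃ s, a < s ∧ s < b ∧ (weightedPoly K m).IsRoot s := by
  have hneg : (weightedPoly K m).eval a * (weightedPoly K m).eval b < 0 := by
    have hba : b ∈ K.erase a := Finset.mem_erase.2 ⟨hab.ne', hb⟩
    have hab' : a ∈ K.erase b := Finset.mem_erase.2 ⟨hab.ne, ha⟩
    rw [eval_weightedPoly_of_mem ha, eval_weightedPoly_of_mem hb,
      ← Finset.mul_prod_erase _ _ hba, ← Finset.mul_prod_erase _ _ hab', Finset.erase_right_comm]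
    have h1 : 0 < (∏ μ ∈ (K.erase b).erase a, (a - μ)) * ∏ μ ∈ (K.erase b).erase a, (b - μ) := by
      rw [← Finset.prod_mul_distrib]
      refine Finset.prod_pos fun μ hμ => ?_
      rw [Finset.mem_erase, Finset.mem_erase] at hμ
      rcases hK μ hμ.2.2 with h | h
      · exact mul_pos (sub_pos.2 (lt_of_le_of_ne h hμ.1))
          (sub_pos.2 (h.trans_lt hab))
      · exact mul_pos_of_neg_of_neg (sub_neg.2 (hab.trans_le h))
          (sub_neg.2 (lt_of_le_of_ne h hμ.2.1.symm))
    have h2 : (0 : ℝ) < m a := by exact_mod_cast hm a ha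
    have h3 : (0 : ℝ) < m b := by exact_mod_cast hm b hb
    have h4 : 0 < (m a * (a ^ 2 + 1)) * (m b * (b ^ 2 + 1)) * ((b - a) * (b - a)) *
      ((∏ μ ∈ (K.erase b).erase a, (a - μ)) * ∏ μ ∈ (K.erase b).erase a, (b - μ)) := by
      have : 0 < b - a := sub_pos.2 hab
      positivity
    linear_combination h4
  have hc : ContinuousOn (fun s => (weightedPoly K m).eval s) (Set.Icc a b) :=
    (weightedPoly K m).continuous.continuousOn
  rcases mul_neg_iff.1 hneg with ⟨h1, h2⟩ | ⟨h1, h2⟩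
  · obtain ⟨s, hs, h0⟩ := intermediate_value_Ioo' hab.le hc ⟨h2, h1⟩
    exact ⟨s, hs.1, hs.2, h0⟩
  · obtain ⟨s, hs, h0⟩ := intermediate_value_Ioo hab.le hc ⟨h1, h2⟩
    exact ⟨s, hs.1, hs.2, h0⟩

/-- The value at the largest element of `K` is positive, while the leading coefficient ∑ m κ makes
the polynomial tend to -∞ at +∞. -/
theorem exists_root_gt (hK : K.Nonempty) (hm : ∀ κ ∈ K, 0 < m κ)
    (hsum : ∑ κ ∈ K, m κ * κ < 0) :
    ∃ s, (∀ κ ∈ K, κ < s) ∧ (weightedPoly K m).IsRoot s := by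
  set b := K.max' hK
  have hb : b ∈ K := K.max'_mem hK
  have hpos : 0 < (weightedPoly K m).eval b := by
    rw [eval_weightedPoly_of_mem hb]
    have h2 : (0 : ℝ) < m b := by exact_mod_cast hm b hb
    refine mul_pos (by positivity) (Finset.prod_pos fun μ hμ => sub_pos.2 ?_)
    rw [Finset.mem_erase] at hμ
    exact lt_of_le_of_ne (K.le_max' μ hμ.2) hμ.1
  have hdeg : (weightedPoly K m).natDegree = K.card :=
    le_antisymm natDegree_weightedPoly_le
      (le_natDegree_of_ne_zero (by rw [coeff_card_weightedPoly]; exact hsum.ne))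
  have hlead : (weightedPoly K m).leadingCoeff ≤ 0 := by
    rw [leadingCoeff, hdeg, coeff_card_weightedPoly]; exact hsum.le
  have htend := tendsto_atBot_of_leadingCoeff_nonpos (weightedPoly K m)
    (natDegree_pos_iff_degree_pos.1 (by rw [hdeg]; exact hK.card_pos)) hlead
  obtain ⟨t, ht1, ht2⟩ := ((htend.eventually_lt_atBot 0).and (Filter.eventually_gt_atTop b)).exists
  obtain ⟨s, hs, h0⟩ := intermediate_value_Ioo' ht2.le
    (weightedPoly K m).continuous.continuousOn ⟨ht1, hpos⟩
  exact ⟨s, fun κ hκ => (K.le_max' κ hκ).trans_lt hs.1, h0⟩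

/-- Reflection κ ↦ -κ, s ↦ -s changes the sign of the rational function and of ∑ m κ, and exchanges
the two ends of the line. -/
theorem exists_root_lt (hK : K.Nonempty) (hm : ∀ κ ∈ K, 0 < m κ)
    (hsum : 0 < ∑ κ ∈ K, m κ * κ) :
    ∃ s, (∀ κ ∈ K, s < κ) ∧ (weightedPoly K m).IsRoot s := by
  have hinj : Set.InjOn (fun κ : ℝ => -κ) (K : Set ℝ) := neg_injective.injOn
  have hm' : ∀ κ ∈ K.image (fun κ => -κ), 0 < m (-κ) := by
    intro κ hκ
    obtain ⟨μ, hμ, rfl⟩ := Finset.mem_image.1 hκ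
    simpa using hm μ hμ
  obtain ⟨s, hs, h0⟩ := exists_root_gt (K := K.image fun κ => -κ) (m := fun κ => m (-κ))
    (hK.image _) hm' (by
      rw [Finset.sum_image hinj]
      simpa using hsum)
  rw [isRoot_weightedPoly_iff hm', Finset.sum_image hinj] at h0
  refine ⟨-s, fun κ hκ => ?_, (isRoot_weightedPoly_iff hm).2 ⟨fun h => ?_, ?_⟩⟩
  · have := hs (-κ) (Finset.mem_image_of_mem _ hκ)
    linarith
  · exact h0.1 (Finset.mem_image.2 ⟨-s, h, neg_neg s⟩)
  · rw [← neg_eq_zero, ← h0.2, ← Finset.sum_neg_distrib]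
    refine Finset.sum_congr rfl fun κ hκ => ?_
    have h1 : s - -κ = -(-s - κ) := by ring
    rw [neg_neg, h1, div_neg]
    ring_nf

/-- `K.card - 1` roots, separated by consecutive elements of `K`. -/
theorem exists_roots_between (hm : ∀ κ ∈ K, 0 < m κ) :
    ∃ R : Finset ℝ, R.card = K.card - 1 ∧ ∀ s ∈ R, (weightedPoly K m).IsRoot s ∧
      (∃ κ ∈ K, κ < s) ∧ ∃ κ ∈ K, s < κ := by
  let e := K.orderEmbOfFin rfl
  have hlt : ∀ i : Fin (K.card - 1), i.1 < K.card ∧ i.1 + 1 < K.card := fun i => by omega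
  have hex : ∀ i : Fin (K.card - 1), ∃ s, e ⟨i, (hlt i).1⟩ < s ∧ s < e ⟨i + 1, (hlt i).2⟩ ∧
      (weightedPoly K m).IsRoot s := by
    intro i
    refine exists_root_between hm (K.orderEmbOfFin_mem rfl _) (K.orderEmbOfFin_mem rfl _)
      (e.strictMono (by simp [Fin.lt_def])) fun κ hκ => ?_
    obtain ⟨j, rfl⟩ : κ ∈ Set.range e := by rw [Finset.range_orderEmbOfFin]; exact hκ
    rw [e.le_iff_le, e.le_iff_le, Fin.le_def, Fin.le_def]
    simp only
    omega
  choose r h1 h2 h3 using hex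
  have hmono : StrictMono r := by
    intro i j hij
    refine (h2 i).trans_le (le_trans ?_ (h1 j).le)
    rw [e.le_iff_le, Fin.le_def]
    exact hij
  refine ⟨Finset.univ.map ⟨r, hmono.injective⟩, by simp, fun s hs => ?_⟩
  obtain ⟨i, -, rfl⟩ := Finset.mem_map.1 hs
  exact ⟨h3 i, ⟨_, K.orderEmbOfFin_mem rfl _, h1 i⟩, ⟨_, K.orderEmbOfFin_mem rfl _, h2 i⟩⟩

/-- A nonzero polynomial has at most as many roots as its degree, so exhibiting that many is enough.
-/
theorem encard_roots_weightedPoly_of_le (hK : K.Nonempty) (hm : ∀ κ ∈ K, 0 < m κ) {q : ℕ}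
    (hq : (weightedPoly K m).natDegree ≤ q) {R : Finset ℝ} (hR : R.card = q)
    (hroot : ∀ s ∈ R, (weightedPoly K m).IsRoot s) :
    {s | (weightedPoly K m).IsRoot s}.encard = q := by
  have h0 := weightedPoly_ne_zero hK hm
  have hset : {s | (weightedPoly K m).IsRoot s} = ((weightedPoly K m).roots.toFinset : Set ℝ) := by
    ext s; simp [h0]
  rw [hset, Set.encard_coe_eq_coe_finsetCard, Nat.cast_inj]
  refine le_antisymm (((Multiset.toFinset_card_le _).trans (card_roots' _)).trans hq) ?_
  rw [← hR]
  exact Finset.card_le_card fun s hs => by simpa [h0] using hroot s hs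

theorem encard_roots_weightedPoly_of_sum_eq_zero (hK : K.Nonempty) (hm : ∀ κ ∈ K, 0 < m κ)
    (hsum : ∑ κ ∈ K, m κ * κ = 0) :
    {s | (weightedPoly K m).IsRoot s}.encard = ((K.card - 1 : ℕ) : ℕ∞) := by
  obtain ⟨R, hR, hroot⟩ := exists_roots_between hm
  refine encard_roots_weightedPoly_of_le hK hm ?_ hR fun s hs => (hroot s hs).1
  have hlt : (weightedPoly K m).natDegree ≠ K.card := by
    intro h
    have := coeff_card_weightedPoly (K := K) (m := m)
    rw [hsum, ← h, coeff_natDegree, leadingCoeff_eq_zero] at this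
    exact weightedPoly_ne_zero hK hm this
  have := natDegree_weightedPoly_le (K := K) (m := m)
  omega

theorem encard_roots_weightedPoly_of_sum_ne_zero (hK : K.Nonempty) (hm : ∀ κ ∈ K, 0 < m κ)
    (hsum : ∑ κ ∈ K, m κ * κ ≠ 0) :
    {s | (weightedPoly K m).IsRoot s}.encard = (K.card : ℕ∞) := by
  obtain ⟨R, hR, hroot⟩ := exists_roots_between hm
  obtain ⟨s, hs, h0⟩ : ∃ s ∉ R, (weightedPoly K m).IsRoot s := by
    rcases hsum.lt_or_gt with h | h
    · obtain ⟨s, hs, h0⟩ := exists_root_gt hK hm h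
      refine ⟨s, fun hR => ?_, h0⟩
      obtain ⟨-, -, κ, hκ, hlt⟩ := hroot s hR
      exact lt_asymm hlt (hs κ hκ)
    · obtain ⟨s, hs, h0⟩ := exists_root_lt hK hm h
      refine ⟨s, fun hR => ?_, h0⟩
      obtain ⟨-, ⟨κ, hκ, hlt⟩, -⟩ := hroot s hR
      exact lt_asymm hlt (hs κ hκ)
  refine encard_roots_weightedPoly_of_le hK hm natDegree_weightedPoly_le
    (R := insert s R) ?_ fun t ht => ?_
  · rw [Finset.card_insert_of_notMem hs, hR]
    have := hK.card_pos
    omega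
  · rcases Finset.mem_insert.1 ht with rfl | ht
    · exact h0
    · exact (hroot t ht).1

theorem hasDerivAt_weightedSum {s : ℝ} (hs : s ∉ K) :
    HasDerivAt (fun s : ℝ => ∑ κ ∈ K, m κ * ((κ * s + 1) / (s - κ)))
      (∑ κ ∈ K, m κ * (-(κ ^ 2 + 1) / (s - κ) ^ 2)) s := by
  refine HasDerivAt.fun_sum fun κ hκ => HasDerivAt.const_mul _ ?_
  have : s - κ ≠ 0 := sub_ne_zero.2 fun h => hs (h ▸ hκ)
  convert! (((hasDerivAt_id s).const_mul κ).add_const 1).div ((hasDerivAt_id s).sub_const κ) this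
    using 1
  simp only [id]
  ring

/-- Strict monotonicity makes every zero simple. This nonvanishing derivative is what the implicit
function theorem needs. -/
theorem deriv_weightedSum_neg (hK : K.Nonempty) (hm : ∀ κ ∈ K, 0 < m κ) {s : ℝ} (hs : s ∉ K) :
    ∑ κ ∈ K, m κ * (-(κ ^ 2 + 1) / (s - κ) ^ 2) < 0 := by
  refine Finset.sum_neg (fun κ hκ => ?_) hK
  have : s - κ ≠ 0 := sub_ne_zero.2 fun h => hs (h ▸ hκ)
  have h2 : (0 : ℝ) < m κ := by exact_mod_cast hm κ hκ
  have h3 : 0 < (κ ^ 2 + 1) / (s - κ) ^ 2 := by positivity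
  rw [neg_div]
  nlinarith

end Roots

/-! ### Traces of pairs of linear maps -/

section RelTrace

variable {E V : Type*} [NormedAddCommGroup E] [InnerProductSpace ℝ E] [FiniteDimensional ℝ E]
  [NormedAddCommGroup V] [InnerProductSpace ℝ V]

theorem isUnit_of_injective {A : E →L[ℝ] E} (hA : Function.Injective A) : IsUnit A :=
  ContinuousLinearMap.isUnit_iff_bijective.2
    ⟨hA, LinearMap.surjective_of_injective (f := A.toLinearMap) hA⟩

theorem exists_comp_eq {P Q : E →L[ℝ] V} (hP : Function.Injective P)
    (h : ∀ v, ∃ u, Q v = P u) : ∃ R : E →L[ℝ] E, Q = P ∘L R := by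
  choose R hR using h
  refine ⟨LinearMap.toContinuousLinearMap
    { toFun := R
      map_add' := fun v w => hP (by rw [map_add, ← hR, ← hR, ← hR, map_add])
      map_smul' := fun c v => hP (by rw [RingHom.id_apply, map_smul, ← hR, ← hR, map_smul]) }, ?_⟩
  ext v : 1
  exact hR v

variable [CompleteSpace E] [CompleteSpace V]

/-- The trace of the endomorphism `R` with `Q = P ∘ R`, for injective `P`. -/
def relTrace (P Q : E →L[ℝ] V) : ℝ :=
  LinearMap.trace ℝ E
    (Ring.inverse (adjoint P ∘L P) * (adjoint P ∘L Q) : E →L[ℝ] E).toLinearMap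

theorem isUnit_adjoint_comp_self {P : E →L[ℝ] V} (hP : Function.Injective P) :
    IsUnit (adjoint P ∘L P) := by
  refine isUnit_of_injective ((injective_iff_map_eq_zero _).2 fun v hv => hP ?_)
  rw [map_zero, ← inner_self_eq_zero (𝕜 := ℝ), ← ContinuousLinearMap.adjoint_inner_left]
  change inner ℝ ((adjoint P ∘L P) v) v = 0
  rw [hv, inner_zero_left]

theorem relTrace_comp {P : E →L[ℝ] V} (hP : Function.Injective P) (R : E →L[ℝ] E) :
    relTrace P (P ∘L R) = LinearMap.trace ℝ E R.toLinearMap := by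
  rw [relTrace, ← ContinuousLinearMap.comp_assoc]
  change LinearMap.trace ℝ E
    (Ring.inverse (adjoint P ∘L P) * ((adjoint P ∘L P) * R) : E →L[ℝ] E).toLinearMap = _
  rw [← mul_assoc, Ring.inverse_mul_cancel _ (isUnit_adjoint_comp_self hP), one_mul]

/-- A change of coordinates conjugates the endomorphism R, so the trace may be computed in any
chart. -/
theorem relTrace_comp_equiv {P Q : E →L[ℝ] V} (hP : Function.Injective P)
    (h : ∀ v, ∃ u, Q v = P u) (T : E ≃L[ℝ] E) :
    relTrace (P ∘L (T : E →L[ℝ] E)) (Q ∘L (T : E →L[ℝ] E)) = relTrace P Q := by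
  obtain ⟨R, rfl⟩ := exists_comp_eq hP h
  have : (P ∘L R) ∘L (T : E →L[ℝ] E) = (P ∘L (T : E →L[ℝ] E)) ∘L
      ((T.symm : E →L[ℝ] E) ∘L R ∘L (T : E →L[ℝ] E)) := by
    ext v; simp
  have hPT : Function.Injective (P ∘L (T : E →L[ℝ] E)) := hP.comp T.injective
  rw [this, relTrace_comp hPT, relTrace_comp hP]
  have := LinearMap.trace_conj' (R := ℝ) R.toLinearMap T.symm.toLinearEquiv
  rw [← this]
  rfl

theorem relTrace_smul_smul {P Q : E →L[ℝ] V} (hP : Function.Injective P)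
    (h : ∀ v, ∃ u, Q v = P u) {c : ℝ} (hc : c ≠ 0) :
    relTrace (c • P) (c • Q) = relTrace P Q := by
  obtain ⟨R, rfl⟩ := exists_comp_eq hP h
  rw [← ContinuousLinearMap.smul_comp, relTrace_comp hP,
    relTrace_comp ((smul_right_injective V hc).comp hP)]

/-- The normal equations R = (P*P)⁻¹P*Q express the trace through P and Q by products, adjoints and
one inversion, all smooth. No eigenvalue enters, so changing multiplicities do no harm. -/
theorem contDiffAt_relTrace {X : Type*} [NormedAddCommGroup X] [NormedSpace ℝ X]
    {k : WithTop ℕ∞} {P Q : X → E →L[ℝ] V} {z : X} (hP : ContDiffAt ℝ k P z)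
    (hQ : ContDiffAt ℝ k Q z) (hinj : Function.Injective (P z)) :
    ContDiffAt ℝ k (fun y => relTrace (P y) (Q y)) z := by
  have hadj : ContDiffAt ℝ k (fun y => adjoint (P y)) z :=
    (adjoint (𝕜 := ℝ) (E := E) (F := V)).toContinuousLinearEquiv.contDiff.contDiffAt.comp z hP
  obtain ⟨u, hu⟩ := isUnit_adjoint_comp_self hinj
  have hinv : ContDiffAt ℝ k (fun y => Ring.inverse (adjoint (P y) ∘L P y)) z := by
    refine ContDiffAt.comp z (g := Ring.inverse) ?_ (hadj.clm_comp hP)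
    rw [← hu]
    exact contDiffAt_ringInverse ℝ u
  let tr : (E →L[ℝ] E) →ₗ[ℝ] ℝ :=
    LinearMap.trace ℝ E ∘ₗ ContinuousLinearMap.coeLM ℝ
  exact (LinearMap.toContinuousLinearMap tr).contDiff.contDiffAt.comp z
    (hinv.clm_comp (hadj.clm_comp hQ))

/-- Riesz representation for the metric induced by `P`. -/
theorem exists_gradient {P : E →L[ℝ] V} (hP : Function.Injective P) (t : E →L[ℝ] ℝ) :
    ∃ z, ∀ v, ⟪P z, P v⟫ = t v := by
  obtain ⟨z, hz⟩ := (ContinuousLinearMap.isUnit_iff_bijective.1 (isUnit_adjoint_comp_self hP)).2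
    ((InnerProductSpace.toDual ℝ E).symm t)
  refine ⟨z, fun v => ?_⟩
  rw [← ContinuousLinearMap.adjoint_inner_left]
  change inner ℝ ((adjoint P ∘L P) z) v = t v
  rw [hz, InnerProductSpace.toDual_symm_apply]

theorem exists_pos_mul_norm_le {P : E →L[ℝ] V} (hP : Function.Injective P) :
    ∃ c > 0, ∀ v, c * ‖v‖ ≤ ‖P v‖ := by
  obtain ⟨K, hK, h⟩ := P.toLinearMap.exists_antilipschitzWith (LinearMap.ker_eq_bot.2 hP)
  refine ⟨(K : ℝ)⁻¹, by positivity, fun v => ?_⟩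
  have := h.le_mul_dist v 0
  rw [map_zero, dist_zero_right, dist_zero_right] at this
  rw [inv_mul_le_iff₀ (by positivity)]
  exact this

/-- `P` is injective exactly when P*P is a unit, and units form an open set. -/
theorem eventually_injective {X : Type*} [TopologicalSpace X] {P : X → E →L[ℝ] V} {z : X}
    (hP : ContinuousAt P z) (hinj : Function.Injective (P z)) :
    ∀ᶠ y in nhds z, Function.Injective (P y) := by
  have hadj : ContinuousAt (fun y => adjoint (P y) ∘L P y) z :=
    ((adjoint (𝕜 := ℝ) (E := E) (F := V)).continuous.continuousAt.comp hP).clm_comp hP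
  have := hadj.eventually (Units.isOpen.mem_nhds (isUnit_adjoint_comp_self hinj))
  filter_upwards [this] with y hy
  exact Function.Injective.of_comp (f := adjoint (P y))
    (ContinuousLinearMap.isUnit_iff_bijective.1 hy).1

end RelTrace

/-! ### Shape operators -/

section Shape

variable {E V : Type*} [NormedAddCommGroup E] [InnerProductSpace ℝ E] [FiniteDimensional ℝ E]
  [NormedAddCommGroup V] [InnerProductSpace ℝ V]

/-- `a` is injective and `b = - a ∘ A` with `A` symmetric for the metric induced by `a`. -/
structure IsShapePair (a b : E →L[ℝ] V) : Prop where
  injective : Function.Injective a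
  symm : ∀ v w, ⟪a v, b w⟫ = ⟪b v, a w⟫
  range : ∀ v, ∃ u, b v = a u

variable {a b : E →L[ℝ] V}

/-- The eigenspaces of the shape operator. -/
def shapeSpace (a b : E →L[ℝ] V) (κ : ℝ) : Submodule ℝ E :=
  LinearMap.ker (b.toLinearMap + κ • a.toLinearMap)

theorem mem_shapeSpace {κ : ℝ} {v : E} : v ∈ shapeSpace a b κ ↔ b v = -(κ • a v) := by
  rw [shapeSpace, LinearMap.mem_ker, LinearMap.add_apply, LinearMap.smul_apply,
    add_eq_zero_iff_eq_neg]
  rfl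

theorem IsShapePair.exists_shapeOperator (h : IsShapePair a b) :
    ∃ A : Module.End ℝ E, (∀ v, b v = -a (A v)) ∧ ∀ κ, A.eigenspace κ = shapeSpace a b κ := by
  obtain ⟨R, hR⟩ := exists_comp_eq h.injective h.range
  have hb : ∀ v, b v = -a ((-R.toLinearMap) v) := fun v => by
    rw [hR, LinearMap.neg_apply, map_neg, neg_neg]; rfl
  refine ⟨-R.toLinearMap, hb, fun κ => ?_⟩
  ext v
  rw [Module.End.mem_eigenspace_iff, mem_shapeSpace, hb, neg_inj, ← map_smul, h.injective.eq_iff]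

/-- The shape operator is symmetric for the metric induced by `a`, not for the given one on `E`. It
is therefore transported to the range of `a`, where the ambient inner product is that metric, and
the spectral theorem is applied there. -/
theorem IsShapePair.isInternal (h : IsShapePair a b) :
    DirectSum.IsInternal (shapeSpace a b) := by
  classical
  obtain ⟨A, hA, hE⟩ := h.exists_shapeOperator
  have hfun : shapeSpace a b = A.eigenspace := funext fun κ => (hE κ).symm
  rw [hfun]
  refine DirectSum.isInternal_submodule_of_iSupIndep_of_iSup_eq_top
    A.eigenspaces_iSupIndep ?_
  let e : E ≃ₗ[ℝ] LinearMap.range a.toLinearMap := LinearEquiv.ofInjective a.toLinearMap h.injective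
  have he : ∀ v, ((e v : LinearMap.range a.toLinearMap) : V) = a v := fun v => rfl
  let T : Module.End ℝ (LinearMap.range a.toLinearMap) := e.toLinearMap ∘ₗ A ∘ₗ e.symm.toLinearMap
  have hT : T.IsSymmetric := by
    intro x y
    obtain ⟨v, rfl⟩ := e.surjective x
    obtain ⟨w, rfl⟩ := e.surjective y
    have h1 : ((T (e v) : LinearMap.range a.toLinearMap) : V) = -b v := by
      simp only [T, LinearMap.comp_apply, LinearEquiv.coe_coe, e.symm_apply_apply, he, hA, neg_neg]
    have h2 : ((T (e w) : LinearMap.range a.toLinearMap) : V) = -b w := by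
      simp only [T, LinearMap.comp_apply, LinearEquiv.coe_coe, e.symm_apply_apply, he, hA, neg_neg]
    rw [Submodule.coe_inner, Submodule.coe_inner, h1, h2, inner_neg_left, inner_neg_right, he, he,
      h.symm]
  have hmap : ∀ κ, A.eigenspace κ = (T.eigenspace κ).map e.symm.toLinearMap := by
    intro κ
    ext v
    rw [Submodule.mem_map_equiv, Module.End.mem_eigenspace_iff, Module.End.mem_eigenspace_iff]
    simp only [LinearEquiv.symm_symm, T, LinearMap.comp_apply, LinearEquiv.coe_coe,
      e.symm_apply_apply]
    rw [← map_smul, e.injective.eq_iff]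
  have htop : ⨆ κ, T.eigenspace κ = ⊤ := by
    rw [← Submodule.orthogonal_eq_bot_iff]
    exact hT.orthogonalComplement_iSup_eigenspaces_eq_bot
  rw [iSup_congr hmap, ← Submodule.map_iSup, htop, Submodule.map_top]
  exact e.symm.range

/-- The set of eigenvalues of the shape operator. -/
def shapeSet (a b : E →L[ℝ] V) : Set ℝ := {κ | shapeSpace a b κ ≠ ⊥}

theorem IsShapePair.finite (h : IsShapePair a b) : (shapeSet a b).Finite := by
  obtain ⟨A, -, hE⟩ := h.exists_shapeOperator
  refine (Module.End.finite_hasEigenvalue A).subset fun κ hκ => ?_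
  change A.eigenspace κ ≠ ⊥
  rw [hE]
  exact hκ

/-- The multiplicities of the eigenvalues of the shape operator. -/
def shapeMult (a b : E →L[ℝ] V) (κ : ℝ) : ℕ := Module.finrank ℝ (shapeSpace a b κ)

theorem shapeMult_pos {κ : ℝ} (hκ : κ ∈ shapeSet a b) : 0 < shapeMult a b κ :=
  Module.finrank_pos_iff.2 (Submodule.nontrivial_iff_ne_bot.2 hκ)

/-- The eigenspaces decompose `E`, so the trace of an operator that is scalar on each of them is a
sum over eigenvalues. All traces below, and the dimension count, are instances. -/
theorem IsShapePair.trace_eq (h : IsShapePair a b) {S : E →ₗ[ℝ] E} {c : ℝ → ℝ}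
    (hS : ∀ κ, ∀ v ∈ shapeSpace a b κ, S v = c κ • v) :
    LinearMap.trace ℝ E S = ∑ κ ∈ h.finite.toFinset, shapeMult a b κ * c κ := by
  have hmaps : ∀ κ, Set.MapsTo S (shapeSpace a b κ) (shapeSpace a b κ) := fun κ v hv => by
    rw [hS κ v hv]
    exact Submodule.smul_mem _ _ hv
  classical
  rw [LinearMap.trace_eq_sum_trace_restrict' h.isInternal h.finite hmaps]
  refine Finset.sum_congr rfl fun κ _ => ?_
  have : S.restrict (hmaps κ) = c κ • LinearMap.id := by
    refine LinearMap.ext fun v => Subtype.ext ?_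
    exact hS κ v v.2
  rw [this, map_smul, LinearMap.trace_id, smul_eq_mul, mul_comm]
  rfl

theorem IsShapePair.nonempty [Nontrivial E] (h : IsShapePair a b) : (shapeSet a b).Nonempty := by
  by_contra hne
  rw [Set.not_nonempty_iff_eq_empty] at hne
  have h1 := h.trace_eq (S := LinearMap.id) (c := fun _ => 1) fun κ v _ => by simp
  have h2 : h.finite.toFinset = ∅ := by simpa using hne
  rw [LinearMap.trace_id, h2, Finset.sum_empty] at h1
  have := Module.finrank_pos (R := ℝ) (M := E)
  exact this.ne' (by exact_mod_cast h1)

theorem IsShapePair.sum_mult (h : IsShapePair a b) :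
    ∑ κ ∈ h.finite.toFinset, shapeMult a b κ = Module.finrank ℝ E := by
  have h1 := h.trace_eq (S := LinearMap.id) (c := fun _ => 1) fun κ v _ => by simp
  rw [LinearMap.trace_id] at h1
  simp only [mul_one] at h1
  exact_mod_cast h1.symm

/-- The kernel of s a + b is the eigenspace of s, because b = -a ∘ A. -/
theorem notMem_shapeSet_iff {s : ℝ} :
    s ∉ shapeSet a b ↔ Function.Injective (s • a + b) := by
  rw [shapeSet, Set.mem_ofPred_eq, not_not, shapeSpace, LinearMap.ker_eq_bot, add_comm]
  rfl

variable [CompleteSpace E] [CompleteSpace V]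

theorem IsShapePair.relTrace_eq (h : IsShapePair a b) :
    relTrace a b = -∑ κ ∈ h.finite.toFinset, shapeMult a b κ * κ := by
  obtain ⟨R, hR⟩ := exists_comp_eq h.injective h.range
  have key := h.trace_eq (S := R.toLinearMap) (c := fun κ => -κ) fun κ v hv => h.injective <| by
    rw [mem_shapeSpace] at hv
    change (a ∘L R) v = _
    rw [← hR, hv, map_smul, neg_smul]
  nth_rewrite 1 [hR]
  rw [relTrace_comp h.injective, key, ← Finset.sum_neg_distrib]
  exact Finset.sum_congr rfl fun κ _ => by ring

theorem IsShapePair.exists_combination (h : IsShapePair a b) {s : ℝ} (hs : s ∉ shapeSet a b)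
    (v : E) : ∃ u, (s • b - a) v = (s • a + b) u := by
  obtain ⟨A, hA, -⟩ := h.exists_shapeOperator
  have hinj := notMem_shapeSet_iff.1 hs
  have hi : Function.Injective (s • (LinearMap.id : E →ₗ[ℝ] E) - A) := by
    refine fun v w hvw => hinj ?_
    have h2 := congrArg a hvw
    simpa [hA, map_sub, sub_eq_add_neg] using h2
  obtain ⟨u, hu⟩ := LinearMap.surjective_of_injective hi (-(s • A v + v))
  refine ⟨u, ?_⟩
  have h2 := congrArg a hu
  simp only [LinearMap.sub_apply, LinearMap.smul_apply, LinearMap.id_apply, map_sub, map_smul,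
    map_neg, map_add] at h2
  simp only [_root_.sub_apply, _root_.smul_apply,
    _root_.add_apply, hA]
  rw [← sub_eq_add_neg, h2, smul_neg]
  abel

/-- On the eigenspace of κ one has b = -κ a, so s a + b = (s - κ) a and s b - a = -(κ s + 1) a; the
quotient is the scalar in the sum. -/
theorem IsShapePair.relTrace_combination (h : IsShapePair a b) {s : ℝ} (hs : s ∉ shapeSet a b) :
    relTrace (s • a + b) (s • b - a) =
      -∑ κ ∈ h.finite.toFinset, shapeMult a b κ * ((κ * s + 1) / (s - κ)) := by
  have hinj := notMem_shapeSet_iff.1 hs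
  obtain ⟨R, hR⟩ := exists_comp_eq hinj (h.exists_combination hs)
  have key := h.trace_eq (S := R.toLinearMap) (c := fun κ => -((κ * s + 1) / (s - κ)))
    fun κ v hv => by
      rcases eq_or_ne v 0 with rfl | hv0
      · simp
      have hκ : s - κ ≠ 0 := by
        refine sub_ne_zero.2 fun hsκ => hs (hsκ ▸ ?_)
        exact fun hbot => hv0 (by rw [hbot] at hv; exact (Submodule.mem_bot ℝ).1 hv)
      refine hinj ?_
      rw [mem_shapeSpace] at hv
      change ((s • a + b) ∘L R) v = _
      rw [← hR, map_smul]
      simp only [_root_.sub_apply, _root_.smul_apply,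
        _root_.add_apply, hv]
      rw [← neg_smul, ← add_smul, smul_smul, smul_smul, ← sub_eq_zero, sub_sub, ← one_smul ℝ (a v)]
      simp only [smul_smul, ← add_smul, ← sub_smul]
      convert zero_smul ℝ (a v) using 2
      field_simp
      ring
  rw [hR, relTrace_comp hinj, key, ← Finset.sum_neg_distrib]
  exact Finset.sum_congr rfl fun κ _ => by ring

/-- This replaces the polynomial, whose shape depends on the number of eigenvalues, by a condition
that depends smoothly on `a` and `b`. -/
theorem IsShapePair.isRoot_iff (h : IsShapePair a b) {s : ℝ} :
    (weightedPoly h.finite.toFinset (shapeMult a b)).IsRoot s ↔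
      Function.Injective (s • a + b) ∧ relTrace (s • a + b) (s • b - a) = 0 := by
  rw [isRoot_weightedPoly_iff fun κ hκ => shapeMult_pos (h.finite.mem_toFinset.1 hκ),
    ← notMem_shapeSet_iff, h.finite.mem_toFinset]
  refine and_congr_right fun hs => ?_
  rw [h.relTrace_combination hs, neg_eq_zero]

theorem IsShapePair.exists_hasDerivAt [Nontrivial E] (h : IsShapePair a b) {s : ℝ}
    (hs : s ∉ shapeSet a b) :
    ∃ c ≠ 0, HasDerivAt (fun s : ℝ => relTrace (s • a + b) (s • b - a)) c s := by
  have hm : ∀ κ ∈ h.finite.toFinset, 0 < shapeMult a b κ := fun κ hκ =>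
    shapeMult_pos (h.finite.mem_toFinset.1 hκ)
  have hs' : s ∉ h.finite.toFinset := fun h' => hs (h.finite.mem_toFinset.1 h')
  have hK : h.finite.toFinset.Nonempty := h.finite.toFinset_nonempty.2 h.nonempty
  refine ⟨_, ?_, ((hasDerivAt_weightedSum (m := shapeMult a b) hs').neg).congr_of_eventuallyEq ?_⟩
  · exact neg_ne_zero.2 (deriv_weightedSum_neg hK hm hs').ne
  · filter_upwards [h.finite.isClosed.isOpen_compl.mem_nhds hs] with r hr
    exact h.relTrace_combination hr

end Shape

/-! ### Null directions normal to a linear map -/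

section NullDir

variable {n : ℕ}

theorem lorForm_apply (u v : Euc n × ℝ) : lorForm n u v = ⟪u.1, v.1⟫ - u.2 * v.2 := rfl

theorem eucForm_apply (u v : Euc n) : eucForm n u v = ⟪u, v⟫ := rfl

/-- With S the matrix of `R` one has c = Sᵀ G, so contracting with G⁻¹ leaves tr S. The Gram matrix
is invertible because a kernel vector would have an image under `P` of length zero. -/
theorem sum_inv_gram_mul {V : Type*} [NormedAddCommGroup V] [InnerProductSpace ℝ V]
    {P : EuclideanSpace ℝ (Fin n) →L[ℝ] V} (hP : Function.Injective P)
    (R : EuclideanSpace ℝ (Fin n) →L[ℝ] EuclideanSpace ℝ (Fin n))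
    {G c : Matrix (Fin n) (Fin n) ℝ}
    (hG : ∀ i j, G i j = ⟪P (EuclideanSpace.single i 1), P (EuclideanSpace.single j 1)⟫)
    (hc : ∀ i j, c i j = ⟪P (R (EuclideanSpace.single i 1)), P (EuclideanSpace.single j 1)⟫) :
    ∑ i, ∑ j, G⁻¹ i j * c i j = LinearMap.trace ℝ (EuclideanSpace ℝ (Fin n)) R.toLinearMap := by
  classical
  let e := (EuclideanSpace.basisFun (Fin n) ℝ).toBasis
  have he : ∀ i, e i = EuclideanSpace.single i 1 := fun i => by simp [e]
  let S := LinearMap.toMatrix e e R.toLinearMap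
  have hS : ∀ i, R (EuclideanSpace.single i 1) = ∑ k, S k i • EuclideanSpace.single k (1 : ℝ) := by
    intro i
    have := e.sum_repr (R (EuclideanSpace.single i 1))
    rw [← this]
    refine Finset.sum_congr rfl fun k _ => ?_
    have hSk : S k i = e.repr (R (e i)) k := LinearMap.toMatrix_apply e e R.toLinearMap k i
    rw [hSk, he k, he i]
  have hcS : c = S.transpose * G := by
    ext i j
    rw [hc, hS, map_sum, sum_inner, Matrix.mul_apply]
    refine Finset.sum_congr rfl fun k _ => ?_
    rw [map_smul, real_inner_smul_left, hG, Matrix.transpose_apply]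
  have hGs : G.transpose = G := by
    ext i j
    rw [Matrix.transpose_apply, hG, hG, real_inner_comm]
  have hvec : ∀ x : Fin n → ℝ, ∑ i, x i • P (EuclideanSpace.single i 1) = P (WithLp.toLp 2 x) := by
    intro x
    rw [← (EuclideanSpace.basisFun (Fin n) ℝ).sum_repr (WithLp.toLp 2 x), map_sum]
    simp [map_smul]
  have hdet : IsUnit G.det := by
    rw [isUnit_iff_ne_zero]
    intro h0
    obtain ⟨x, hx0, hx⟩ := Matrix.exists_mulVec_eq_zero_iff.2 h0
    apply hx0
    have h1 : ⟪P (WithLp.toLp 2 x), P (WithLp.toLp 2 x)⟫ = 0 := by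
      rw [← hvec, sum_inner]
      refine Finset.sum_eq_zero fun i _ => ?_
      have hxi : ∑ j, G i j * x j = 0 := congrFun hx i
      rw [real_inner_smul_left, inner_sum, ← mul_zero (x i), ← hxi]
      refine congrArg _ (Finset.sum_congr rfl fun j _ => ?_)
      rw [real_inner_smul_right, hG, mul_comm]
    have h2 := hP ((inner_self_eq_zero.1 h1).trans (map_zero P).symm)
    simpa using congrArg (WithLp.ofLp) h2
  calc ∑ i, ∑ j, G⁻¹ i j * c i j = (G⁻¹.transpose * c).trace := by
        rw [Matrix.trace, Finset.sum_comm]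
        simp [Matrix.mul_apply]
    _ = (G⁻¹ * S.transpose * G).trace := by
        rw [Matrix.transpose_nonsing_inv, hGs, hcS, Matrix.mul_assoc]
    _ = S.trace := by
        rw [Matrix.trace_mul_comm, ← Matrix.mul_assoc, Matrix.mul_nonsing_inv _ hdet, Matrix.one_mul,
          Matrix.trace_transpose]
    _ = _ := (LinearMap.trace_eq_matrix_trace ℝ e _).symm

/-- A vector orthogonal to the orthonormal pair `p`, `q` is in the range of every injective map of
`ℝⁿ` to the orthogonal complement of `p`, `q` in `ℝⁿ⁺²`. -/
theorem mem_range_of_perp {P : EuclideanSpace ℝ (Fin n) →L[ℝ] Euc n} (hP : Function.Injective P)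
    {p q : Euc n} (hp : ⟪p, p⟫ = 1) (hq : ⟪q, q⟫ = 1) (hqp : ⟪q, p⟫ = 0)
    (hPp : ∀ v, ⟪p, P v⟫ = 0) (hPq : ∀ v, ⟪q, P v⟫ = 0) {u : Euc n} (hup : ⟪p, u⟫ = 0)
    (huq : ⟪q, u⟫ = 0) : ∃ v, u = P v := by
  let L := Submodule.span ℝ (Set.range ![p, q])
  have hL : Module.finrank ℝ L = 2 := by
    have ho : Orthonormal ℝ ![p, q] := by
      rw [orthonormal_iff_ite]
      intro i j
      fin_cases i <;> fin_cases j
      · exact hp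
      · exact (real_inner_comm q p).trans hqp
      · exact hqp
      · exact hq
    simpa using finrank_span_eq_card ho.linearIndependent
  have hmem : ∀ w : Euc n, ⟪p, w⟫ = 0 → ⟪q, w⟫ = 0 → w ∈ Lᗮ := by
    intro w h1 h2
    rw [Submodule.mem_orthogonal]
    intro x hx
    induction hx using Submodule.span_induction with
    | mem x hx =>
      obtain ⟨i, rfl⟩ := hx
      fin_cases i
      · exact h1
      · exact h2
    | zero => exact inner_zero_left _
    | add x y _ _ hx hy => rw [inner_add_left, hx, hy, add_zero]
    | smul c x _ hx => rw [real_inner_smul_left, hx, mul_zero]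
  have hle : LinearMap.range P.toLinearMap ≤ Lᗮ := by
    rintro _ ⟨v, rfl⟩
    exact hmem _ (hPp v) (hPq v)
  have hdim : Module.finrank ℝ (LinearMap.range P.toLinearMap) = Module.finrank ℝ Lᗮ := by
    have h1 := L.finrank_add_finrank_orthogonal
    rw [hL, finrank_euclideanSpace_fin] at h1
    rw [LinearMap.finrank_range_of_inj hP, finrank_euclideanSpace_fin]
    omega
  have hu := hmem u hup huq
  rw [← Submodule.eq_of_le_of_finrank_eq hle hdim] at hu
  obtain ⟨v, hv⟩ := hu
  exact ⟨v, hv.symm⟩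

/-- The vector `(N, 1)` is null, tangent to the product at a point over `p`, and normal to the
range of `D`. -/
structure NullDir (p N : Euc n) (D : EuclideanSpace ℝ (Fin n) →L[ℝ] Euc n × ℝ) : Prop where
  unit : ⟪N, N⟫ = 1
  perp : ⟪N, p⟫ = 0
  normal : ∀ v, ⟪N, (D v).1⟫ = (D v).2

/-- The component of `D` along the orthogonal complement of the null direction `(N, 1)`. -/
def reduced (D : EuclideanSpace ℝ (Fin n) →L[ℝ] Euc n × ℝ) (N : Euc n) :
    EuclideanSpace ℝ (Fin n) →L[ℝ] Euc n :=
  ContinuousLinearMap.fst ℝ _ _ ∘L D - (ContinuousLinearMap.snd ℝ _ _ ∘L D).smulRight N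

variable {D : EuclideanSpace ℝ (Fin n) →L[ℝ] Euc n × ℝ} {p N : Euc n}

theorem reduced_apply (v : EuclideanSpace ℝ (Fin n)) :
    reduced D N v = (D v).1 - (D v).2 • N := rfl

namespace NullDir

/-- Subtracting a multiple of (N, 1) from a tangent vector kills its vertical part and preserves
products, since (N, 1) is null and orthogonal to the tangent vectors. -/
theorem inner_reduced (h : NullDir p N D) (v w : EuclideanSpace ℝ (Fin n)) :
    ⟪reduced D N v, reduced D N w⟫ = lorForm n (D v) (D w) := by
  have h1 := h.normal v
  rw [real_inner_comm] at h1
  rw [reduced_apply, reduced_apply, inner_sub_left, inner_sub_right, inner_sub_right,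
    real_inner_smul_left, real_inner_smul_right, real_inner_smul_left, real_inner_smul_right, h1,
    h.normal, h.unit, lorForm_apply]
  ring

theorem injective_reduced (h : NullDir p N D)
    (hD : ∀ v, (∀ w, lorForm n (D v) (D w) = 0) → v = 0) :
    Function.Injective (reduced D N) := by
  refine (injective_iff_map_eq_zero _).2 fun v hv => hD v fun w => ?_
  rw [← h.inner_reduced, hv, inner_zero_left]

theorem inner_reduced_left (h : NullDir p N D) (v : EuclideanSpace ℝ (Fin n)) :
    ⟪N, reduced D N v⟫ = 0 := by
  rw [reduced_apply, inner_sub_right, real_inner_smul_right, h.unit, h.normal]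
  ring

theorem inner_base_reduced (h : NullDir p N D) (hD : ∀ v, ⟪p, (D v).1⟫ = 0)
    (v : EuclideanSpace ℝ (Fin n)) : ⟪p, reduced D N v⟫ = 0 := by
  rw [reduced_apply, inner_sub_right, real_inner_smul_right, hD, real_inner_comm, h.perp]
  ring

/-- This is the nondegeneracy of the linearised equations for a null direction: a variation `u` of N
solving them lies in the range of `reduced D N` and is orthogonal to it. -/
theorem eq_zero_of_perp (h : NullDir p N D) (hp : ⟪p, p⟫ = 1) (hD : ∀ v, ⟪p, (D v).1⟫ = 0)
    (hinj : Function.Injective (reduced D N)) {u : Euc n} (hup : ⟪p, u⟫ = 0) (huN : ⟪N, u⟫ = 0)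
    (huD : ∀ v, ⟪(D v).1, u⟫ = 0) : u = 0 := by
  obtain ⟨v, hv⟩ := mem_range_of_perp hinj hp h.unit h.perp (h.inner_base_reduced hD)
    h.inner_reduced_left hup huN
  rw [← inner_self_eq_zero (𝕜 := ℝ)]
  nth_rewrite 1 [hv]
  rw [reduced_apply, inner_sub_left, real_inner_smul_left, huN, huD]
  ring

theorem null (h : NullDir p N D) : lorForm n (N, 1) (N, 1) = 0 := by
  rw [lorForm_apply, h.unit]; ring

/-- There is a second null direction, and the two span the normal space. -/
theorem exists_other (h : NullDir p N D) (hp : ⟪p, p⟫ = 1) (hD : ∀ v, ⟪p, (D v).1⟫ = 0)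
    (hinj : Function.Injective (reduced D N)) :
    ∃ N', NullDir p N' D ∧ lorForm n (N, 1) (N', 1) ≠ 0 ∧
      ∀ ζ : Euc n × ℝ, ⟪p, ζ.1⟫ = 0 → (∀ v, lorForm n ζ (D v) = 0) →
        ∃ α β : ℝ, ζ = α • (N, 1) + β • (N', 1) := by
  obtain ⟨z, hz⟩ := exists_gradient hinj (ContinuousLinearMap.snd ℝ _ _ ∘L D)
  replace hz : ∀ v, ⟪reduced D N z, reduced D N v⟫ = (D v).2 := hz
  set q := reduced D N z with hq
  set ρ := (D z).2
  have hqq : ⟪q, q⟫ = ρ := hz z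
  have hρ : 0 ≤ ρ := by rw [← hqq]; exact real_inner_self_nonneg
  have hρ1 : ρ + 1 ≠ 0 := by positivity
  have hNq : ⟪N, q⟫ = 0 := h.inner_reduced_left z
  have hqN : ⟪q, N⟫ = 0 := by rw [real_inner_comm, hNq]
  have hqp : ⟪q, p⟫ = 0 := by rw [real_inner_comm, h.inner_base_reduced hD]
  have hfst : ∀ v, (D v).1 = reduced D N v + (D v).2 • N := fun v => by
    rw [reduced_apply, sub_add_cancel]
  have hqD : ∀ v, ⟪q, (D v).1⟫ = (D v).2 := fun v => by
    rw [hfst, inner_add_right, real_inner_smul_right, hqN, hz, mul_zero, add_zero]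
  -- Ansatz N' = αN + βq with q the gradient of the height. Normality asks α + β = 1 and unit length
  -- asks α² + β²ρ = 1. Besides β = 0, which is N itself, the solution is β = 2/(ρ + 1).
  refine ⟨(ρ + 1)⁻¹ • ((ρ - 1) • N + (2 : ℝ) • q), ⟨?_, ?_, fun v => ?_⟩, ?_, ?_⟩
  · simp only [real_inner_smul_left, real_inner_smul_right, inner_add_left, inner_add_right,
      h.unit, hNq, hqN, hqq]
    field_simp
    ring
  · simp only [real_inner_smul_left, inner_add_left, h.perp, hqp]
    ring
  · simp only [real_inner_smul_left, inner_add_left, h.normal, hqD]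
    field_simp
    ring
  · simp only [lorForm_apply, real_inner_smul_right, inner_add_right, h.unit, hNq]
    intro h0
    field_simp at h0
    linarith
  · intro ζ hζp hζ
    simp only [lorForm_apply] at hζ
    obtain ⟨y, hy⟩ := mem_range_of_perp hinj hp h.unit h.perp (h.inner_base_reduced hD)
      h.inner_reduced_left (u := ζ.1 - ⟪N, ζ.1⟫ • N)
      (by rw [inner_sub_right, real_inner_smul_right, hζp, real_inner_comm N p, h.perp]; ring)
      (by rw [inner_sub_right, real_inner_smul_right, h.unit]; ring)
    -- Once its N component is removed, a normal vector pairs with every tangent vector as a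
    -- multiple of the height differential, so it is that multiple of the gradient.
    have hyz : y = (ζ.2 - ⟪N, ζ.1⟫) • z := by
      refine hinj ?_
      rw [← sub_eq_zero, ← inner_self_eq_zero (𝕜 := ℝ), ← map_sub]
      set w := y - (ζ.2 - ⟪N, ζ.1⟫) • z
      have h1 : ⟪reduced D N y, reduced D N w⟫ = (ζ.2 - ⟪N, ζ.1⟫) * (D w).2 := by
        rw [← hy, inner_sub_left, real_inner_smul_left, h.inner_reduced_left, reduced_apply,
          inner_sub_right, real_inner_smul_right, real_inner_comm N ζ.1]
        linear_combination hζ w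
      have h2 : reduced D N w = reduced D N y - (ζ.2 - ⟪N, ζ.1⟫) • q := by
        rw [map_sub, map_smul]
      nth_rewrite 1 [h2]
      rw [inner_sub_left, h1, real_inner_smul_left, hz]
      ring
    rw [hyz, map_smul, ← hq] at hy
    set b := ζ.2
    set α := ⟪N, ζ.1⟫
    -- The second coefficient is read off from q, which enters N' with factor 2/(ρ + 1). The first
    -- then follows from the vertical component b.
    refine ⟨b - (b - α) * (ρ + 1) / 2, (b - α) * (ρ + 1) / 2, Prod.ext ?_ ?_⟩
    · have : ζ.1 = α • N + (b - α) • q := by rw [← hy]; abel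
      rw [this]
      simp only [Prod.fst_add, Prod.smul_fst]
      match_scalars <;> field_simp
      ring
    · simp only [Prod.snd_add, Prod.smul_snd, smul_eq_mul, mul_one]
      ring

end NullDir

/-- The component of N tangent to `D₁` must be the gradient of the height. Spacelikeness bounds its
length by 1, and a unit vector normal to `D₁` and `p` fills up the rest. -/
theorem exists_nullDir (hD : ∀ v, ⟪p, (D v).1⟫ = 0)
    (hpos : ∀ v, v ≠ 0 → 0 < lorForm n (D v) (D v)) : ∃ N, NullDir p N D := by
  set D₁ := ContinuousLinearMap.fst ℝ _ _ ∘L D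
  have hD₁ : ∀ v, D₁ v = (D v).1 := fun v => rfl
  have hinj : Function.Injective D₁ := by
    refine (injective_iff_map_eq_zero _).2 fun v hv => by_contra fun hv0 => ?_
    have := hpos v hv0
    rw [lorForm_apply, ← hD₁, hv, inner_zero_left] at this
    nlinarith [mul_self_nonneg (D v).2]
  obtain ⟨z, hz⟩ := exists_gradient hinj (ContinuousLinearMap.snd ℝ _ _ ∘L D)
  replace hz : ∀ v, ⟪D₁ z, D₁ v⟫ = (D v).2 := hz
  -- With ρ = |D₁ z|² the height of D z is also ρ, so positivity of the metric at z reads ρ - ρ² >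
  -- 0.
  have hle : ⟪D₁ z, D₁ z⟫ ≤ 1 := by
    rcases eq_or_ne z 0 with rfl | hz0
    · simp
    · have := hpos z hz0
      rw [lorForm_apply, ← hD₁, ← hz z] at this
      nlinarith [real_inner_self_nonneg (x := D₁ z)]
  -- The range of `D₁` together with `p` spans at most n + 1 of the n + 2 dimensions.
  obtain ⟨m, hm1, hmp, hmD⟩ : ∃ m : Euc n, ⟪m, m⟫ = 1 ∧ ⟪m, p⟫ = 0 ∧ ∀ v, ⟪m, D₁ v⟫ = 0 := by
    let L := LinearMap.range D₁.toLinearMap ⊔ (ℝ ∙ p)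
    have hL : Lᗮ ≠ ⊥ := by
      intro hbot
      have h1 := L.finrank_add_finrank_orthogonal
      rw [hbot, finrank_bot, finrank_euclideanSpace_fin] at h1
      have h2 := Submodule.finrank_add_le_finrank_add_finrank (LinearMap.range D₁.toLinearMap)
        (ℝ ∙ p)
      have h3 := LinearMap.finrank_range_le D₁.toLinearMap
      have h4 := finrank_span_le_card (R := ℝ) ({p} : Set (Euc n))
      rw [finrank_euclideanSpace_fin] at h3
      simp only [Set.toFinset_singleton, Finset.card_singleton] at h4
      change _ + 0 = _ at h1
      change Module.finrank ℝ L ≤ _ at h2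
      omega
    obtain ⟨m, hm, hm0⟩ := Submodule.exists_mem_ne_zero_of_ne_bot hL
    rw [Submodule.mem_orthogonal'] at hm
    have hmn : ‖m‖ ≠ 0 := norm_ne_zero_iff.2 hm0
    refine ⟨‖m‖⁻¹ • m, ?_, ?_, fun v => ?_⟩
    · rw [real_inner_smul_left, real_inner_smul_right, real_inner_self_eq_norm_sq]
      field_simp
    · rw [real_inner_smul_left, hm p (Submodule.mem_sup_right (Submodule.mem_span_singleton_self p)),
        mul_zero]
    · rw [real_inner_smul_left, hm (D₁ v) (Submodule.mem_sup_left ⟨v, rfl⟩), mul_zero]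
  have hmz : ⟪D₁ z, m⟫ = 0 := by rw [real_inner_comm, hmD]
  have hsq := Real.mul_self_sqrt (sub_nonneg.2 hle)
  refine ⟨D₁ z + √(1 - ⟪D₁ z, D₁ z⟫) • m, ?_, ?_, fun v => ?_⟩
  · simp only [inner_add_left, inner_add_right, real_inner_smul_left, real_inner_smul_right, hm1,
      hmD, hmz]
    linarith
  · rw [inner_add_left, real_inner_smul_left, hmp, real_inner_comm, hD₁, hD]
    ring
  · rw [inner_add_left, real_inner_smul_left, ← hD₁, hmD, hz]
    ring

/-- A nonzero null vector normal to `D` is proportional to a null direction. -/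
theorem nullDir_of_null {ζ : Euc n × ℝ} (h0 : ζ ≠ 0) (hnull : lorForm n ζ ζ = 0)
    (hp : ⟪p, ζ.1⟫ = 0) (hD : ∀ v, lorForm n ζ (D v) = 0) :
    ζ.2 ≠ 0 ∧ NullDir p (ζ.2⁻¹ • ζ.1) D := by
  have hζ : ζ.2 ≠ 0 := by
    intro h
    rw [lorForm_apply, h, mul_zero, sub_zero, inner_self_eq_zero] at hnull
    exact h0 (Prod.ext hnull h)
  rw [lorForm_apply, sub_eq_zero] at hnull
  refine ⟨hζ, ?_, ?_, fun v => ?_⟩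
  · rw [real_inner_smul_left, real_inner_smul_right, hnull]
    field_simp
  · rw [real_inner_smul_left, real_inner_comm, hp, mul_zero]
  · have := hD v
    rw [lorForm_apply, sub_eq_zero] at this
    rw [real_inner_smul_left, this]
    field_simp

end NullDir

/-! ### Orthogonal projections -/

section OrthProj

variable {V : Type*} [NormedAddCommGroup V] [NormedSpace ℝ V] {B : LinearMap.BilinForm ℝ V}
  {S : Submodule ℝ V}

theorem orthProj_mem (u : V) : orthProj B S u ∈ S := by
  rw [orthProj]
  split_ifs with h
  · exact h.choose_spec.1
  · exact S.zero_mem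

theorem orthProj_spec {u : V} (h : ∃ ξ ∈ S, ∀ η ∈ S, B ξ η = B u η) {η : V} (hη : η ∈ S) :
    B (orthProj B S u) η = B u η := by
  rw [orthProj, dif_pos h]
  exact h.choose_spec.2 η hη

/-- Projection to a plane spanned by two null vectors. -/
theorem exists_orthProj_of_null {ξ η : V} (hξ : ξ ∈ S) (hη : η ∈ S) (hξξ : B ξ ξ = 0)
    (hηη : B η η = 0) (hξη : B ξ η ≠ 0) (hB : B.IsSymm)
    (hspan : ∀ ζ ∈ S, ∃ α β : ℝ, ζ = α • ξ + β • η) (u : V) :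
    ∃ ξ ∈ S, ∀ η ∈ S, B ξ η = B u η := by
  have hηξ : B η ξ = B ξ η := hB.eq η ξ
  refine ⟨(B u η / B ξ η) • ξ + (B u ξ / B ξ η) • η,
    S.add_mem (S.smul_mem _ hξ) (S.smul_mem _ hη), fun ζ hζ => ?_⟩
  obtain ⟨α, β, rfl⟩ := hspan ζ hζ
  simp only [map_add, map_smul, LinearMap.add_apply, LinearMap.smul_apply, smul_eq_mul, hξξ, hηη,
    hηξ]
  field_simp
  ring

end OrthProj

/-! ### Implicit functions -/

theorem isInvertible_of_injective {X Y : Type*} [NormedAddCommGroup X] [NormedSpace ℝ X]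
    [FiniteDimensional ℝ X] [NormedAddCommGroup Y] [NormedSpace ℝ Y] [FiniteDimensional ℝ Y]
    {L : X →L[ℝ] Y} (hL : Function.Injective L)
    (hdim : Module.finrank ℝ X = Module.finrank ℝ Y) : L.IsInvertible :=
  ⟨(LinearEquiv.ofInjectiveOfFinrankEq L.toLinearMap hL hdim).toContinuousLinearEquiv, by
    ext v; rfl⟩

/-- With equal dimensions, injectivity of the partial derivative suffices. The last clause is local
uniqueness; through it, solutions known only to be continuous inherit the regularity of ψ. -/
theorem exists_implicit {Z X Y : Type*} [NormedAddCommGroup Z] [NormedSpace ℝ Z] [CompleteSpace Z]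
    [NormedAddCommGroup X] [NormedSpace ℝ X] [FiniteDimensional ℝ X] [NormedAddCommGroup Y]
    [NormedSpace ℝ Y] [FiniteDimensional ℝ Y] (hdim : Module.finrank ℝ X = Module.finrank ℝ Y)
    {k : WithTop ℕ∞} (hk : k ≠ 0) {G : Z × X → Y} {z : Z} {u : X} (hG : ContDiffAt ℝ k G (z, u))
    (h0 : G (z, u) = 0) {L : X →L[ℝ] Y} (hL : HasFDerivAt (fun u => G (z, u)) L u)
    (hinj : Function.Injective L) :
    ∃ ψ : Z → X, ContDiffAt ℝ k ψ z ∧ ψ z = u ∧ (∀ᶠ y in 𝓝 z, G (y, ψ y) = 0) ∧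
      ∀ᶠ w in 𝓝 (z, u), G w = 0 → w.2 = ψ w.1 := by
  have : CompleteSpace X := FiniteDimensional.complete ℝ X
  have : CompleteSpace Y := FiniteDimensional.complete ℝ Y
  have hinv : (fderiv ℝ G (z, u) ∘L .inr ℝ Z X).IsInvertible := by
    have h1 : HasFDerivAt (fun u => G (z, u)) (fderiv ℝ G (z, u) ∘L .inr ℝ Z X) u :=
      HasFDerivAt.comp (g := G) u (hG.differentiableAt hk).hasFDerivAt
        (hasFDerivAt_prodMk_right z u)
    rw [h1.unique hL]
    exact isInvertible_of_injective hinj hdim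
  refine ⟨hG.implicitFunction hk hinv, hG.contDiffAt_implicitFunction hk hinv,
    hG.implicitFunction_apply_self hk hinv, ?_, ?_⟩
  · have := hG.eventually_apply_implicitFunction hk hinv
    rwa [h0] at this
  · filter_upwards [hG.eventually_apply_eq_iff_implicitFunction hk hinv] with w hw hw0
    exact (hw.1 (hw0.trans h0.symm)).symm

/-! ### Charts -/

section Charts

variable {n : ℕ} {M : Type*} [TopologicalSpace M] [ChartedSpace (EuclideanSpace ℝ (Fin n)) M]
variable {V : Type*} [NormedAddCommGroup V] [NormedSpace ℝ V]

/-- The map `f` in the preferred chart at `x`. -/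
def inChart (x : M) (f : M → V) : EuclideanSpace ℝ (Fin n) → V :=
  f ∘ (extChartAt (𝓡 n) x).symm

theorem inChart_apply_self (x : M) (f : M → V) : inChart x f (extChartAt (𝓡 n) x x) = f x := by
  rw [inChart, Function.comp_apply, extChartAt_to_inv]

theorem inChart_apply {x y : M} (hy : y ∈ (extChartAt (𝓡 n) x).source) (f : M → V) :
    inChart x f (extChartAt (𝓡 n) x y) = f y := by
  rw [inChart, Function.comp_apply, PartialEquiv.left_inv _ hy]

theorem eventually_inChart {x : M} {p : M → Prop} (h : ∀ᶠ y in 𝓝 x, p y) :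
    ∀ᶠ z in 𝓝 (extChartAt (𝓡 n) x x), p ((extChartAt (𝓡 n) x).symm z) := by
  have := continuousAt_extChartAt_symm (I := 𝓡 n) x
  rw [ContinuousAt, extChartAt_to_inv] at this
  exact this.eventually h

theorem eventually_of_inChart {x : M} {p : EuclideanSpace ℝ (Fin n) → Prop}
    (h : ∀ᶠ z in 𝓝 (extChartAt (𝓡 n) x x), p z) :
    ∀ᶠ y in 𝓝 x, y ∈ (extChartAt (𝓡 n) x).source ∧ p (extChartAt (𝓡 n) x y) :=
  Filter.Eventually.and (extChartAt_source_mem_nhds (I := 𝓡 n) x)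
    ((continuousAt_extChartAt (I := 𝓡 n) x).eventually h)

variable [IsManifold (𝓡 n) ∞ M]

theorem contDiffAt_inChart {k : WithTop ℕ∞} (hk : k ≤ ∞) {f : M → V} {x y : M}
    (hy : y ∈ (extChartAt (𝓡 n) x).source) (hf : ContMDiffAt (𝓡 n) 𝓘(ℝ, V) k f y) :
    ContDiffAt ℝ k (inChart x f) (extChartAt (𝓡 n) x y) := by
  have : IsManifold (𝓡 n) k M := IsManifold.of_le hk
  rw [← contMDiffAt_iff_contDiffAt]
  have h1 : ContMDiffAt 𝓘(ℝ, EuclideanSpace ℝ (Fin n)) (𝓡 n) k (extChartAt (𝓡 n) x).symm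
      (extChartAt (𝓡 n) x y) :=
    (contMDiffOn_extChartAt_symm x).contMDiffAt
      ((isOpen_extChartAt_target x).mem_nhds ((extChartAt (𝓡 n) x).map_source hy))
  refine ContMDiffAt.comp (g := f) _ ?_ h1
  rwa [PartialEquiv.left_inv _ hy]

theorem contMDiffAt_comp_extChartAt {k : WithTop ℕ∞} (hk : k ≤ ∞)
    {g : EuclideanSpace ℝ (Fin n) → V} {x y : M} (hy : y ∈ (extChartAt (𝓡 n) x).source)
    (hg : ContDiffAt ℝ k g (extChartAt (𝓡 n) x y)) :
    ContMDiffAt (𝓡 n) 𝓘(ℝ, V) k (fun w => g (extChartAt (𝓡 n) x w)) y := by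
  have : IsManifold (𝓡 n) k M := IsManifold.of_le hk
  have h1 : ContMDiffAt (𝓡 n) 𝓘(ℝ, EuclideanSpace ℝ (Fin n)) k (extChartAt (𝓡 n) x) y :=
    contMDiffAt_extChartAt' (by rwa [extChartAt_source] at hy)
  exact (contMDiffAt_iff_contDiffAt.2 hg).comp y h1

theorem diff_eq_fderiv {f : M → V} {x : M} (hf : MDifferentiableAt (𝓡 n) 𝓘(ℝ, V) f x) :
    diff f x = fderiv ℝ (inChart x f) (extChartAt (𝓡 n) x x) := by
  refine hf.mfderiv.trans ?_
  simp only [writtenInExtChartAt, extChartAt_model_space_eq_id, PartialEquiv.refl_coe,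
    Function.id_comp, modelWithCornersSelf_coe, Set.range_id, fderivWithin_univ]
  rfl

theorem hasFDerivAt_inChart {f : M → V} {x : M} (hf : ContMDiffAt (𝓡 n) 𝓘(ℝ, V) 1 f x) :
    HasFDerivAt (inChart x f) (diff f x) (extChartAt (𝓡 n) x x) := by
  rw [diff_eq_fderiv (hf.mdifferentiableAt one_ne_zero)]
  exact ((contDiffAt_inChart (by exact_mod_cast le_top) (mem_extChartAt_source x)
    hf).differentiableAt one_ne_zero).hasFDerivAt

/-- The change of coordinates from the preferred chart at `y` to the one at `x`. -/
theorem exists_diff_eq {x y : M} (hy : y ∈ (extChartAt (𝓡 n) x).source) :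
    ∃ T : EuclideanSpace ℝ (Fin n) ≃L[ℝ] EuclideanSpace ℝ (Fin n),
      ∀ (V : Type) [NormedAddCommGroup V] [NormedSpace ℝ V] (f : M → V),
        ContMDiffAt (𝓡 n) 𝓘(ℝ, V) 1 f y → diff f y =
          fderiv ℝ (inChart x f) (extChartAt (𝓡 n) x y) ∘L
            (T : EuclideanSpace ℝ (Fin n) →L[ℝ] EuclideanSpace ℝ (Fin n)) := by
  obtain ⟨T, hT⟩ := isInvertible_mfderiv_extChartAt (I := 𝓡 n) hy
  refine ⟨T, fun V _ _ f hf => ?_⟩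
  have h1 : MDifferentiableAt (𝓡 n) 𝓘(ℝ, EuclideanSpace ℝ (Fin n)) (extChartAt (𝓡 n) x) y :=
    mdifferentiableAt_extChartAt (by rwa [extChartAt_source] at hy)
  have h2 : DifferentiableAt ℝ (inChart x f) (extChartAt (𝓡 n) x y) :=
    (contDiffAt_inChart (by exact_mod_cast le_top) hy hf).differentiableAt one_ne_zero
  have h3 : f =ᶠ[𝓝 y] inChart x f ∘ extChartAt (𝓡 n) x := by
    filter_upwards [(isOpen_extChartAt_source (I := 𝓡 n) x).mem_nhds hy] with w hw
    exact (inChart_apply hw f).symm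
  rw [diff, h3.mfderiv_eq, mfderiv_comp y h2.mdifferentiableAt h1, mfderiv_eq_fderiv, ← hT]
  rfl

end Charts

/-! ### Null normal fields -/

section NullField

variable {n : ℕ} {M : Type*} [TopologicalSpace M] [ChartedSpace (EuclideanSpace ℝ (Fin n)) M]
  [IsManifold (𝓡 n) ∞ M]
variable {F : M → Euc n × ℝ} {N : M → Euc n} {x : M}

theorem natCast_le_infty (k : ℕ) : (k : WithTop ℕ∞) ≤ ∞ := by exact_mod_cast le_top

theorem eventually_contMDiffAt {V : Type*} [NormedAddCommGroup V] [NormedSpace ℝ V] {k : ℕ}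
    {f : M → V} (hf : ContMDiffAt (𝓡 n) 𝓘(ℝ, V) k f x) :
    ∀ᶠ y in 𝓝 x, ContMDiffAt (𝓡 n) 𝓘(ℝ, V) k f y := by
  have : IsManifold (𝓡 n) (k : WithTop ℕ∞) M :=
    IsManifold.of_le (n := ∞) (natCast_le_infty k)
  exact (contMDiffAt_iff_contMDiffAt_nhds (by simp)).1 hf

theorem diff_eq_of_hasFDerivAt {V : Type*} [NormedAddCommGroup V] [NormedSpace ℝ V] {f : M → V}
    (hf : ContMDiffAt (𝓡 n) 𝓘(ℝ, V) 1 f x) {L : EuclideanSpace ℝ (Fin n) →L[ℝ] V}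
    (h : HasFDerivAt (inChart x f) L (extChartAt (𝓡 n) x x)) : diff f x = L :=
  (hasFDerivAt_inChart hf).unique h

theorem diff_fst (hF : ContMDiffAt (𝓡 n) 𝓘(ℝ, Euc n × ℝ) 1 F x) :
    diff (n := n) (fun y => (F y).1) x = ContinuousLinearMap.fst ℝ _ _ ∘L diff F x :=
  diff_eq_of_hasFDerivAt ((contMDiffAt_iff_contDiffAt.2 contDiffAt_fst).comp x hF)
    (hasFDerivAt_inChart hF).fst

theorem diff_snd (hF : ContMDiffAt (𝓡 n) 𝓘(ℝ, Euc n × ℝ) 1 F x) :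
    diff (n := n) (fun y => (F y).2) x = ContinuousLinearMap.snd ℝ _ _ ∘L diff F x :=
  diff_eq_of_hasFDerivAt ((contMDiffAt_iff_contDiffAt.2 contDiffAt_snd).comp x hF)
    (hasFDerivAt_inChart hF).snd

theorem contMDiffAt_fst {k : WithTop ℕ∞} (hF : ContMDiffAt (𝓡 n) 𝓘(ℝ, Euc n × ℝ) k F x) :
    ContMDiffAt (𝓡 n) 𝓘(ℝ, Euc n) k (fun y => (F y).1) x :=
  (contMDiffAt_iff_contDiffAt.2 contDiffAt_fst).comp x hF

theorem contMDiffAt_snd {k : WithTop ℕ∞} (hF : ContMDiffAt (𝓡 n) 𝓘(ℝ, Euc n × ℝ) k F x) :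
    ContMDiffAt (𝓡 n) 𝓘(ℝ, ℝ) k (fun y => (F y).2) x :=
  (contMDiffAt_iff_contDiffAt.2 contDiffAt_snd).comp x hF

theorem inner_diff_add_inner_diff {f g : M → Euc n} (hf : ContMDiffAt (𝓡 n) 𝓘(ℝ, Euc n) 1 f x)
    (hg : ContMDiffAt (𝓡 n) 𝓘(ℝ, Euc n) 1 g x) {c : ℝ} (h : ∀ᶠ y in 𝓝 x, ⟪f y, g y⟫ = c)
    (v : EuclideanSpace ℝ (Fin n)) : ⟪f x, diff g x v⟫ + ⟪diff f x v, g x⟫ = 0 := by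
  have h1 := (hasFDerivAt_inChart hf).inner ℝ (hasFDerivAt_inChart hg)
  have h2 : (fun z => ⟪inChart x f z, inChart x g z⟫) =ᶠ[𝓝 (extChartAt (𝓡 n) x x)] fun _ => c :=
    eventually_inChart h
  have h3 := h1.unique ((hasFDerivAt_const c _).congr_of_eventuallyEq h2)
  rw [inChart_apply_self, inChart_apply_self] at h3
  simpa using DFunLike.congr_fun h3 v

theorem inner_base_diff (hF : ContMDiffAt (𝓡 n) 𝓘(ℝ, Euc n × ℝ) 1 F x)
    (hunit : ∀ᶠ y in 𝓝 x, ‖(F y).1‖ = 1) (v : EuclideanSpace ℝ (Fin n)) :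
    ⟪(F x).1, (diff F x v).1⟫ = 0 := by
  have h1 := inner_diff_add_inner_diff (contMDiffAt_fst hF) (contMDiffAt_fst hF) (c := 1)
    (hunit.mono fun y hy => by rw [real_inner_self_eq_norm_sq, hy, one_pow]) v
  rw [diff_fst hF, real_inner_comm (F x).1] at h1
  change ⟪(F x).1, (diff F x v).1⟫ + ⟪(F x).1, (diff F x v).1⟫ = 0 at h1
  linarith

/-- The derivative of the null normal field `(N, 1)` along `F`, tangent to the sphere. -/
def twist (F : M → Euc n × ℝ) (N : M → Euc n) (x : M) : EuclideanSpace ℝ (Fin n) →L[ℝ] Euc n :=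
  diff N x + (ContinuousLinearMap.snd ℝ _ _ ∘L diff F x).smulRight (F x).1

theorem twist_apply (v : EuclideanSpace ℝ (Fin n)) :
    twist F N x v = diff N x v + (diff F x v).2 • (F x).1 := rfl

theorem NullDir.comp_iff {p q : Euc n} {D : EuclideanSpace ℝ (Fin n) →L[ℝ] Euc n × ℝ}
    (T : EuclideanSpace ℝ (Fin n) ≃L[ℝ] EuclideanSpace ℝ (Fin n)) :
    NullDir p q (D ∘L (T : EuclideanSpace ℝ (Fin n) →L[ℝ] EuclideanSpace ℝ (Fin n))) ↔
      NullDir p q D := by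
  refine ⟨fun h => ⟨h.unit, h.perp, fun v => ?_⟩, fun h => ⟨h.unit, h.perp, fun v => h.normal _⟩⟩
  simpa using h.normal (T.symm v)

/-- `(N, 1)` is a null normal field near `x`. -/
structure IsNullField (F : M → Euc n × ℝ) (N : M → Euc n) (x : M) : Prop where
  contMDiffAt : ContMDiffAt (𝓡 n) 𝓘(ℝ, Euc n × ℝ) 2 F x
  base_unit : ∀ᶠ y in 𝓝 x, ‖(F y).1‖ = 1
  field_contMDiffAt : ContMDiffAt (𝓡 n) 𝓘(ℝ, Euc n) 1 N x
  nullDir : ∀ᶠ y in 𝓝 x, NullDir (F y).1 (N y) (diff F y)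
  injective : ∀ᶠ y in 𝓝 x, Function.Injective (reduced (diff F y) (N y))

namespace IsNullField

theorem eventually (h : IsNullField F N x) : ∀ᶠ y in 𝓝 x, IsNullField F N y := by
  filter_upwards [eventually_contMDiffAt (k := 2) h.contMDiffAt, h.base_unit.eventually_nhds,
    eventually_contMDiffAt (k := 1) h.field_contMDiffAt, h.nullDir.eventually_nhds,
    h.injective.eventually_nhds] with y h1 h2 h3 h4 h5
  exact ⟨h1, h2, h3, h4, h5⟩

theorem contMDiffAt_one (h : IsNullField F N x) : ContMDiffAt (𝓡 n) 𝓘(ℝ, Euc n × ℝ) 1 F x :=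
  h.contMDiffAt.of_le one_le_two

theorem inner_base (h : IsNullField F N x) : ⟪(F x).1, (F x).1⟫ = 1 := by
  rw [real_inner_self_eq_norm_sq, h.base_unit.self_of_nhds, one_pow]

theorem inner_base_diff (h : IsNullField F N x) (v : EuclideanSpace ℝ (Fin n)) :
    ⟪(F x).1, (diff F x v).1⟫ = 0 :=
  MarginallyTrapped.inner_base_diff h.contMDiffAt_one h.base_unit v

theorem inner_field_diff (h : IsNullField F N x) (v : EuclideanSpace ℝ (Fin n)) :
    ⟪N x, diff N x v⟫ = 0 := by
  have h1 := inner_diff_add_inner_diff h.field_contMDiffAt h.field_contMDiffAt (c := 1)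
    (h.nullDir.mono fun y hy => hy.unit) v
  rw [real_inner_comm (N x)] at h1
  linarith

theorem inner_base_diff_field (h : IsNullField F N x) (v : EuclideanSpace ℝ (Fin n)) :
    ⟪(F x).1, diff N x v⟫ = -(diff F x v).2 := by
  have h1 := inner_diff_add_inner_diff h.field_contMDiffAt (contMDiffAt_fst h.contMDiffAt_one)
    (c := 0) (h.nullDir.mono fun y hy => hy.perp) v
  rw [diff_fst h.contMDiffAt_one] at h1
  change ⟪N x, (diff F x v).1⟫ + ⟪diff N x v, (F x).1⟫ = 0 at h1
  rw [h.nullDir.self_of_nhds.normal] at h1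
  rw [real_inner_comm]
  linarith

theorem inner_field_twist (h : IsNullField F N x) (v : EuclideanSpace ℝ (Fin n)) :
    ⟪N x, twist F N x v⟫ = 0 := by
  rw [twist_apply, inner_add_right, real_inner_smul_right, h.inner_field_diff,
    h.nullDir.self_of_nhds.perp]
  ring

theorem inner_base_twist (h : IsNullField F N x) (v : EuclideanSpace ℝ (Fin n)) :
    ⟪(F x).1, twist F N x v⟫ = 0 := by
  rw [twist_apply, inner_add_right, real_inner_smul_right, h.inner_base_diff_field, h.inner_base]
  ring

/-- The twist is orthogonal to F₁ and to N, and by dimension the complement of these two is the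
range of `reduced`. Hence the trace of the twist relative to `reduced` makes sense. -/
theorem exists_twist_eq (h : IsNullField F N x) (v : EuclideanSpace ℝ (Fin n)) :
    ∃ u, twist F N x v = reduced (diff F x) (N x) u :=
  mem_range_of_perp h.injective.self_of_nhds h.inner_base h.nullDir.self_of_nhds.unit
    h.nullDir.self_of_nhds.perp
    (h.nullDir.self_of_nhds.inner_base_reduced h.inner_base_diff)
    h.nullDir.self_of_nhds.inner_reduced_left (h.inner_base_twist v) (h.inner_field_twist v)

/-- Differentiate ⟨N, dF₁ w⟩ = dt w along v in a fixed chart. Passing from dN and dF₁ to `twist` and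
`reduced` changes nothing, as F₁ is orthogonal to dF₁ and N, and N to dN. -/
theorem lorForm_diff2 (h : IsNullField F N x) (v w : EuclideanSpace ℝ (Fin n)) :
    lorForm n (diff2 F x v w) (N x, 1) = -⟪twist F N x v, reduced (diff F x) (N x) w⟫ := by
  have hf := contDiffAt_inChart (natCast_le_infty 2) (mem_extChartAt_source x) h.contMDiffAt
  obtain ⟨f'', hf', hf''⟩ : ∃ f'', HasFDerivAt (fderiv ℝ (inChart x F)) f''
      (extChartAt (𝓡 n) x x) ∧ f'' v w = diff2 F x v w :=
    ⟨_, ((hf.fderiv_right (m := 1) (by norm_num)).differentiableAt one_ne_zero).hasFDerivAt, rfl⟩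
  have hfw := hf'.clm_apply (hasFDerivAt_const w _)
  have hN := hasFDerivAt_inChart h.field_contMDiffAt
  have hzero : (fun z => ⟪inChart x N z, (fderiv ℝ (inChart x F) z w).1⟫ -
      (fderiv ℝ (inChart x F) z w).2) =ᶠ[𝓝 (extChartAt (𝓡 n) x x)] fun _ => 0 := by
    filter_upwards [eventually_inChart (h.nullDir.and
      ((eventually_contMDiffAt (k := 1) h.contMDiffAt_one))),
      extChartAt_target_mem_nhds (I := 𝓡 n) x] with z hz hzt
    obtain ⟨T, hT⟩ := exists_diff_eq ((extChartAt (𝓡 n) x).map_target hzt)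
    have h1 := hz.1
    rw [hT _ F hz.2, NullDir.comp_iff, PartialEquiv.right_inv _ hzt] at h1
    have h2 := h1.normal w
    exact sub_eq_zero.2 h2
  have h1 := ((hN.inner ℝ hfw.fst).sub hfw.snd).unique
    ((hasFDerivAt_const (0 : ℝ) _).congr_of_eventuallyEq hzero)
  have hD : fderiv ℝ (inChart x F) (extChartAt (𝓡 n) x x) = diff F x :=
    (diff_eq_fderiv (h.contMDiffAt_one.mdifferentiableAt one_ne_zero)).symm
  rw [inChart_apply_self, hD] at h1
  have h2 : ⟪N x, (f'' v w).1⟫ + ⟪diff N x v, (diff F x w).1⟫ - (f'' v w).2 = 0 := by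
    simpa using DFunLike.congr_fun h1 v
  rw [hf''] at h2
  rw [twist_apply, reduced_apply, lorForm_apply, inner_add_left, inner_sub_right, inner_sub_right,
    real_inner_smul_left, real_inner_smul_left, real_inner_smul_right, real_inner_smul_right,
    h.inner_base_diff, real_inner_comm (N x) (F x).1, h.nullDir.self_of_nhds.perp,
    real_inner_comm (N x) (diff N x v), h.inner_field_diff, real_inner_comm (N x) (diff2 F x v w).1]
  linarith

end IsNullField

end NullField

/-! ### Mean curvature and second fundamental form against null normals -/

section NullField

variable {n : ℕ} {M : Type*} [TopologicalSpace M] [ChartedSpace (EuclideanSpace ℝ (Fin n)) M]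
  [IsManifold (𝓡 n) ∞ M]
variable {F : M → Euc n × ℝ} {N : M → Euc n} {x : M}

theorem mem_normalSpace {ζ : Euc n × ℝ} :
    ζ ∈ normalSpace n (lorForm n) (productTangent n) F x ↔
      ⟪(F x).1, ζ.1⟫ = 0 ∧ ∀ v : EuclideanSpace ℝ (Fin n), lorForm n ζ (diff F x v) = 0 := by
  have h1 : ζ ∈ productTangent n (F x) ↔ ⟪(F x).1, ζ.1⟫ = 0 := by
    rw [productTangent, Submodule.mem_prod, sphereTangent,
      Submodule.mem_orthogonal_singleton_iff_inner_right]
    simp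
  rw [normalSpace, Submodule.mem_inf, h1]
  refine and_congr_right fun _ => ⟨fun h v => ?_, ?_⟩
  · have := h (diff F x v) ⟨v, rfl⟩
    rw [lorForm_apply] at this ⊢
    rw [real_inner_comm, mul_comm]
    exact this
  · rintro h _ ⟨v, rfl⟩
    have := h v
    change lorForm n (diff F x v) ζ = 0
    rw [lorForm_apply] at this ⊢
    rw [real_inner_comm, mul_comm]
    exact this

theorem lorForm_isSymm : (lorForm n).IsSymm := ⟨fun u v => by
  rw [lorForm_apply, lorForm_apply, real_inner_comm, mul_comm]⟩

theorem NullDir.mem_normalSpace {q : Euc n} (h : NullDir (F x).1 q (diff F x)) :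
    (q, (1 : ℝ)) ∈ normalSpace n (lorForm n) (productTangent n) F x := by
  rw [MarginallyTrapped.mem_normalSpace]
  refine ⟨(real_inner_comm _ _).trans h.perp, fun v => ?_⟩
  rw [lorForm_apply, h.normal]
  ring

/-- Two distinct null directions span the normal space. -/
theorem NullDir.pair {p q q' : Euc n} {D : EuclideanSpace ℝ (Fin n) →L[ℝ] Euc n × ℝ}
    (h : NullDir p q D) (h' : NullDir p q' D) (hne : q ≠ q') (hp : ⟪p, p⟫ = 1)
    (hD : ∀ v, ⟪p, (D v).1⟫ = 0) (hinj : Function.Injective (reduced D q)) :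
    lorForm n (q, 1) (q', 1) ≠ 0 ∧
      ∀ ζ : Euc n × ℝ, ⟪p, ζ.1⟫ = 0 → (∀ v, lorForm n ζ (D v) = 0) →
        ∃ α β : ℝ, ζ = α • (q, 1) + β • (q', 1) := by
  obtain ⟨r, hr, hne', hspan⟩ := h.exists_other hp hD hinj
  suffices q' = r by rw [this]; exact ⟨hne', hspan⟩
  obtain ⟨α, β, hαβ⟩ := hspan (q', 1) ((real_inner_comm _ _).trans h'.perp) fun v => by
    rw [lorForm_apply, h'.normal]; ring
  have h1 : (1 : ℝ) = α + β := by simpa using congrArg Prod.snd hαβ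
  have h2 : q' = α • q + β • r := by simpa using congrArg Prod.fst hαβ
  have h3 := h'.null
  rw [hαβ] at h3
  simp only [map_add, map_smul, LinearMap.add_apply, LinearMap.smul_apply, smul_eq_mul, h.null,
    hr.null, lorForm_isSymm.eq (r, 1) (q, 1)] at h3
  -- For a combination of two null vectors the square is 2αβ times their product, so a null one lies
  -- on one of the two lines.
  have h4 : α * β * lorForm n (q, 1) (r, 1) = 0 := by
    linarith
  rcases mul_eq_zero.1 (or_iff_left hne' |>.1 (mul_eq_zero.1 h4)) with h5 | h5
  · rw [h5, zero_add] at h1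
    rw [h2, h5, ← h1, zero_smul, one_smul, zero_add]
  · rw [h5, add_zero] at h1
    rw [h5, ← h1, zero_smul, one_smul, add_zero] at h2
    exact absurd h2.symm hne

namespace IsNullField

theorem exists_orthProj (h : IsNullField F N x) (u : Euc n × ℝ) :
    ∃ ξ ∈ normalSpace n (lorForm n) (productTangent n) F x,
      ∀ η ∈ normalSpace n (lorForm n) (productTangent n) F x,
        lorForm n ξ η = lorForm n u η := by
  obtain ⟨r, hr, hne, hspan⟩ := h.nullDir.self_of_nhds.exists_other h.inner_base h.inner_base_diff
    h.injective.self_of_nhds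
  refine exists_orthProj_of_null h.nullDir.self_of_nhds.mem_normalSpace hr.mem_normalSpace
    h.nullDir.self_of_nhds.null hr.null hne lorForm_isSymm (fun ζ hζ => ?_) u
  rw [mem_normalSpace] at hζ
  exact hspan ζ hζ.1 hζ.2

theorem lorForm_secondForm (h : IsNullField F N x) (v w : EuclideanSpace ℝ (Fin n))
    {ζ : Euc n × ℝ} (hζ : ζ ∈ normalSpace n (lorForm n) (productTangent n) F x) :
    lorForm n (secondFormL F x v w) ζ = lorForm n (diff2 F x v w) ζ :=
  orthProj_spec (h.exists_orthProj _) hζ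

theorem lorForm_secondForm_field (h : IsNullField F N x) (v w : EuclideanSpace ℝ (Fin n)) :
    lorForm n (secondFormL F x v w) (N x, 1) =
      -⟪twist F N x v, reduced (diff F x) (N x) w⟫ := by
  rw [h.lorForm_secondForm v w h.nullDir.self_of_nhds.mem_normalSpace, h.lorForm_diff2]

/-- Writing `twist` as `reduced` composed with R gives ⟨h(v, w), (N, 1)⟩ = -⟨P R v, P w⟩, where P is
`reduced` and induces the metric of F. The metric trace is therefore -tr R. -/
theorem lorForm_meanCurvature (h : IsNullField F N x) :
    lorForm n (meanCurvatureL F x) (N x, 1) =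
      -relTrace (reduced (diff F x) (N x)) (twist F N x) := by
  obtain ⟨R, hR⟩ := exists_comp_eq h.injective.self_of_nhds h.exists_twist_eq
  have h1 := sum_inv_gram_mul h.injective.self_of_nhds R (G := gram (lorForm n) F x)
    (c := Matrix.of fun i j => ⟪reduced (diff F x) (N x) (R (EuclideanSpace.single i 1)),
      reduced (diff F x) (N x) (EuclideanSpace.single j 1)⟫)
    (fun i j => (h.nullDir.self_of_nhds.inner_reduced _ _).symm) fun i j => rfl
  rw [hR, relTrace_comp h.injective.self_of_nhds, ← h1, meanCurvatureL, meanCurvature]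
  simp only [map_sum, map_smul, LinearMap.sum_apply, LinearMap.smul_apply, smul_eq_mul]
  rw [← Finset.sum_neg_distrib]
  refine Finset.sum_congr rfl fun i _ => ?_
  rw [← Finset.sum_neg_distrib]
  refine Finset.sum_congr rfl fun j _ => ?_
  rw [h.lorForm_secondForm_field, hR, mul_neg]
  rfl

end IsNullField

theorem meanCurvature_mem (x : M) :
    meanCurvatureL F x ∈ normalSpace n (lorForm n) (productTangent n) F x :=
  Submodule.sum_mem _ fun _ _ => Submodule.sum_mem _ fun _ _ =>
    Submodule.smul_mem _ _ (orthProj_mem _)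

/-- A null vector of the normal space is orthogonal to one of two distinct null directions, and
conversely. -/
theorem null_iff {q q' : Euc n} (h : NullDir (F x).1 q (diff F x))
    (h' : NullDir (F x).1 q' (diff F x)) (hne : q ≠ q') (hp : ⟪(F x).1, (F x).1⟫ = 1)
    (hD : ∀ v : EuclideanSpace ℝ (Fin n), ⟪(F x).1, (diff F x v).1⟫ = 0)
    (hinj : Function.Injective (reduced (diff F x) q))
    {ζ : Euc n × ℝ} (hζ : ζ ∈ normalSpace n (lorForm n) (productTangent n) F x) :
    lorForm n ζ ζ = 0 ↔ lorForm n ζ (q, 1) = 0 ∨ lorForm n ζ (q', 1) = 0 := by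
  obtain ⟨hne', hspan⟩ := h.pair h' hne hp hD hinj
  rw [mem_normalSpace] at hζ
  obtain ⟨α, β, rfl⟩ := hspan ζ hζ.1 hζ.2
  have hs : lorForm n (q', (1 : ℝ)) (q, 1) = lorForm n (q, 1) (q', 1) := lorForm_isSymm.eq _ _
  simp only [map_add, map_smul, LinearMap.add_apply, LinearMap.smul_apply, smul_eq_mul, h.null,
    h'.null, hs, mul_zero, zero_add, add_zero, mul_eq_zero, hne', or_false]
  have h1 : α * (β * lorForm n (q, 1) (q', 1)) + β * (α * lorForm n (q, 1) (q', 1)) =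
      2 * (β * α) * lorForm n (q, 1) (q', 1) := by ring
  rw [h1, mul_eq_zero, or_iff_left hne', mul_eq_zero, mul_eq_zero]
  simp

theorem reduced_comp (D : EuclideanSpace ℝ (Fin n) →L[ℝ] Euc n × ℝ) (q : Euc n)
    (T : EuclideanSpace ℝ (Fin n) →L[ℝ] EuclideanSpace ℝ (Fin n)) :
    reduced (D ∘L T) q = reduced D q ∘L T := rfl

theorem contDiffAt_reduced {X : Type*} [NormedAddCommGroup X] [NormedSpace ℝ X]
    {k : WithTop ℕ∞} {D : X → EuclideanSpace ℝ (Fin n) →L[ℝ] Euc n × ℝ} {q : X → Euc n} {z : X}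
    (hD : ContDiffAt ℝ k D z) (hq : ContDiffAt ℝ k q z) :
    ContDiffAt ℝ k (fun y => reduced (D y) (q y)) z :=
  (contDiffAt_const.clm_comp hD).sub ((contDiffAt_const.clm_comp hD).smulRight hq)

/-- A null normal vector extends to a smooth null normal field, unique among the continuous
ones. -/
theorem exists_nullField {k : ℕ} (hk : k ≠ 0)
    (hF : ContMDiffAt (𝓡 n) 𝓘(ℝ, Euc n × ℝ) ((k + 1 : ℕ) : WithTop ℕ∞) F x)
    (hunit : ∀ᶠ y in 𝓝 x, ‖(F y).1‖ = 1) {q : Euc n} (hq : NullDir (F x).1 q (diff F x))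
    (hinj : Function.Injective (reduced (diff F x) q)) :
    ∃ N : M → Euc n, N x = q ∧ ContMDiffAt (𝓡 n) 𝓘(ℝ, Euc n) k N x ∧ IsNullField F N x ∧
      ∀ N' : M → Euc n, ContinuousAt N' x → N' x = q →
        (∀ᶠ y in 𝓝 x, NullDir (F y).1 (N' y) (diff F y)) → N' =ᶠ[𝓝 x] N := by
  set z := extChartAt (𝓡 n) x x
  set f : EuclideanSpace ℝ (Fin n) → Euc n × ℝ := inChart x F
  have hk1 : (1 : WithTop ℕ∞) ≤ k := by exact_mod_cast Nat.one_le_iff_ne_zero.2 hk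
  have hk2 : (k : WithTop ℕ∞) ≤ (k + 1 : ℕ) := by exact_mod_cast Nat.le_succ k
  have hF1 : ContMDiffAt (𝓡 n) 𝓘(ℝ, Euc n × ℝ) 1 F x := hF.of_le (hk1.trans hk2)
  have hf : ContDiffAt ℝ ((k + 1 : ℕ) : WithTop ℕ∞) f z :=
    contDiffAt_inChart (natCast_le_infty _) (mem_extChartAt_source x) hF
  have hfk : ContDiffAt ℝ k f z := hf.of_le hk2
  have hf' : ContDiffAt ℝ k (fderiv ℝ f) z := hf.fderiv_right (by norm_cast)
  have hfz : f z = F x := inChart_apply_self x F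
  have hDz : fderiv ℝ f z = diff F x :=
    (diff_eq_fderiv (hF1.mdifferentiableAt one_ne_zero)).symm
  -- The null direction equations in the fixed chart at x: unit length, tangency to the sphere,
  -- normality to dF. The derivative of F enters, which costs one order of regularity.
  let G : EuclideanSpace ℝ (Fin n) × Euc n → ℝ × ℝ × (EuclideanSpace ℝ (Fin n) →L[ℝ] ℝ) :=
    fun w => (⟪w.2, w.2⟫ - 1, ⟪(f w.1).1, w.2⟫,
      innerSL ℝ w.2 ∘L (ContinuousLinearMap.fst ℝ _ _ ∘L fderiv ℝ f w.1) -
        ContinuousLinearMap.snd ℝ _ _ ∘L fderiv ℝ f w.1)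
  have hGiff : ∀ w, G w = 0 ↔ NullDir (f w.1).1 w.2 (fderiv ℝ f w.1) := by
    intro w
    simp only [G, Prod.mk_eq_zero, sub_eq_zero]
    refine ⟨fun h => ⟨h.1, (real_inner_comm _ _).trans h.2.1,
      fun v => DFunLike.congr_fun h.2.2 v⟩,
      fun h => ⟨h.unit, (real_inner_comm _ _).trans h.perp, ?_⟩⟩
    ext v : 1
    exact h.normal v
  have hG : ContDiffAt ℝ k G (z, q) := by
    have h1 : ContDiffAt ℝ k (fun w : EuclideanSpace ℝ (Fin n) × Euc n => fderiv ℝ f w.1) (z, q) :=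
      ContDiffAt.comp (z, q) (g := fderiv ℝ f) hf' contDiffAt_fst
    have h2 : ContDiffAt ℝ k (fun w : EuclideanSpace ℝ (Fin n) × Euc n => f w.1) (z, q) :=
      ContDiffAt.comp (z, q) (g := f) hfk contDiffAt_fst
    refine ((contDiffAt_snd.inner ℝ contDiffAt_snd).sub contDiffAt_const).prodMk
      ((h2.fst.inner ℝ contDiffAt_snd).prodMk (ContDiffAt.sub ?_ (contDiffAt_const.clm_comp h1)))
    exact ((innerSL ℝ).contDiff.contDiffAt.comp (z, q) contDiffAt_snd).clm_comp
      (contDiffAt_const.clm_comp h1)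
  have hp : ⟪(F x).1, (F x).1⟫ = 1 := by
    rw [real_inner_self_eq_norm_sq, hunit.self_of_nhds, one_pow]
  let A := ContinuousLinearMap.fst ℝ _ _ ∘L fderiv ℝ f z
  let L : Euc n →L[ℝ] ℝ × ℝ × (EuclideanSpace ℝ (Fin n) →L[ℝ] ℝ) :=
    ((2 : ℝ) • innerSL ℝ q).prod ((innerSL ℝ (f z).1).prod
      (((ContinuousLinearMap.compL ℝ (EuclideanSpace ℝ (Fin n)) (Euc n) ℝ).flip A).comp
        (innerSL ℝ)))
  have hL : HasFDerivAt (fun u => G (z, u)) L q := by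
    have h3 : HasFDerivAt (fun u : Euc n => innerSL ℝ u ∘L A -
        ContinuousLinearMap.snd ℝ _ _ ∘L fderiv ℝ f z)
        (((ContinuousLinearMap.compL ℝ (EuclideanSpace ℝ (Fin n)) (Euc n) ℝ).flip A).comp
          (innerSL ℝ)) q :=
      HasFDerivAt.sub_const _ (((ContinuousLinearMap.compL ℝ (EuclideanSpace ℝ (Fin n)) (Euc n)
        ℝ).flip A).comp (innerSL ℝ)).hasFDerivAt
    refine HasFDerivAt.prodMk ?_ ((innerSL ℝ (f z).1).hasFDerivAt.prodMk h3)
    convert! ((hasFDerivAt_id q).inner ℝ (hasFDerivAt_id q)).sub_const 1 using 1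
    ext v
    simp [two_mul, real_inner_comm]
  have hLinj : Function.Injective L := by
    refine (injective_iff_map_eq_zero _).2 fun u hu => ?_
    have h1 : (2 : ℝ) * ⟪q, u⟫ = 0 := congrArg Prod.fst hu
    have h2 : ⟪(f z).1, u⟫ = 0 := congrArg (fun w => w.2.1) hu
    have h3 : ∀ v, ⟪u, (fderiv ℝ f z v).1⟫ = 0 := fun v =>
      DFunLike.congr_fun (congrArg (fun w => w.2.2) hu) v
    rw [hfz] at h2
    rw [hDz] at h3
    exact hq.eq_zero_of_perp hp (inner_base_diff hF1 hunit) hinj h2 (by linarith) fun v =>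
      (real_inner_comm _ _).trans (h3 v)
  -- There are 1 + 1 + n scalar equations for the n + 2 coordinates of N.
  have hdim : Module.finrank ℝ (Euc n) =
      Module.finrank ℝ (ℝ × ℝ × (EuclideanSpace ℝ (Fin n) →L[ℝ] ℝ)) := by
    rw [Module.finrank_prod, Module.finrank_prod, Module.finrank_self, finrank_euclideanSpace_fin,
      ← (LinearMap.toContinuousLinearMap
        (𝕜 := ℝ) (E := EuclideanSpace ℝ (Fin n)) (F' := ℝ)).finrank_eq, Module.finrank_linearMap,
      finrank_euclideanSpace_fin, Module.finrank_self]
    omega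
  have hG0 : G (z, q) = 0 := (hGiff _).2 (by simpa only [hfz, hDz] using hq)
  obtain ⟨ψ, hψ, hψz, hψ0, huniq⟩ := exists_implicit hdim (by exact_mod_cast hk) hG hG0 hL hLinj
  have hnull : ∀ᶠ y in 𝓝 x, ∀ u, NullDir (F y).1 u (diff F y) ↔
      G (extChartAt (𝓡 n) x y, u) = 0 := by
    filter_upwards [eventually_contMDiffAt (k := 1) hF1,
      extChartAt_source_mem_nhds (I := 𝓡 n) x] with y hy hys u
    obtain ⟨T, hT⟩ := exists_diff_eq hys
    rw [hT _ F hy, NullDir.comp_iff, hGiff, ← inChart_apply hys F]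
  have hNk : ContMDiffAt (𝓡 n) 𝓘(ℝ, Euc n) k (fun y => ψ (extChartAt (𝓡 n) x y)) x :=
    contMDiffAt_comp_extChartAt (natCast_le_infty k) (mem_extChartAt_source x) hψ
  refine ⟨fun y => ψ (extChartAt (𝓡 n) x y), hψz, hNk,
    ⟨hF.of_le (by exact_mod_cast Nat.succ_le_succ (Nat.one_le_iff_ne_zero.2 hk)), hunit,
      hNk.of_le hk1, ?_, ?_⟩, ?_⟩
  · filter_upwards [hnull, (continuousAt_extChartAt (I := 𝓡 n) x).eventually hψ0] with y hy hy0
    exact (hy _).2 hy0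
  · have hcont : ContinuousAt (fun y => reduced (fderiv ℝ f y) (ψ y)) z :=
      (contDiffAt_reduced hf' hψ).continuousAt
    have hi : Function.Injective (reduced (fderiv ℝ f z) (ψ z)) := by rwa [hDz, hψz]
    filter_upwards [eventually_contMDiffAt (k := 1) hF1, extChartAt_source_mem_nhds (I := 𝓡 n) x,
      (continuousAt_extChartAt (I := 𝓡 n) x).eventually (eventually_injective hcont hi)]
      with y hy hys hyi
    obtain ⟨T, hT⟩ := exists_diff_eq hys
    rw [hT _ F hy, reduced_comp]
    exact hyi.comp T.injective
  · intro N' hN' hN'x hN'0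
    have ht : Filter.Tendsto (fun y => (extChartAt (𝓡 n) x y, N' y)) (𝓝 x) (𝓝 (z, q)) := by
      rw [← hN'x]
      exact (continuousAt_extChartAt (I := 𝓡 n) x).prodMk hN'
    filter_upwards [hnull, hN'0, ht.eventually huniq] with y h1 h2 h3
    exact h3 ((h1 _).1 h2)

end NullField

/-! ### Immersions with null second fundamental form -/

section NullSecondForm

variable {n : ℕ} {M : Type*} [TopologicalSpace M] [ChartedSpace (EuclideanSpace ℝ (Fin n)) M]
  [IsManifold (𝓡 n) ∞ M]
variable {F : M → Euc n × ℝ} {N : M → Euc n} {x : M}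

/-- `twist` in coordinates. -/
def twistAt (f : EuclideanSpace ℝ (Fin n) → Euc n × ℝ) (g : EuclideanSpace ℝ (Fin n) → Euc n)
    (z : EuclideanSpace ℝ (Fin n)) : EuclideanSpace ℝ (Fin n) →L[ℝ] Euc n :=
  fderiv ℝ g z + (ContinuousLinearMap.snd ℝ _ _ ∘L fderiv ℝ f z).smulRight (f z).1

theorem exists_reduced_twist_eq (hF : ContMDiffAt (𝓡 n) 𝓘(ℝ, Euc n × ℝ) 1 F x)
    (hN : ContMDiffAt (𝓡 n) 𝓘(ℝ, Euc n) 1 N x) {x₀ : M}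
    (hx : x ∈ (extChartAt (𝓡 n) x₀).source) :
    ∃ T : EuclideanSpace ℝ (Fin n) ≃L[ℝ] EuclideanSpace ℝ (Fin n),
      reduced (diff F x) (N x) =
        reduced (fderiv ℝ (inChart x₀ F) (extChartAt (𝓡 n) x₀ x))
          (inChart x₀ N (extChartAt (𝓡 n) x₀ x)) ∘L
          (T : EuclideanSpace ℝ (Fin n) →L[ℝ] EuclideanSpace ℝ (Fin n)) ∧
      twist F N x = twistAt (inChart x₀ F) (inChart x₀ N) (extChartAt (𝓡 n) x₀ x) ∘L
          (T : EuclideanSpace ℝ (Fin n) →L[ℝ] EuclideanSpace ℝ (Fin n)) := by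
  obtain ⟨T, hT⟩ := exists_diff_eq hx
  refine ⟨T, ?_, ?_⟩
  · rw [hT _ F hF, reduced_comp, inChart_apply hx]
  · rw [twist, twistAt, hT _ F hF, hT _ N hN, inChart_apply hx]
    rfl

namespace IsNullField

theorem continuousAt_twistAt (h : IsNullField F N x) :
    ContinuousAt (twistAt (inChart x F) (inChart x N)) (extChartAt (𝓡 n) x x) := by
  have hf := contDiffAt_inChart (natCast_le_infty 2) (mem_extChartAt_source x) h.contMDiffAt
  have hg := contDiffAt_inChart (natCast_le_infty 1) (mem_extChartAt_source x) h.field_contMDiffAt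
  have h1 : ContDiffAt ℝ 0 (fderiv ℝ (inChart x F)) (extChartAt (𝓡 n) x x) :=
    hf.fderiv_right (by norm_num)
  have h2 : ContDiffAt ℝ 0 (fderiv ℝ (inChart x N)) (extChartAt (𝓡 n) x x) :=
    hg.fderiv_right (by norm_num)
  exact (h2.add ((contDiffAt_const.clm_comp h1).smulRight
    (hf.of_le (by norm_num)).fst)).continuousAt

/-- `twist F N y` is written in the preferred chart at y, which may jump with y, so it need not be
continuous. In the fixed chart at x it is, and vanishing does not depend on the chart. -/
theorem eventually_twist_ne_zero (h : IsNullField F N x) (h0 : twist F N x ≠ 0) :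
    ∀ᶠ y in 𝓝 x, twist F N y ≠ 0 := by
  have h1 : twistAt (inChart x F) (inChart x N) (extChartAt (𝓡 n) x x) ≠ 0 := by
    obtain ⟨T, -, hT⟩ := exists_reduced_twist_eq h.contMDiffAt_one h.field_contMDiffAt
      (mem_extChartAt_source x)
    intro h1
    rw [h1, ContinuousLinearMap.zero_comp] at hT
    exact h0 hT
  filter_upwards [h.eventually, eventually_of_inChart (h.continuousAt_twistAt.eventually_ne h1)]
    with y hy hy1 hy0
  obtain ⟨T, -, hT⟩ := exists_reduced_twist_eq hy.contMDiffAt_one hy.field_contMDiffAt hy1.1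
  rw [hy0] at hT
  refine hy1.2 ?_
  ext v : 1
  have := DFunLike.congr_fun hT (T.symm v)
  simpa using this.symm

/-- Again the trace is first moved to the chart at x, where it is continuous. -/
theorem eventually_relTrace_ne_zero (h : IsNullField F N x)
    (h0 : relTrace (reduced (diff F x) (N x)) (twist F N x) ≠ 0) :
    ∀ᶠ y in 𝓝 x, relTrace (reduced (diff F y) (N y)) (twist F N y) ≠ 0 := by
  have key : ∀ y, y ∈ (extChartAt (𝓡 n) x).source → IsNullField F N y →
      Function.Injective (reduced (fderiv ℝ (inChart x F) (extChartAt (𝓡 n) x y))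
          (inChart x N (extChartAt (𝓡 n) x y))) ∧
      relTrace (reduced (diff F y) (N y)) (twist F N y) =
        relTrace (reduced (fderiv ℝ (inChart x F) (extChartAt (𝓡 n) x y))
          (inChart x N (extChartAt (𝓡 n) x y)))
          (twistAt (inChart x F) (inChart x N) (extChartAt (𝓡 n) x y)) := by
    intro y hys hy
    obtain ⟨T, hT1, hT2⟩ := exists_reduced_twist_eq hy.contMDiffAt_one hy.field_contMDiffAt hys
    have hi := hy.injective.self_of_nhds
    have hr := hy.exists_twist_eq
    rw [hT1] at hi hr
    rw [hT2] at hr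
    have hi' : Function.Injective (reduced (fderiv ℝ (inChart x F) (extChartAt (𝓡 n) x y))
          (inChart x N (extChartAt (𝓡 n) x y))) := by
      intro v w hvw
      have : T.symm v = T.symm w := hi (by simpa using hvw)
      exact T.symm.injective this
    refine ⟨hi', ?_⟩
    rw [hT1, hT2, relTrace_comp_equiv hi' fun v => ?_]
    obtain ⟨u, hu⟩ := hr (T.symm v)
    exact ⟨T u, by simpa using hu⟩
  have hx := key x (mem_extChartAt_source x) h
  rw [hx.2] at h0
  have hf := contDiffAt_inChart (natCast_le_infty 2) (mem_extChartAt_source x) h.contMDiffAt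
  have hg := contDiffAt_inChart (natCast_le_infty 1) (mem_extChartAt_source x) h.field_contMDiffAt
  have h1 : ContDiffAt ℝ 0 (fderiv ℝ (inChart x F)) (extChartAt (𝓡 n) x x) :=
    hf.fderiv_right (by norm_num)
  have h2 : ContDiffAt ℝ 0 (fun z => reduced (fderiv ℝ (inChart x F) z) (inChart x N z))
      (extChartAt (𝓡 n) x x) := contDiffAt_reduced h1 (hg.of_le (by norm_num))
  have h3 : ContDiffAt ℝ 0 (twistAt (inChart x F) (inChart x N)) (extChartAt (𝓡 n) x x) := by
    have h4 : ContDiffAt ℝ 0 (fderiv ℝ (inChart x N)) (extChartAt (𝓡 n) x x) :=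
      hg.fderiv_right (by norm_num)
    exact h4.add ((contDiffAt_const.clm_comp h1).smulRight (hf.of_le (by norm_num)).fst)
  have h5 := (contDiffAt_relTrace h2 h3 hx.1).continuousAt
  filter_upwards [h.eventually, eventually_of_inChart (h5.eventually_ne h0)] with y hy hy1
  rw [(key y hy1.1 hy).2]
  exact hy1.2

/-- If a null normal field is parallel, `F` is horizontal. -/
theorem snd_diff_eq_zero (hn : 2 ≤ n) (h : IsNullField F N x)
    (h0 : ∀ᶠ y in 𝓝 x, twist F N y = 0) (v : EuclideanSpace ℝ (Fin n)) :
    (diff F x v).2 = 0 := by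
  set z := extChartAt (𝓡 n) x x
  set f : EuclideanSpace ℝ (Fin n) → Euc n × ℝ := inChart x F
  set g : EuclideanSpace ℝ (Fin n) → Euc n := inChart x N
  have hf : ContDiffAt ℝ 2 f z :=
    contDiffAt_inChart (natCast_le_infty 2) (mem_extChartAt_source x) h.contMDiffAt
  have hf1 : HasFDerivAt f (diff F x) z := hasFDerivAt_inChart h.contMDiffAt_one
  have hfz : f z = F x := inChart_apply_self x F
  have hDz : fderiv ℝ f z = diff F x := hf1.fderiv
  have hf' : ContDiffAt ℝ 1 (fderiv ℝ f) z := hf.fderiv_right (by norm_num)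
  have hf'' := (hf'.differentiableAt one_ne_zero).hasFDerivAt
  -- Parallelism says dN = -dt·F₁. The right side is C¹, so N is twice differentiable here although
  -- it was only assumed C¹.
  let g' : EuclideanSpace ℝ (Fin n) → EuclideanSpace ℝ (Fin n) →L[ℝ] Euc n := fun y =>
    (ContinuousLinearMap.snd ℝ _ _ ∘L fderiv ℝ f y).smulRight (-(f y).1)
  have hg' : ContDiffAt ℝ 1 g' z := (contDiffAt_const.clm_comp hf').smulRight
    (hf.of_le one_le_two).fst.neg
  have hg'' := (hg'.differentiableAt one_ne_zero).hasFDerivAt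
  have hgder : ∀ᶠ y in 𝓝 z, HasFDerivAt g (g' y) y := by
    filter_upwards [eventually_inChart (h0.and h.eventually),
      extChartAt_target_mem_nhds (I := 𝓡 n) x] with y hy hyt
    have hys := (extChartAt (𝓡 n) x).map_target hyt
    obtain ⟨T, -, hT⟩ := exists_reduced_twist_eq hy.2.contMDiffAt_one hy.2.field_contMDiffAt hys
    have hd := (contDiffAt_inChart (natCast_le_infty 1) hys
      hy.2.field_contMDiffAt).differentiableAt one_ne_zero
    rw [PartialEquiv.right_inv _ hyt] at hd hT
    rw [hy.1] at hT
    have h1 : fderiv ℝ g y = g' y := by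
      ext w : 1
      have h2 := DFunLike.congr_fun hT (T.symm w)
      have h3 : 0 = fderiv ℝ g y w + (fderiv ℝ f y w).2 • (f y).1 := by
        simpa [twistAt] using h2
      change _ = (fderiv ℝ f y w).2 • (-(f y).1)
      rw [smul_neg]
      exact eq_neg_of_add_eq_zero_left h3.symm
    rw [← h1]
    exact hd.hasFDerivAt
  have hval : ∀ v w, fderiv ℝ g' z v w =
      (diff F x w).2 • (-(diff F x v).1) + (fderiv ℝ (fderiv ℝ f) z v w).2 • (-(F x).1) := by
    intro v w
    have h1 := hg''.clm_apply (hasFDerivAt_const w z)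
    have h2 := (hf''.clm_apply (hasFDerivAt_const w z)).snd.smul hf1.fst.neg
    have h3 := DFunLike.congr_fun (h1.unique h2) v
    simpa [hDz, hfz] using h3
  -- In the symmetry of the second derivative of N the Hessian of the height cancels, leaving dt(w)
  -- dF₁(v) = dt(v) dF₁(w).
  have hsymm := second_derivative_symmetric_of_eventually hgder hg''
  have hfsymm : IsSymmSndFDerivAt ℝ f z := hf.isSymmSndFDerivAt (by simp)
  have hcomm : ∀ v w : EuclideanSpace ℝ (Fin n),
      (diff F x w).2 • (diff F x v).1 = (diff F x v).2 • (diff F x w).1 := by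
    intro v w
    have h1 := hsymm v w
    rw [hval, hval, hfsymm.eq w v, add_left_inj, smul_neg, smul_neg, neg_inj] at h1
    exact h1
  -- Here n ≥ 2 enters: dt has a nonzero kernel vector w. If dt(v) ≠ 0, the relation gives dF₁(w) =
  -- 0 as well, against injectivity.
  obtain ⟨w, hw, hw0⟩ := Submodule.exists_mem_ne_zero_of_ne_bot
    (LinearMap.ker_ne_bot_of_finrank_lt
      (f := (ContinuousLinearMap.snd ℝ (Euc n) ℝ ∘L diff (n := n) F x).toLinearMap)
      (by rw [Module.finrank_self, finrank_euclideanSpace_fin]; omega))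
  have hw2 : (diff F x w).2 = 0 := hw
  by_contra hv
  have h1 := hcomm v w
  rw [hw2, zero_smul, eq_comm, smul_eq_zero, or_iff_right hv] at h1
  refine hw0 (h.injective.self_of_nhds ?_)
  rw [reduced_apply, h1, hw2, zero_smul, sub_zero, map_zero]

end IsNullField

/-- A vector space is not the union of two proper subspaces, here the kernels. -/
theorem eq_zero_or_eq_zero_of_forall {X Y Z : Type*} [AddCommGroup X] [Module ℝ X]
    [AddCommGroup Y] [Module ℝ Y] [AddCommGroup Z] [Module ℝ Z] {f : X →ₗ[ℝ] Y} {g : X →ₗ[ℝ] Z}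
    (h : ∀ v, f v = 0 ∨ g v = 0) : f = 0 ∨ g = 0 := by
  by_contra! hne
  obtain ⟨a, ha⟩ : ∃ a, f a ≠ 0 := by
    by_contra! h0; exact hne.1 (LinearMap.ext h0)
  obtain ⟨b, hb⟩ : ∃ b, g b ≠ 0 := by
    by_contra! h0; exact hne.2 (LinearMap.ext h0)
  have h1 := (h a).resolve_left ha
  have h2 := (h b).resolve_right hb
  rcases h (a + b) with h3 | h3
  · rw [map_add, h2, add_zero] at h3; exact ha h3
  · rw [map_add, h1, zero_add] at h3; exact hb h3

/-- Each h(v, w) is orthogonal to one of the two null directions. The preceding alternative is used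
twice: in w for fixed v, to choose which twist kills v, and then in v. -/
theorem IsNullField.twist_eq_zero_or {N' : M → Euc n} (h : IsNullField F N x)
    (h' : IsNullField F N' x) (hne : N x ≠ N' x)
    (hnull : ∀ v w, lorForm n (secondFormL F x v w) (secondFormL F x v w) = 0) :
    twist F N x = 0 ∨ twist F N' x = 0 := by
  have hzero : ∀ {N : M → Euc n}, IsNullField F N x → ∀ v,
      (∀ w, ⟪twist F N x v, reduced (diff F x) (N x) w⟫ = 0) → twist F N x v = 0 := by
    intro N h v hv
    obtain ⟨u, hu⟩ := h.exists_twist_eq v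
    rw [← inner_self_eq_zero (𝕜 := ℝ)]
    nth_rewrite 2 [hu]
    exact hv u
  have key : ∀ v, twist F N x v = 0 ∨ twist F N' x v = 0 := by
    intro v
    have h1 : ∀ w, (innerₛₗ ℝ (twist F N x v) ∘ₗ (reduced (diff F x) (N x)).toLinearMap) w = 0 ∨
        (innerₛₗ ℝ (twist F N' x v) ∘ₗ (reduced (diff F x) (N' x)).toLinearMap) w = 0 := by
      intro w
      have := (null_iff h.nullDir.self_of_nhds h'.nullDir.self_of_nhds hne h.inner_base
        h.inner_base_diff h.injective.self_of_nhds (orthProj_mem _)).1 (hnull v w)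
      change lorForm n (secondFormL F x v w) (N x, 1) = 0 ∨
        lorForm n (secondFormL F x v w) (N' x, 1) = 0 at this
      rw [h.lorForm_secondForm_field, h'.lorForm_secondForm_field, neg_eq_zero, neg_eq_zero] at this
      exact this
    exact (eq_zero_or_eq_zero_of_forall h1).imp (fun h2 => hzero h v fun w =>
      LinearMap.congr_fun h2 w) fun h2 => hzero h' v fun w => LinearMap.congr_fun h2 w
  exact (eq_zero_or_eq_zero_of_forall (f := (twist F N x).toLinearMap)
    (g := (twist F N' x).toLinearMap) key).imp
    (fun h2 => ContinuousLinearMap.coe_injective h2)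
    fun h2 => ContinuousLinearMap.coe_injective h2

theorem isTotallyGeodesicOn_of_null (hn : 2 ≤ n) {U : Set M} (hU : IsOpen U)
    (hF : IsNondegenerateOn 2 F U) (hnull : HasNullSecondFormOn F U) :
    IsTotallyGeodesicOn F U := by
  intro x hx v w
  by_contra hne
  set ζ := secondFormL F x v w with hζdef
  have hUx := hU.mem_nhds hx
  have hF2 : ContMDiffAt (𝓡 n) 𝓘(ℝ, Euc n × ℝ) 2 F x := hF.contMDiffOn.contMDiffAt hUx
  have hunit : ∀ᶠ y in 𝓝 x, ‖(F y).1‖ = 1 := by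
    filter_upwards [hUx] with y hy using hF.mem y hy
  have hmem : ζ ∈ normalSpace n (lorForm n) (productTangent n) F x := orthProj_mem _
  have hmem' := mem_normalSpace.1 hmem
  obtain ⟨hζ2, hdir⟩ := nullDir_of_null hne (hnull x hx v w) hmem'.1 hmem'.2
  have hp : ⟪(F x).1, (F x).1⟫ = 1 := by
    rw [real_inner_self_eq_norm_sq, hF.mem x hx, one_pow]
  have hD : ∀ v : EuclideanSpace ℝ (Fin n), ⟪(F x).1, (diff F x v).1⟫ = 0 :=
    inner_base_diff (hF2.of_le one_le_two) hunit
  obtain ⟨q', hq', hqq', -⟩ := hdir.exists_other hp hD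
    (hdir.injective_reduced (hF.nondegenerate x hx))
  obtain ⟨N, hNx, -, hN, -⟩ := exists_nullField one_ne_zero hF2 hunit hdir
    (hdir.injective_reduced (hF.nondegenerate x hx))
  obtain ⟨N', hN'x, -, hN', -⟩ := exists_nullField one_ne_zero hF2 hunit hq'
    (hq'.injective_reduced (hF.nondegenerate x hx))
  have hζ : ζ = ζ.2 • (N x, 1) := by
    rw [hNx]
    exact Prod.ext (by simp [smul_smul, hζ2]) (by simp)
  have hNN' : N x ≠ N' x := by
    intro h
    rw [hNx, hN'x] at h
    rw [← h, hdir.null] at hqq'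
    exact hqq' rfl
  -- h(v, w) is a nonzero multiple of (N, 1), hence not orthogonal to the other null direction,
  -- whose twist would otherwise annihilate it. This persists near x and forces the twist of N to
  -- vanish there.
  have htw : twist F N' x ≠ 0 := by
    intro h0
    have h1 := hN'.lorForm_secondForm_field v w
    rw [h0, zero_apply, inner_zero_left, neg_zero, ← hζdef, hζ, map_smul,
      LinearMap.smul_apply, smul_eq_mul, hNx, hN'x] at h1
    exact (mul_ne_zero hζ2 hqq') h1
  have hzero : ∀ᶠ y in 𝓝 x, twist F N y = 0 := by
    filter_upwards [hN.eventually, hN'.eventually, hN'.eventually_twist_ne_zero htw, hUx,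
      (hN.field_contMDiffAt.continuousAt.sub hN'.field_contMDiffAt.continuousAt).eventually_ne
        (sub_ne_zero.2 hNN')] with y h1 h2 h3 h4 h5
    exact (h1.twist_eq_zero_or h2 (sub_ne_zero.1 h5) (hnull y h4)).resolve_right h3
  have hhor : ∀ᶠ y in 𝓝 x, ∀ v : EuclideanSpace ℝ (Fin n), (diff F y v).2 = 0 := by
    filter_upwards [hN.eventually, hzero.eventually_nhds] with y h1 h2 v
    exact h1.snd_diff_eq_zero hn h2 v
  -- For horizontal F the vertical vector is normal. Its product with h is minus the second
  -- derivative of the height, which is zero, whereas its product with (N, 1) is -1.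
  have hvert : ((0 : Euc n), (1 : ℝ)) ∈ normalSpace n (lorForm n) (productTangent n) F x := by
    rw [mem_normalSpace]
    refine ⟨inner_zero_right _, fun v => ?_⟩
    rw [lorForm_apply, hhor.self_of_nhds, inner_zero_left]
    ring
  have h2 : (diff2 F x v w).2 = 0 := by
    have hf : ContDiffAt ℝ 2 (inChart x F) (extChartAt (𝓡 n) x x) :=
      contDiffAt_inChart (natCast_le_infty 2) (mem_extChartAt_source x) hF2
    have hf' := ((hf.fderiv_right (m := 1) (by norm_num)).differentiableAt
      one_ne_zero).hasFDerivAt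
    have hz : (fun z => (fderiv ℝ (inChart x F) z w).2) =ᶠ[𝓝 (extChartAt (𝓡 n) x x)]
        fun _ => 0 := by
      filter_upwards [eventually_inChart (hhor.and (eventually_contMDiffAt (k := 2) hF2)),
        extChartAt_target_mem_nhds (I := 𝓡 n) x] with z hz hzt
      obtain ⟨T, hT⟩ := exists_diff_eq ((extChartAt (𝓡 n) x).map_target hzt)
      have h1 := hz.1 (T.symm w)
      rw [hT _ F (hz.2.of_le one_le_two), PartialEquiv.right_inv _ hzt] at h1
      simpa using h1
    have h3 := (hf'.clm_apply (hasFDerivAt_const w _)).snd.unique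
      ((hasFDerivAt_const (0 : ℝ) _).congr_of_eventuallyEq hz)
    have h4 := DFunLike.congr_fun h3 v
    rw [ContinuousLinearMap.comp_apply, _root_.add_apply, ContinuousLinearMap.comp_zero] at h4
    simpa [diff2, inChart] using h4
  have h3 := hN.lorForm_secondForm v w hvert
  rw [← hζdef, hζ, map_smul, LinearMap.smul_apply, lorForm_apply, lorForm_apply, h2] at h3
  simp at h3
  exact hζ2 h3

end NullSecondForm

/-! ### Hypersurfaces of the sphere -/

section Hypersurface

variable {n : ℕ} {M : Type*} [TopologicalSpace M] [ChartedSpace (EuclideanSpace ℝ (Fin n)) M]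
  [IsManifold (𝓡 n) ∞ M]
variable {φ ν : M → Euc n} {x : M} {U : Set M}

theorem mem_normalSpace_sphere {η : Euc n} :
    η ∈ normalSpace n (eucForm n) (sphereTangent n) φ x ↔
      ⟪φ x, η⟫ = 0 ∧ ∀ v : EuclideanSpace ℝ (Fin n), ⟪diff φ x v, η⟫ = 0 := by
  rw [normalSpace, Submodule.mem_inf, sphereTangent,
    Submodule.mem_orthogonal_singleton_iff_inner_right]
  refine and_congr_right fun _ => ⟨fun h v => h (diff φ x v) ⟨v, rfl⟩, ?_⟩
  rintro h _ ⟨v, rfl⟩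
  exact h v

namespace IsHypersurfaceOn

theorem contMDiffAt (h : IsHypersurfaceOn φ ν U) (hU : IsOpen U) (hx : x ∈ U) :
    ContMDiffAt (𝓡 n) 𝓘(ℝ, Euc n) 4 φ x :=
  h.contMDiffOn.contMDiffAt (hU.mem_nhds hx)

theorem gauss_contMDiffAt (h : IsHypersurfaceOn φ ν U) (hU : IsOpen U) (hx : x ∈ U) :
    ContMDiffAt (𝓡 n) 𝓘(ℝ, Euc n) 3 ν x :=
  h.gauss_contMDiffOn.contMDiffAt (hU.mem_nhds hx)

theorem contMDiffAt_two (h : IsHypersurfaceOn φ ν U) (hU : IsOpen U) (hx : x ∈ U) :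
    ContMDiffAt (𝓡 n) 𝓘(ℝ, Euc n) 2 φ x :=
  (h.contMDiffAt hU hx).of_le (by norm_num)

theorem contMDiffAt_one (h : IsHypersurfaceOn φ ν U) (hU : IsOpen U) (hx : x ∈ U) :
    ContMDiffAt (𝓡 n) 𝓘(ℝ, Euc n) 1 φ x :=
  (h.contMDiffAt_two hU hx).of_le one_le_two

theorem gauss_contMDiffAt_two (h : IsHypersurfaceOn φ ν U) (hU : IsOpen U) (hx : x ∈ U) :
    ContMDiffAt (𝓡 n) 𝓘(ℝ, Euc n) 2 ν x :=
  (h.gauss_contMDiffAt hU hx).of_le (by norm_num)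

theorem gauss_contMDiffAt_one (h : IsHypersurfaceOn φ ν U) (hU : IsOpen U) (hx : x ∈ U) :
    ContMDiffAt (𝓡 n) 𝓘(ℝ, Euc n) 1 ν x :=
  (h.gauss_contMDiffAt_two hU hx).of_le one_le_two

theorem inner_self (h : IsHypersurfaceOn φ ν U) (hx : x ∈ U) : ⟪φ x, φ x⟫ = 1 := by
  rw [real_inner_self_eq_norm_sq, h.mem x hx, one_pow]

theorem inner_gauss_self (h : IsHypersurfaceOn φ ν U) (hx : x ∈ U) : ⟪ν x, ν x⟫ = 1 := by
  rw [real_inner_self_eq_norm_sq, h.gauss_unit x hx, one_pow]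

theorem inner_gauss (h : IsHypersurfaceOn φ ν U) (hx : x ∈ U) : ⟪φ x, ν x⟫ = 0 :=
  (mem_normalSpace_sphere.1 (h.gauss_normal x hx)).1

theorem inner_gauss_diff (h : IsHypersurfaceOn φ ν U) (hx : x ∈ U)
    (v : EuclideanSpace ℝ (Fin n)) : ⟪ν x, diff φ x v⟫ = 0 :=
  (real_inner_comm _ _).trans ((mem_normalSpace_sphere.1 (h.gauss_normal x hx)).2 v)

theorem inner_diff (h : IsHypersurfaceOn φ ν U) (hU : IsOpen U) (hx : x ∈ U)
    (v : EuclideanSpace ℝ (Fin n)) : ⟪φ x, diff φ x v⟫ = 0 := by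
  have h1 := inner_diff_add_inner_diff (h.contMDiffAt_one hU hx) (h.contMDiffAt_one hU hx) (c := 1)
    (by filter_upwards [hU.mem_nhds hx] with y hy using h.inner_self hy) v
  rw [real_inner_comm (φ x)] at h1
  linarith

theorem inner_gauss_diff_gauss (h : IsHypersurfaceOn φ ν U) (hU : IsOpen U) (hx : x ∈ U)
    (v : EuclideanSpace ℝ (Fin n)) : ⟪ν x, diff ν x v⟫ = 0 := by
  have h1 := inner_diff_add_inner_diff (h.gauss_contMDiffAt_one hU hx)
    (h.gauss_contMDiffAt_one hU hx) (c := 1)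
    (by filter_upwards [hU.mem_nhds hx] with y hy using h.inner_gauss_self hy) v
  rw [real_inner_comm (ν x)] at h1
  linarith

theorem inner_diff_gauss (h : IsHypersurfaceOn φ ν U) (hU : IsOpen U) (hx : x ∈ U)
    (v : EuclideanSpace ℝ (Fin n)) : ⟪φ x, diff ν x v⟫ = 0 := by
  have h1 := inner_diff_add_inner_diff (h.contMDiffAt_one hU hx) (h.gauss_contMDiffAt_one hU hx)
    (c := 0) (by filter_upwards [hU.mem_nhds hx] with y hy using h.inner_gauss hy) v
  rwa [real_inner_comm (ν x), h.inner_gauss_diff hx, add_zero] at h1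

theorem exists_eq_diff (h : IsHypersurfaceOn φ ν U) (hU : IsOpen U) (hx : x ∈ U) {u : Euc n}
    (hφ : ⟪φ x, u⟫ = 0) (hν : ⟪ν x, u⟫ = 0) : ∃ v, u = diff (n := n) φ x v :=
  mem_range_of_perp (h.immersion x hx) (h.inner_self hx) (h.inner_gauss_self hx)
    ((real_inner_comm _ _).trans (h.inner_gauss hx)) (h.inner_diff hU hx) (h.inner_gauss_diff hx)
    hφ hν

theorem inner_diff2 (h : IsHypersurfaceOn φ ν U) (hU : IsOpen U) (hx : x ∈ U)
    (v w : EuclideanSpace ℝ (Fin n)) :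
    ⟪diff2 φ x v w, ν x⟫ = -⟪diff ν x v, diff φ x w⟫ := by
  have hf := contDiffAt_inChart (natCast_le_infty 2) (mem_extChartAt_source x)
    (h.contMDiffAt_two hU hx)
  obtain ⟨f'', hf', hf''⟩ : ∃ f'', HasFDerivAt (fderiv ℝ (inChart x φ)) f''
      (extChartAt (𝓡 n) x x) ∧ f'' v w = diff2 φ x v w :=
    ⟨_, ((hf.fderiv_right (m := 1) (by norm_num)).differentiableAt one_ne_zero).hasFDerivAt, rfl⟩
  have hfw := hf'.clm_apply (hasFDerivAt_const w _)
  have hN := hasFDerivAt_inChart (h.gauss_contMDiffAt_one hU hx)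
  have hzero : (fun z => ⟪inChart x ν z, fderiv ℝ (inChart x φ) z w⟫)
      =ᶠ[𝓝 (extChartAt (𝓡 n) x x)] fun _ => 0 := by
    filter_upwards [eventually_inChart (hU.mem_nhds hx),
      extChartAt_target_mem_nhds (I := 𝓡 n) x] with z hz hzt
    obtain ⟨T, hT⟩ := exists_diff_eq ((extChartAt (𝓡 n) x).map_target hzt)
    have h1 := h.inner_gauss_diff hz (T.symm w)
    rwa [hT _ φ (h.contMDiffAt_one hU hz), PartialEquiv.right_inv _ hzt,
      ContinuousLinearMap.comp_apply, ContinuousLinearEquiv.coe_coe, T.apply_symm_apply] at h1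
  have h1 := (hN.inner ℝ hfw).unique ((hasFDerivAt_const (0 : ℝ) _).congr_of_eventuallyEq hzero)
  have hD : fderiv ℝ (inChart x φ) (extChartAt (𝓡 n) x x) = diff φ x :=
    (hasFDerivAt_inChart (h.contMDiffAt_one hU hx)).fderiv
  rw [inChart_apply_self, hD] at h1
  have h2 : ⟪ν x, f'' v w⟫ + ⟪diff ν x v, diff φ x w⟫ = 0 := by
    simpa using DFunLike.congr_fun h1 v
  rw [hf'', real_inner_comm] at h2
  linarith

/-- ⟨dν v, dφ w⟩ is minus the normal part of the second derivative of φ, hence symmetric. The range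
of dν lies in that of dφ because dν is orthogonal to φ and ν. -/
theorem isShapePair (h : IsHypersurfaceOn φ ν U) (hU : IsOpen U) (hx : x ∈ U) :
    IsShapePair (diff (n := n) φ x) (diff (n := n) ν x) := by
  refine ⟨h.immersion x hx, fun v w => ?_, fun v => h.exists_eq_diff hU hx
    (h.inner_diff_gauss hU hx v) (h.inner_gauss_diff_gauss hU hx v)⟩
  have hsymm : IsSymmSndFDerivAt ℝ (inChart x φ) (extChartAt (𝓡 n) x x) :=
    (contDiffAt_inChart (natCast_le_infty 2) (mem_extChartAt_source x)
      (h.contMDiffAt_two hU hx)).isSymmSndFDerivAt (by simp)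
  have h1 : diff2 φ x v w = diff2 φ x w v := hsymm.eq v w
  have h2 := h.inner_diff2 hU hx v w
  rw [h1, h.inner_diff2 hU hx w v] at h2
  rw [real_inner_comm]
  linarith

theorem eq_smul_gauss (h : IsHypersurfaceOn φ ν U) (hU : IsOpen U) (hx : x ∈ U) {η : Euc n}
    (hη : η ∈ normalSpace n (eucForm n) (sphereTangent n) φ x) : η = ⟪η, ν x⟫ • ν x := by
  rw [mem_normalSpace_sphere] at hη
  obtain ⟨v, hv⟩ := h.exists_eq_diff hU hx (u := η - ⟪η, ν x⟫ • ν x)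
    (by rw [inner_sub_right, real_inner_smul_right, hη.1, h.inner_gauss hx]; ring)
    (by rw [inner_sub_right, real_inner_smul_right, h.inner_gauss_self hx, real_inner_comm]; ring)
  rw [← sub_eq_zero, ← inner_self_eq_zero (𝕜 := ℝ)]
  nth_rewrite 1 [hv]
  rw [inner_sub_right, hη.2, real_inner_smul_right, real_inner_comm (ν x) (diff φ x v),
    h.inner_gauss_diff hx]
  ring

theorem inner_secondForm (h : IsHypersurfaceOn φ ν U) (hU : IsOpen U) (hx : x ∈ U)
    (v w : EuclideanSpace ℝ (Fin n)) :
    ⟪secondForm (eucForm n) (sphereTangent n) φ x v w, ν x⟫ = -⟪diff ν x v, diff φ x w⟫ := by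
  rw [← h.inner_diff2 hU hx]
  refine orthProj_spec (B := eucForm n) ⟨⟪diff2 φ x v w, ν x⟫ • ν x,
    Submodule.smul_mem _ _ (h.gauss_normal x hx), fun η hη => ?_⟩ (h.gauss_normal x hx)
  rw [h.eq_smul_gauss hU hx hη]
  simp only [eucForm_apply, real_inner_smul_left, real_inner_smul_right, h.inner_gauss_self hx]
  ring

theorem inner_meanCurvature (h : IsHypersurfaceOn φ ν U) (hU : IsOpen U) (hx : x ∈ U) :
    ⟪meanCurvatureS φ x, ν x⟫ = -relTrace (diff (n := n) φ x) (diff (n := n) ν x) := by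
  have hs := h.isShapePair hU hx
  obtain ⟨R, hR⟩ := exists_comp_eq hs.injective hs.range
  have h1 := sum_inv_gram_mul hs.injective R (G := gram (eucForm n) φ x)
    (c := Matrix.of fun i j => ⟪diff φ x (R (EuclideanSpace.single i 1)),
      diff φ x (EuclideanSpace.single j 1)⟫)
    (fun i j => rfl) fun i j => rfl
  rw [hR, relTrace_comp hs.injective, ← h1, meanCurvatureS, meanCurvature]
  simp only [sum_inner, real_inner_smul_left]
  rw [← Finset.sum_neg_distrib]
  refine Finset.sum_congr rfl fun i _ => ?_
  rw [← Finset.sum_neg_distrib]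
  refine Finset.sum_congr rfl fun j _ => ?_
  rw [h.inner_secondForm hU hx, hR, mul_neg]
  rfl

theorem meanCurvature_eq_zero_iff (h : IsHypersurfaceOn φ ν U) (hU : IsOpen U) (hx : x ∈ U) :
    meanCurvatureS φ x = 0 ↔ ∑ κ ∈ (h.isShapePair hU hx).finite.toFinset,
      shapeMult (diff (n := n) φ x) (diff (n := n) ν x) κ * κ = 0 := by
  have h1 := h.inner_meanCurvature hU hx
  rw [(h.isShapePair hU hx).relTrace_eq, neg_neg] at h1
  rw [← h1]
  refine ⟨fun h2 => by rw [h2, inner_zero_left], fun h2 => ?_⟩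
  have hmem : meanCurvatureS φ x ∈ normalSpace n (eucForm n) (sphereTangent n) φ x :=
    Submodule.sum_mem _ fun _ _ => Submodule.sum_mem _ fun _ _ =>
      Submodule.smul_mem _ _ (orthProj_mem _)
  rw [h.eq_smul_gauss hU hx hmem, h2, zero_smul]

/-- Finiteness of the set of principal curvatures turns the `finsum` and `finprod` into genuine sums
and products instead of their default values. -/
theorem trapPoly_eq (h : IsHypersurfaceOn φ ν U) (hU : IsOpen U) (hx : x ∈ U) :
    trapPoly φ ν x = weightedPoly (h.isShapePair hU hx).finite.toFinset
      (shapeMult (diff (n := n) φ x) (diff (n := n) ν x)) := by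
  have hfin : (principalCurvatures φ ν x).Finite := (h.isShapePair hU hx).finite
  rw [trapPoly, finsum_mem_eq_finite_toFinset_sum _ hfin, weightedPoly]
  refine Finset.sum_congr rfl fun κ _ => ?_
  rw [finprod_mem_eq_finite_toFinset_prod _ (hfin.subset Set.sdiff_subset)]
  refine congrArg _ (Finset.prod_congr ?_ fun _ _ => rfl)
  ext μ
  simp only [Set.Finite.mem_toFinset, Finset.mem_erase, Set.mem_sdiff, Set.mem_singleton_iff]
  exact and_comm

theorem isRoot_iff (h : IsHypersurfaceOn φ ν U) (hU : IsOpen U) (hx : x ∈ U) {s : ℝ} :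
    (trapPoly φ ν x).IsRoot s ↔
      Function.Injective (s • diff (n := n) φ x + diff (n := n) ν x) ∧
        relTrace (s • diff (n := n) φ x + diff (n := n) ν x)
          (s • diff (n := n) ν x - diff (n := n) φ x) = 0 := by
  rw [h.trapPoly_eq hU hx, (h.isShapePair hU hx).isRoot_iff]

theorem encard_roots (hn : 1 ≤ n) (h : IsHypersurfaceOn φ ν U) (hU : IsOpen U) (hx : x ∈ U) :
    (meanCurvatureS φ x = 0 → {s | (trapPoly φ ν x).IsRoot s}.encard
      = (((principalCurvatures φ ν x).ncard - 1 : ℕ) : ℕ∞)) ∧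
    (meanCurvatureS φ x ≠ 0 → {s | (trapPoly φ ν x).IsRoot s}.encard
      = ((principalCurvatures φ ν x).ncard : ℕ∞)) := by
  have hs := h.isShapePair hU hx
  have : NeZero n := ⟨by omega⟩
  have hK : hs.finite.toFinset.Nonempty := hs.finite.toFinset_nonempty.2 hs.nonempty
  have hm : ∀ κ ∈ hs.finite.toFinset,
      0 < shapeMult (diff (n := n) φ x) (diff (n := n) ν x) κ := fun κ hκ =>
    shapeMult_pos (hs.finite.mem_toFinset.1 hκ)
  have hcard : (principalCurvatures φ ν x).ncard = hs.finite.toFinset.card :=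
    Set.ncard_eq_toFinset_card _ hs.finite
  rw [Ne, h.meanCurvature_eq_zero_iff hU hx, h.trapPoly_eq hU hx, hcard]
  exact ⟨encard_roots_weightedPoly_of_sum_eq_zero hK hm,
    encard_roots_weightedPoly_of_sum_ne_zero hK hm⟩

end IsHypersurfaceOn

/-- The root condition is invariant under coordinate changes, so near x it can be tested in the
single chart at x, where its data are differentiable. -/
theorem injective_and_relTrace_comp_iff {a b : EuclideanSpace ℝ (Fin n) →L[ℝ] Euc n}
    (T : EuclideanSpace ℝ (Fin n) ≃L[ℝ] EuclideanSpace ℝ (Fin n)) (h : IsShapePair a b) {s : ℝ} :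
    (Function.Injective (s • a + b) ∧ relTrace (s • a + b) (s • b - a) = 0) ↔
      Function.Injective (s • (a ∘L (T : EuclideanSpace ℝ (Fin n) →L[ℝ] _)) +
          b ∘L (T : EuclideanSpace ℝ (Fin n) →L[ℝ] _)) ∧
        relTrace (s • (a ∘L (T : EuclideanSpace ℝ (Fin n) →L[ℝ] _)) +
          b ∘L (T : EuclideanSpace ℝ (Fin n) →L[ℝ] _))
          (s • (b ∘L (T : EuclideanSpace ℝ (Fin n) →L[ℝ] _)) -
            a ∘L (T : EuclideanSpace ℝ (Fin n) →L[ℝ] _)) = 0 := by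
  have h1 : s • (a ∘L (T : EuclideanSpace ℝ (Fin n) →L[ℝ] _)) +
      b ∘L (T : EuclideanSpace ℝ (Fin n) →L[ℝ] _) =
        (s • a + b) ∘L (T : EuclideanSpace ℝ (Fin n) →L[ℝ] _) := rfl
  have h2 : s • (b ∘L (T : EuclideanSpace ℝ (Fin n) →L[ℝ] _)) -
      a ∘L (T : EuclideanSpace ℝ (Fin n) →L[ℝ] _) =
        (s • b - a) ∘L (T : EuclideanSpace ℝ (Fin n) →L[ℝ] _) := rfl
  have h3 : Function.Injective ((s • a + b) ∘L (T : EuclideanSpace ℝ (Fin n) →L[ℝ] _)) ↔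
      Function.Injective (s • a + b) := T.toEquiv.injective_comp (s • a + b)
  rw [h1, h2, h3]
  refine and_congr_right fun hi => ?_
  rw [relTrace_comp_equiv hi (h.exists_combination (notMem_shapeSet_iff.2 hi))]

theorem IsShapePair.of_comp {a b : EuclideanSpace ℝ (Fin n) →L[ℝ] Euc n}
    {T : EuclideanSpace ℝ (Fin n) ≃L[ℝ] EuclideanSpace ℝ (Fin n)}
    (h : IsShapePair (a ∘L (T : EuclideanSpace ℝ (Fin n) →L[ℝ] _))
      (b ∘L (T : EuclideanSpace ℝ (Fin n) →L[ℝ] _))) : IsShapePair a b := by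
  refine ⟨(T.toEquiv.injective_comp a).1 h.injective, fun v w => ?_, fun v => ?_⟩
  · simpa using h.symm (T.symm v) (T.symm w)
  · obtain ⟨u, hu⟩ := h.range (T.symm v)
    exact ⟨T u, by simpa using hu⟩

/-- Every root of the polynomial extends to a root function of class `C²`, unique among the
continuous ones. -/
theorem IsHypersurfaceOn.exists_rootFunction (hn : 1 ≤ n) (h : IsHypersurfaceOn φ ν U)
    (hU : IsOpen U) (hx : x ∈ U) {s : ℝ} (hs : (trapPoly φ ν x).IsRoot s) :
    ∃ ψ : M → ℝ, ψ x = s ∧ ContMDiffAt (𝓡 n) 𝓘(ℝ, ℝ) 2 ψ x ∧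
      (∀ᶠ y in 𝓝 x, (trapPoly φ ν y).IsRoot (ψ y)) ∧
      ∀ r : M → ℝ, ContinuousAt r x → r x = s →
        (∀ᶠ y in 𝓝 x, (trapPoly φ ν y).IsRoot (r y)) → r =ᶠ[𝓝 x] ψ := by
  have : NeZero n := ⟨by omega⟩
  set z := extChartAt (𝓡 n) x x
  set a : EuclideanSpace ℝ (Fin n) → EuclideanSpace ℝ (Fin n) →L[ℝ] Euc n :=
    fderiv ℝ (inChart x φ)
  set b : EuclideanSpace ℝ (Fin n) → EuclideanSpace ℝ (Fin n) →L[ℝ] Euc n :=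
    fderiv ℝ (inChart x ν)
  have ha : ContDiffAt ℝ 2 a z := (contDiffAt_inChart (natCast_le_infty 4)
    (mem_extChartAt_source x) (h.contMDiffAt hU hx)).fderiv_right (by norm_num)
  have hb : ContDiffAt ℝ 2 b z := (contDiffAt_inChart (natCast_le_infty 3)
    (mem_extChartAt_source x) (h.gauss_contMDiffAt hU hx)).fderiv_right (by norm_num)
  have haz : a z = diff φ x := (hasFDerivAt_inChart (h.contMDiffAt_one hU hx)).fderiv
  have hbz : b z = diff ν x := (hasFDerivAt_inChart (h.gauss_contMDiffAt_one hU hx)).fderiv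
  -- The trace, rather than the polynomial, is solved for s: it is C² in the point and its
  -- s-derivative does not vanish at a zero.
  let G : EuclideanSpace ℝ (Fin n) × ℝ → ℝ := fun w =>
    relTrace (w.2 • a w.1 + b w.1) (w.2 • b w.1 - a w.1)
  have hs' := (h.isRoot_iff hU hx).1 hs
  have hi : Function.Injective (s • a z + b z) := by rw [haz, hbz]; exact hs'.1
  have ha' : ContDiffAt ℝ 2 (fun w : EuclideanSpace ℝ (Fin n) × ℝ => a w.1) (z, s) :=
    ContDiffAt.comp (z, s) (g := a) ha contDiffAt_fst
  have hb' : ContDiffAt ℝ 2 (fun w : EuclideanSpace ℝ (Fin n) × ℝ => b w.1) (z, s) :=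
    ContDiffAt.comp (z, s) (g := b) hb contDiffAt_fst
  have hP : ContDiffAt ℝ 2 (fun w : EuclideanSpace ℝ (Fin n) × ℝ => w.2 • a w.1 + b w.1) (z, s) :=
    (contDiffAt_snd.smul ha').add hb'
  have hG : ContDiffAt ℝ 2 G (z, s) :=
    contDiffAt_relTrace hP ((contDiffAt_snd.smul hb').sub ha') hi
  have hG0 : G (z, s) = 0 := by
    simp only [G, haz, hbz]
    exact hs'.2
  obtain ⟨c, hc, hder⟩ := (h.isShapePair hU hx).exists_hasDerivAt (notMem_shapeSet_iff.2 hs'.1)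
  have hL : HasFDerivAt (fun r => G (z, r)) (ContinuousLinearMap.toSpanSingleton ℝ c) s := by
    simp only [G, haz, hbz]
    exact hder.hasFDerivAt
  have hLinj : Function.Injective (ContinuousLinearMap.toSpanSingleton ℝ c) := fun u v huv => by
    simpa [hc] using huv
  obtain ⟨ψ, hψ, hψz, hψ0, huniq⟩ := exists_implicit rfl two_ne_zero hG hG0 hL hLinj
  have hroot : ∀ᶠ y in 𝓝 x, ∀ r, (trapPoly φ ν y).IsRoot r ↔
      Function.Injective (r • a (extChartAt (𝓡 n) x y) + b (extChartAt (𝓡 n) x y)) ∧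
        G (extChartAt (𝓡 n) x y, r) = 0 := by
    filter_upwards [hU.mem_nhds hx, extChartAt_source_mem_nhds (I := 𝓡 n) x] with y hy hys r
    obtain ⟨T, hT⟩ := exists_diff_eq hys
    have hsp := h.isShapePair hU hy
    rw [hT _ φ (h.contMDiffAt_one hU hy), hT _ ν (h.gauss_contMDiffAt_one hU hy)] at hsp
    rw [h.isRoot_iff hU hy, hT _ φ (h.contMDiffAt_one hU hy),
      hT _ ν (h.gauss_contMDiffAt_one hU hy), ← injective_and_relTrace_comp_iff T hsp.of_comp]
  have hcx := continuousAt_extChartAt (I := 𝓡 n) x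
  refine ⟨fun y => ψ (extChartAt (𝓡 n) x y), hψz,
    contMDiffAt_comp_extChartAt (natCast_le_infty 2) (mem_extChartAt_source x) hψ, ?_, ?_⟩
  · have hinj : ∀ᶠ y in 𝓝 z, Function.Injective (ψ y • a y + b y) := by
      refine eventually_injective (((hψ.smul ha).add hb).continuousAt) ?_
      simpa only [hψz] using hi
    filter_upwards [hroot, hcx.eventually hψ0, hcx.eventually hinj] with y h1 h2 h3
    exact (h1 _).2 ⟨h3, h2⟩
  · intro r hr hrx hr0
    have ht : Filter.Tendsto (fun y => (extChartAt (𝓡 n) x y, r y)) (𝓝 x) (𝓝 (z, s)) := by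
      rw [← hrx]
      exact hcx.prodMk hr
    filter_upwards [hroot, hr0, ht.eventually huniq] with y h1 h2 h3
    exact h3 ((h1 _).1 h2).2

end Hypersurface

/-! ### Rotations in the plane of the position vector and the normal -/

theorem sin_arccot (s : ℝ) : Real.sin (arccot s) = (√(1 + s ^ 2))⁻¹ := by
  rw [arccot, Real.sin_pi_div_two_sub, Real.cos_arctan, one_div]

theorem cos_arccot (s : ℝ) : Real.cos (arccot s) = (√(1 + s ^ 2))⁻¹ * s := by
  rw [arccot, Real.cos_pi_div_two_sub, Real.sin_arctan, div_eq_inv_mul]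

theorem sin_arccot_pos (s : ℝ) : 0 < Real.sin (arccot s) := by
  rw [sin_arccot]
  positivity

theorem arccot_cos_div_sin {θ : ℝ} (h0 : 0 < θ) (hπ : θ < Real.pi) :
    arccot (Real.cos θ / Real.sin θ) = θ := by
  have h1 : Real.cos θ / Real.sin θ = Real.tan (Real.pi / 2 - θ) := by
    rw [Real.tan_eq_sin_div_cos, Real.sin_pi_div_two_sub, Real.cos_pi_div_two_sub]
  rw [arccot, h1, Real.arctan_tan (by linarith) (by linarith)]
  ring

section Rotation

variable {n : ℕ} {M : Type*} [TopologicalSpace M] [ChartedSpace (EuclideanSpace ℝ (Fin n)) M]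
  [IsManifold (𝓡 n) ∞ M]
variable {f g : M → Euc n} {θ : M → ℝ} {x : M} {k : WithTop ℕ∞}

/-- `cos θ f + sin θ g`. -/
def rotate (θ : M → ℝ) (f g : M → Euc n) (y : M) : Euc n :=
  Real.cos (θ y) • f y + Real.sin (θ y) • g y

theorem contMDiffAt_rotate (hθ : ContMDiffAt (𝓡 n) 𝓘(ℝ, ℝ) k θ x)
    (hf : ContMDiffAt (𝓡 n) 𝓘(ℝ, Euc n) k f x) (hg : ContMDiffAt (𝓡 n) 𝓘(ℝ, Euc n) k g x) :
    ContMDiffAt (𝓡 n) 𝓘(ℝ, Euc n) k (rotate θ f g) x :=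
  (((contMDiffAt_iff_contDiffAt.2 Real.contDiff_cos.contDiffAt).comp x hθ).smul hf).add
    (((contMDiffAt_iff_contDiffAt.2 Real.contDiff_sin.contDiffAt).comp x hθ).smul hg)

theorem diff_rotate (hθ : ContMDiffAt (𝓡 n) 𝓘(ℝ, ℝ) 1 θ x)
    (hf : ContMDiffAt (𝓡 n) 𝓘(ℝ, Euc n) 1 f x) (hg : ContMDiffAt (𝓡 n) 𝓘(ℝ, Euc n) 1 g x)
    (v : EuclideanSpace ℝ (Fin n)) :
    diff (rotate θ f g) x v = diff θ x v • (Real.cos (θ x) • g x - Real.sin (θ x) • f x) +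
      (Real.cos (θ x) • diff f x v + Real.sin (θ x) • diff g x v) := by
  have h1 := hasFDerivAt_inChart hθ
  have h2 := (h1.cos.smul (hasFDerivAt_inChart hf)).add (h1.sin.smul (hasFDerivAt_inChart hg))
  rw [diff_eq_of_hasFDerivAt (contMDiffAt_rotate hθ hf hg) h2]
  rw [inChart_apply_self, inChart_apply_self, inChart_apply_self]
  simp only [_root_.add_apply, _root_.smul_apply, ContinuousLinearMap.smulRight_apply, smul_eq_mul]
  module

theorem diff_neg (hf : ContMDiffAt (𝓡 n) 𝓘(ℝ, Euc n) 1 f x) :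
    diff (n := n) (fun y => -f y) x = -diff (n := n) f x :=
  diff_eq_of_hasFDerivAt hf.neg (hasFDerivAt_inChart hf).neg

end Rotation

/-! ### The null lift of a hypersurface -/

section NullLift

variable {n : ℕ} {M : Type*} [TopologicalSpace M] [ChartedSpace (EuclideanSpace ℝ (Fin n)) M]
  [IsManifold (𝓡 n) ∞ M]
variable {φ ν : M → Euc n} {x : M} {U : Set M} {θ : M → ℝ}

/-- Only one null field has to be controlled; the second null direction is needed at the point
alone. -/
theorem IsNullField.null_meanCurvature {F : M → Euc n × ℝ} {N : M → Euc n}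
    (h : IsNullField F N x) (h0 : lorForm n (meanCurvatureL F x) (N x, 1) = 0) :
    lorForm n (meanCurvatureL F x) (meanCurvatureL F x) = 0 := by
  obtain ⟨q, hq, hne, -⟩ := h.nullDir.self_of_nhds.exists_other h.inner_base h.inner_base_diff
    h.injective.self_of_nhds
  have hqne : N x ≠ q := by
    rintro rfl
    exact hne h.nullDir.self_of_nhds.null
  exact (null_iff h.nullDir.self_of_nhds hq hqne h.inner_base h.inner_base_diff
    h.injective.self_of_nhds (meanCurvature_mem x)).2 (Or.inl h0)

theorem nullLift_eq (φ ν : M → Euc n) (s : M → ℝ) :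
    nullLift φ ν s = fun y => (rotate (fun y => arccot (s y)) φ ν y, arccot (s y)) := by
  funext y
  rw [nullLift, rotate, cos_arccot, sin_arccot, smul_add, smul_smul]

theorem contMDiffAt_prod_rotate {k : WithTop ℕ∞} (hθ : ContMDiffAt (𝓡 n) 𝓘(ℝ, ℝ) k θ x)
    (hφ : ContMDiffAt (𝓡 n) 𝓘(ℝ, Euc n) k φ x) (hν : ContMDiffAt (𝓡 n) 𝓘(ℝ, Euc n) k ν x) :
    ContMDiffAt (𝓡 n) 𝓘(ℝ, Euc n × ℝ) k (fun y => (rotate θ φ ν y, θ y)) x :=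
  (contMDiffAt_rotate hθ hφ hν).prodMk_space hθ

theorem inner_rotate {p q : Euc n} (hp : ⟪p, p⟫ = 1) (hq : ⟪q, q⟫ = 1) (hpq : ⟪p, q⟫ = 0)
    (t : ℝ) :
    ⟪Real.cos t • p + Real.sin t • q, Real.cos t • p + Real.sin t • q⟫ = 1 ∧
    ⟪Real.cos t • q - Real.sin t • p, Real.cos t • q - Real.sin t • p⟫ = 1 ∧
    ⟪Real.cos t • q - Real.sin t • p, Real.cos t • p + Real.sin t • q⟫ = 0 := by
  have hqp : ⟪q, p⟫ = 0 := (real_inner_comm _ _).trans hpq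
  have := Real.sin_sq_add_cos_sq t
  simp only [inner_add_left, inner_add_right, inner_sub_left, inner_sub_right,
    real_inner_smul_left, real_inner_smul_right, hp, hq, hpq, hqp]
  refine ⟨by linarith, by linarith, by ring⟩

/-- Differentiating the rotation gives dF₁ = dθ·N + cos θ dφ + sin θ dν. So `reduced` drops exactly
the term with dθ, and the twist likewise cancels the derivative of θ. Both maps depend on θ only
pointwise. -/
theorem IsHypersurfaceOn.isNullField (h : IsHypersurfaceOn φ ν U) (hU : IsOpen U) (hx : x ∈ U)
    (hθ : ContMDiffAt (𝓡 n) 𝓘(ℝ, ℝ) 2 θ x)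
    (hinj : ∀ᶠ y in 𝓝 x, Function.Injective
      (Real.cos (θ y) • diff (n := n) φ y + Real.sin (θ y) • diff (n := n) ν y)) :
    IsNullField (fun y => (rotate θ φ ν y, θ y)) (rotate θ ν (fun y => -φ y)) x ∧
      reduced (diff (n := n) (fun y => (rotate θ φ ν y, θ y)) x) (rotate θ ν (fun y => -φ y) x) =
        Real.cos (θ x) • diff (n := n) φ x + Real.sin (θ x) • diff (n := n) ν x ∧
      twist (fun y => (rotate θ φ ν y, θ y)) (rotate θ ν (fun y => -φ y)) x =
        Real.cos (θ x) • diff (n := n) ν x - Real.sin (θ x) • diff (n := n) φ x := by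
  set F : M → Euc n × ℝ := fun y => (rotate θ φ ν y, θ y)
  set N : M → Euc n := rotate θ ν (fun y => -φ y)
  have hNy : ∀ y, N y = Real.cos (θ y) • ν y - Real.sin (θ y) • φ y := fun y => by
    simp only [N, rotate, smul_neg, sub_eq_add_neg]
  have hF : ∀ y ∈ U, ContMDiffAt (𝓡 n) 𝓘(ℝ, ℝ) 1 θ y → ∀ v : EuclideanSpace ℝ (Fin n),
      diff F y v = (diff θ y v • N y +
        (Real.cos (θ y) • diff φ y v + Real.sin (θ y) • diff ν y v), diff θ y v) := by
    intro y hy hθy v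
    have hFy := contMDiffAt_prod_rotate hθy (h.contMDiffAt_one hU hy)
      (h.gauss_contMDiffAt_one hU hy)
    refine Prod.ext ?_ ?_
    · have h1 := DFunLike.congr_fun (diff_fst hFy) v
      rw [hNy, ← diff_rotate hθy (h.contMDiffAt_one hU hy) (h.gauss_contMDiffAt_one hU hy)]
      exact h1.symm
    · exact (DFunLike.congr_fun (diff_snd hFy) v).symm
  have hred : ∀ y ∈ U, ContMDiffAt (𝓡 n) 𝓘(ℝ, ℝ) 1 θ y → reduced (diff (n := n) F y) (N y) =
      Real.cos (θ y) • diff (n := n) φ y + Real.sin (θ y) • diff (n := n) ν y := by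
    intro y hy hθy
    ext v : 1
    rw [reduced_apply, hF y hy hθy]
    simp only [add_sub_cancel_left]
    rfl
  have hUx := hU.mem_nhds hx
  have hθ1 := eventually_contMDiffAt (k := 1) (hθ.of_le one_le_two)
  have hNx : ContMDiffAt (𝓡 n) 𝓘(ℝ, Euc n) 1 N x :=
    contMDiffAt_rotate (hθ.of_le one_le_two) (h.gauss_contMDiffAt_one hU hx)
      (h.contMDiffAt_one hU hx).neg
  refine ⟨⟨contMDiffAt_prod_rotate hθ (h.contMDiffAt_two hU hx) (h.gauss_contMDiffAt_two hU hx),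
    ?_, hNx, ?_, ?_⟩, hred x hx (hθ.of_le one_le_two), ?_⟩
  · filter_upwards [hUx] with y hy
    have h1 := (inner_rotate (h.inner_self hy) (h.inner_gauss_self hy) (h.inner_gauss hy) (θ y)).1
    rw [real_inner_self_eq_norm_sq] at h1
    exact (pow_eq_one_iff_of_nonneg (norm_nonneg _) two_ne_zero).1 h1
  · filter_upwards [hUx, hθ1] with y hy hθy
    have h1 := inner_rotate (h.inner_self hy) (h.inner_gauss_self hy) (h.inner_gauss hy) (θ y)
    refine ⟨by rw [hNy]; exact h1.2.1, by rw [hNy]; exact h1.2.2, fun v => ?_⟩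
    have h2 : ⟪N y, N y⟫ = 1 := by rw [hNy]; exact h1.2.1
    rw [hF y hy hθy]
    simp only [inner_add_right, real_inner_smul_right, h2]
    rw [hNy]
    simp only [inner_sub_left, real_inner_smul_left, h.inner_gauss_diff hy, h.inner_diff hU hy,
      h.inner_gauss_diff_gauss hU hy, h.inner_diff_gauss hU hy]
    ring
  · filter_upwards [hUx, hθ1, hinj] with y hy hθy hiy
    rwa [hred y hy hθy]
  · ext v : 1
    rw [twist_apply, hF x hx (hθ.of_le one_le_two), diff_rotate (hθ.of_le one_le_two)
      (h.gauss_contMDiffAt_one hU hx) (h.contMDiffAt_one hU hx).neg, diff_neg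
      (h.contMDiffAt_one hU hx)]
    simp only [F, rotate, _root_.sub_apply, _root_.smul_apply, _root_.neg_apply]
    module

/-- Local uniqueness identifies a continuous root with the C² one through the same value. -/
theorem IsHypersurfaceOn.contMDiffAt_rootFunction (hn : 1 ≤ n) (h : IsHypersurfaceOn φ ν U)
    (hU : IsOpen U) {s : M → ℝ} (hs : IsRootFunctionOn φ ν s U) (hx : x ∈ U) :
    ContMDiffAt (𝓡 n) 𝓘(ℝ, ℝ) 2 s x := by
  obtain ⟨ψ, -, hψ, -, huniq⟩ := h.exists_rootFunction hn hU hx (hs.2 x hx)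
  exact hψ.congr_of_eventuallyEq (huniq s (hs.1.continuousAt (hU.mem_nhds hx)) rfl (by
    filter_upwards [hU.mem_nhds hx] with y hy using hs.2 y hy))

theorem contDiff_arccot {k : WithTop ℕ∞} : ContDiff ℝ k arccot :=
  contDiff_const.sub Real.contDiff_arctan

theorem IsHypersurfaceOn.isMarginallyTrappedOn_nullLift (hn : 1 ≤ n)
    (h : IsHypersurfaceOn φ ν U) (hU : IsOpen U) {s : M → ℝ} (hs : IsRootFunctionOn φ ν s U) :
    IsMarginallyTrappedOn 2 (nullLift φ ν s) U := by
  set θ : M → ℝ := fun y => arccot (s y)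
  have hcomb : ∀ y, ∀ a b : EuclideanSpace ℝ (Fin n) →L[ℝ] Euc n,
      Real.cos (θ y) • a + Real.sin (θ y) • b = Real.sin (θ y) • (s y • a + b) ∧
      Real.cos (θ y) • b - Real.sin (θ y) • a = Real.sin (θ y) • (s y • b - a) := by
    intro y a b
    have : Real.cos (θ y) = Real.sin (θ y) * s y := by rw [cos_arccot, sin_arccot]
    rw [this, smul_add, smul_sub, smul_smul, smul_smul]
    exact ⟨rfl, rfl⟩
  have hpos : ∀ y, Real.sin (θ y) ≠ 0 := fun y => (sin_arccot_pos (s y)).ne'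
  have hinj : ∀ y ∈ U, Function.Injective
      (Real.cos (θ y) • diff (n := n) φ y + Real.sin (θ y) • diff (n := n) ν y) := by
    intro y hy
    rw [(hcomb y _ _).1]
    exact (smul_right_injective _ (hpos y)).comp ((h.isRoot_iff hU hy).1 (hs.2 y hy)).1
  have hθ : ∀ y ∈ U, ContMDiffAt (𝓡 n) 𝓘(ℝ, ℝ) 2 θ y := fun y hy =>
    (contMDiffAt_iff_contDiffAt.2 contDiff_arccot.contDiffAt).comp y
      (h.contMDiffAt_rootFunction hn hU hs hy)
  have key := fun y (hy : y ∈ U) => h.isNullField hU hy (hθ y hy)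
    (by filter_upwards [hU.mem_nhds hy] with w hw using hinj w hw)
  rw [nullLift_eq]
  refine ⟨⟨fun y hy => (key y hy).1.contMDiffAt.contMDiffWithinAt,
    fun y hy => (key y hy).1.base_unit.self_of_nhds, fun y hy v hv => ?_⟩, fun y hy => ?_⟩
  · have hN := (key y hy).1
    rw [firstForm, ← hN.nullDir.self_of_nhds.inner_reduced]
    refine real_inner_self_pos.2 fun h0 => hv (hN.injective.self_of_nhds ?_)
    rw [h0, map_zero]
  · obtain ⟨hN, hP, hQ⟩ := key y hy
    have hroot := (h.isRoot_iff hU hy).1 (hs.2 y hy)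
    have hc := hcomb y (diff φ y) (diff ν y)
    refine hN.null_meanCurvature ?_
    rw [hN.lorForm_meanCurvature, hP, hQ, hc.1, hc.2,
      relTrace_smul_smul hroot.1 ((h.isShapePair hU hy).exists_combination
        (notMem_shapeSet_iff.2 hroot.1)) (hpos y), hroot.2, neg_zero]

/-- Roots are numbered in increasing order at each point. As their number is constant, the local C²
branches through the roots at x exhaust the roots nearby and keep their order, so each numbered root
agrees with a branch. -/
theorem IsHypersurfaceOn.exists_rootFunctions (hn : 1 ≤ n) (h : IsHypersurfaceOn φ ν U)
    (hU : IsOpen U) {q : ℕ} (hq : ∀ x ∈ U, {t | (trapPoly φ ν x).IsRoot t}.encard = q) :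
    ∃ s : Fin q → M → ℝ,
      (∀ x ∈ U, Function.Injective (fun i => s i x) ∧
        Set.range (fun i => s i x) = {t | (trapPoly φ ν x).IsRoot t}) ∧
      ∀ i, IsRootFunctionOn φ ν (s i) U := by
  have hex : ∀ x, ∃ e : Fin q → ℝ, x ∈ U →
      StrictMono e ∧ Set.range e = {t | (trapPoly φ ν x).IsRoot t} := by
    intro x
    by_cases hx : x ∈ U
    · have hfin := Set.finite_of_encard_eq_coe (hq x hx)
      have hcard : hfin.toFinset.card = q := by
        have := hq x hx
        rw [hfin.encard_eq_coe_toFinset_card] at this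
        exact_mod_cast this
      refine ⟨hfin.toFinset.orderEmbOfFin hcard, fun _ => ⟨OrderEmbedding.strictMono _, ?_⟩⟩
      rw [Finset.range_orderEmbOfFin, hfin.coe_toFinset]
    · exact ⟨fun _ => 0, fun h => absurd h hx⟩
  choose e he using hex
  have hroot : ∀ x ∈ U, ∀ i, (trapPoly φ ν x).IsRoot (e x i) := fun x hx i => by
    have : e x i ∈ Set.range (e x) := ⟨i, rfl⟩
    rwa [(he x hx).2] at this
  refine ⟨fun i x => e x i, fun x hx => ⟨(he x hx).1.injective, (he x hx).2⟩,
    fun i => ⟨fun x hx => ContinuousAt.continuousWithinAt ?_, fun x hx => hroot x hx i⟩⟩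
  choose ψ hψx hψ hψr _ using fun j => h.exists_rootFunction hn hU hx (hroot x hx j)
  have hmono : ∀ᶠ y in 𝓝 x, ∀ j k, j < k → ψ j y < ψ k y := by
    rw [Filter.eventually_all]
    intro j
    rw [Filter.eventually_all]
    intro k
    by_cases hjk : j < k
    · have := (hψ j).continuousAt.eventually_lt (hψ k).continuousAt
        (by rw [hψx, hψx]; exact (he x hx).1 hjk)
      filter_upwards [this] with y hy _ using hy
    · exact Filter.Eventually.of_forall fun y h => absurd h hjk
  refine (hψ i).continuousAt.congr ?_
  filter_upwards [hmono, Filter.eventually_all.2 hψr, hU.mem_nhds hx] with y h1 h2 h3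
  have hsm : StrictMono fun j => ψ j y := fun j k hjk => h1 j k hjk
  have hrange : Set.range (fun j => ψ j y) = Set.range (e y) := by
    rw [(he y h3).2]
    -- The q branches are distinct roots at y, and there are only q roots.
    refine (Set.finite_of_encard_eq_coe (hq y h3)).eq_of_subset_of_encard_le' ?_ ?_
    · rintro _ ⟨j, rfl⟩
      exact h2 j
    · rw [hq y h3, ← Set.image_univ, hsm.injective.encard_image]
      simp
  exact congrFun ((hsm.range_inj (he y h3).1).1 hrange) i

end NullLift

/-! ### Marginally trapped immersions are null lifts -/

section Converse

variable {n : ℕ} {M : Type*} [TopologicalSpace M] [ChartedSpace (EuclideanSpace ℝ (Fin n)) M]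
  [IsManifold (𝓡 n) ∞ M]
variable {F : M → Euc n × ℝ} {N : M → Euc n} {x : M} {U : Set M}

theorem eventually_injective_diff {f : M → Euc n} (hf : ContMDiffAt (𝓡 n) 𝓘(ℝ, Euc n) 1 f x)
    (hinj : Function.Injective (diff (n := n) f x)) :
    ∀ᶠ y in 𝓝 x, Function.Injective (diff (n := n) f y) := by
  have h1 : ContDiffAt ℝ 0 (fderiv ℝ (inChart x f)) (extChartAt (𝓡 n) x x) :=
    (contDiffAt_inChart (natCast_le_infty 1) (mem_extChartAt_source x) hf).fderiv_right
      (by norm_num)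
  have h2 : Function.Injective (fderiv ℝ (inChart x f) (extChartAt (𝓡 n) x x)) := by
    rwa [(hasFDerivAt_inChart hf).fderiv]
  filter_upwards [eventually_contMDiffAt (k := 1) hf,
    eventually_of_inChart (eventually_injective h1.continuousAt h2)] with y hy hy1
  obtain ⟨T, hT⟩ := exists_diff_eq hy1.1
  rw [hT _ f hy]
  exact hy1.2.comp T.injective

/-- For large s the vector s P v is longer than Q v. -/
theorem exists_injective_smul_sub {P Q : EuclideanSpace ℝ (Fin n) →L[ℝ] Euc n}
    (hP : Function.Injective P) : ∃ s : ℝ, Function.Injective (s • P - Q) := by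
  obtain ⟨c, hc, h⟩ := exists_pos_mul_norm_le hP
  refine ⟨(‖Q‖ + 1) / c, (injective_iff_map_eq_zero _).2 fun v hv => ?_⟩
  rw [_root_.sub_apply, _root_.smul_apply, sub_eq_zero] at hv
  have h1 := Q.le_opNorm v
  rw [← hv, norm_smul, Real.norm_of_nonneg (by positivity)] at h1
  have h2 : (‖Q‖ + 1) / c * (c * ‖v‖) ≤ (‖Q‖ + 1) / c * ‖P v‖ := by gcongr; exact h v
  have h3 : (‖Q‖ + 1) / c * (c * ‖v‖) = (‖Q‖ + 1) * ‖v‖ := by field_simp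
  have h4 : ‖v‖ ≤ 0 := by linarith
  exact norm_le_zero_iff.1 h4

/-- Rotating the position vector and the null normal field back gives a hypersurface and its Gauss
map. -/
theorem IsNullField.diff_rotate_back (h : IsNullField F N x) (c : ℝ) :
    diff (n := n) (rotate (fun y => (F y).2 + c) (fun y => (F y).1) (fun y => -N y)) x =
      Real.cos ((F x).2 + c) • reduced (diff F x) (N x) -
        Real.sin ((F x).2 + c) • twist F N x ∧
    diff (n := n) (rotate (fun y => (F y).2 + c) N (fun y => (F y).1)) x =
      Real.sin ((F x).2 + c) • reduced (diff F x) (N x) +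
        Real.cos ((F x).2 + c) • twist F N x := by
  have hθ : ContMDiffAt (𝓡 n) 𝓘(ℝ, ℝ) 1 (fun y => (F y).2 + c) x :=
    (contMDiffAt_snd h.contMDiffAt_one).add contMDiffAt_const
  have hdθ : diff (n := n) (fun y => (F y).2 + c) x = ContinuousLinearMap.snd ℝ _ _ ∘L diff F x :=
    diff_eq_of_hasFDerivAt hθ ((hasFDerivAt_inChart h.contMDiffAt_one).snd.add_const c)
  constructor
  · ext v : 1
    rw [diff_rotate hθ (contMDiffAt_fst h.contMDiffAt_one) h.field_contMDiffAt.neg,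
      diff_neg h.field_contMDiffAt, diff_fst h.contMDiffAt_one, hdθ]
    simp only [_root_.sub_apply, _root_.smul_apply, _root_.neg_apply, twist_apply, reduced_apply,
      ContinuousLinearMap.comp_apply, ContinuousLinearMap.coe_fst', ContinuousLinearMap.coe_snd']
    module
  · ext v : 1
    rw [diff_rotate hθ h.field_contMDiffAt (contMDiffAt_fst h.contMDiffAt_one),
      diff_fst h.contMDiffAt_one, hdθ]
    simp only [_root_.add_apply, _root_.smul_apply, twist_apply, reduced_apply,
      ContinuousLinearMap.comp_apply, ContinuousLinearMap.coe_fst', ContinuousLinearMap.coe_snd']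
    module

/-- Rotating the orthonormal pair (F₁, N) through θ = t + c gives φ and ν. Inverting the rotation
recovers F, and s dφ + dν, s dν - dφ become P/sin θ and Q/sin θ, where P is `reduced` and Q is
`twist`. So the root condition is the vanishing of ⟨H, (N, 1)⟩. -/
theorem IsNullField.isLocallyNullLift (h : IsNullField F N x)
    (hF : ContMDiffAt (𝓡 n) 𝓘(ℝ, Euc n × ℝ) 5 F x) (hN : ContMDiffAt (𝓡 n) 𝓘(ℝ, Euc n) 4 N x)
    (htr : ∀ᶠ y in 𝓝 x, lorForm n (meanCurvatureL F y) (N y, 1) = 0) :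
    IsLocallyNullLift F x := by
  obtain ⟨s₀, hs₀⟩ := exists_injective_smul_sub (Q := twist F N x) h.injective.self_of_nhds
  -- The vertical translation is chosen so that cot θ(x) = s₀. Then dφ at x is a nonzero multiple of
  -- the injective map s₀ P - Q.
  set c := arccot s₀ - (F x).2 with hc
  set θ : M → ℝ := fun y => (F y).2 + c with hθdef
  have hθx : θ x = arccot s₀ := by simp only [hθdef, hc]; ring
  set φ : M → Euc n := rotate θ (fun y => (F y).1) (fun y => -N y) with hφ
  set ν : M → Euc n := rotate θ N (fun y => (F y).1) with hν
  have hdiff : ∀ y, IsNullField F N y →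
      diff (n := n) φ y = Real.cos (θ y) • reduced (diff F y) (N y) -
        Real.sin (θ y) • twist F N y ∧
      diff (n := n) ν y = Real.sin (θ y) • reduced (diff F y) (N y) +
        Real.cos (θ y) • twist F N y := fun y hy => hy.diff_rotate_back c
  have hF4 : ContMDiffAt (𝓡 n) 𝓘(ℝ, Euc n × ℝ) 4 F x := hF.of_le (by norm_num)
  have hθ4 : ContMDiffAt (𝓡 n) 𝓘(ℝ, ℝ) 4 θ x := (contMDiffAt_snd hF4).add contMDiffAt_const
  have hφ4 : ContMDiffAt (𝓡 n) 𝓘(ℝ, Euc n) 4 φ x :=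
    contMDiffAt_rotate hθ4 (contMDiffAt_fst hF4) hN.neg
  have hν4 : ContMDiffAt (𝓡 n) 𝓘(ℝ, Euc n) 4 ν x :=
    contMDiffAt_rotate hθ4 hN (contMDiffAt_fst hF4)
  have hφinj : Function.Injective (diff (n := n) φ x) := by
    have h1 : diff (n := n) φ x =
        Real.sin (θ x) • (s₀ • reduced (diff F x) (N x) - twist F N x) := by
      rw [(hdiff x h).1, hθx, cos_arccot, sin_arccot, smul_sub, smul_smul]
    have h2 : Real.sin (θ x) ≠ 0 := by
      rw [hθx]
      exact (sin_arccot_pos s₀).ne'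
    rw [h1]
    exact (smul_right_injective _ h2).comp hs₀
  -- Staying in (0, π) keeps sin θ positive and lets `arccot` undo the cotangent.
  have hθI : ∀ᶠ y in 𝓝 x, θ y ∈ Set.Ioo 0 Real.pi := by
    refine hθ4.continuousAt.eventually (isOpen_Ioo.mem_nhds ?_)
    rw [hθx, arccot]
    have h1 := Real.arctan_lt_pi_div_two s₀
    have h2 := Real.neg_pi_div_two_lt_arctan s₀
    constructor <;> linarith
  have hgood : ∀ᶠ y in 𝓝 x, IsNullField F N y ∧ ContMDiffAt (𝓡 n) 𝓘(ℝ, Euc n) 4 φ y ∧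
      ContMDiffAt (𝓡 n) 𝓘(ℝ, Euc n) 4 ν y ∧ Function.Injective (diff (n := n) φ y) ∧
      θ y ∈ Set.Ioo 0 Real.pi ∧ lorForm n (meanCurvatureL F y) (N y, 1) = 0 := by
    filter_upwards [h.eventually, eventually_contMDiffAt (k := 4) hφ4,
      eventually_contMDiffAt (k := 4) hν4,
      eventually_injective_diff (hφ4.of_le (by norm_num)) hφinj, hθI, htr] with y h1 h2 h3 h4 h5 h6
    exact ⟨h1, h2, h3, h4, h5, h6⟩
  obtain ⟨O, hO, hOo, hxO⟩ := eventually_nhds_iff.1 hgood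
  have horth : ∀ y ∈ O, ⟪φ y, φ y⟫ = 1 ∧ ⟪ν y, ν y⟫ = 1 ∧ ⟪φ y, ν y⟫ = 0 := by
    intro y hy
    have hNy := (hO y hy).1
    have h1 := inner_rotate hNy.nullDir.self_of_nhds.unit hNy.inner_base
      hNy.nullDir.self_of_nhds.perp (θ y)
    have h2 : φ y = Real.cos (θ y) • (F y).1 - Real.sin (θ y) • N y := by
      simp only [hφ, rotate, smul_neg, sub_eq_add_neg]
    rw [h2]
    exact ⟨h1.2.1, h1.1, h1.2.2⟩
  have hnorm : ∀ u : Euc n, ⟪u, u⟫ = 1 → ‖u‖ = 1 := fun u hu => by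
    rw [real_inner_self_eq_norm_sq] at hu
    exact (pow_eq_one_iff_of_nonneg (norm_nonneg _) two_ne_zero).1 hu
  have hhyp : IsHypersurfaceOn φ ν O := by
    refine ⟨fun y hy => (hO y hy).2.1.contMDiffWithinAt, fun y hy => hnorm _ (horth y hy).1,
      fun y hy => (hO y hy).2.2.2.1,
      fun y hy => ((hO y hy).2.2.1.of_le (by norm_num)).contMDiffWithinAt,
      fun y hy => hnorm _ (horth y hy).2.1, fun y hy => ?_⟩
    have hNy := (hO y hy).1
    refine mem_normalSpace_sphere.2 ⟨(horth y hy).2.2, fun v => ?_⟩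
    rw [(hdiff y hNy).1]
    simp only [hν, rotate, _root_.sub_apply, _root_.smul_apply, inner_sub_left, inner_add_right,
      real_inner_smul_right,
      real_inner_comm (N y), real_inner_comm (F y).1, hNy.inner_field_twist, hNy.inner_base_twist,
      hNy.nullDir.self_of_nhds.inner_reduced_left,
      hNy.nullDir.self_of_nhds.inner_base_reduced hNy.inner_base_diff]
    ring
  have hsin : ∀ y ∈ O, Real.sin (θ y) ≠ 0 := fun y hy =>
    (Real.sin_pos_of_mem_Ioo (hO y hy).2.2.2.2.1).ne'
  refine ⟨O, hOo, hxO, φ, ν, fun y => Real.cos (θ y) / Real.sin (θ y), c, hhyp, ⟨?_, ?_⟩, ?_⟩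
  · intro y hy
    have hθy : ContinuousAt θ y :=
      (contMDiffAt_snd (hO y hy).1.contMDiffAt).continuousAt.add continuousAt_const
    exact ((Real.continuous_cos.continuousAt.comp hθy).div
      (Real.continuous_sin.continuousAt.comp hθy) (hsin y hy)).continuousWithinAt
  · intro y hy
    have hNy := (hO y hy).1
    have hs := hsin y hy
    have hsc := Real.sin_sq_add_cos_sq (θ y)
    have h1 : (Real.cos (θ y) / Real.sin (θ y)) • diff (n := n) φ y + diff (n := n) ν y =
        (Real.sin (θ y))⁻¹ • reduced (diff F y) (N y) := by
      rw [(hdiff y hNy).1, (hdiff y hNy).2]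
      match_scalars <;> field_simp <;> linarith
    have h2 : (Real.cos (θ y) / Real.sin (θ y)) • diff (n := n) ν y - diff (n := n) φ y =
        (Real.sin (θ y))⁻¹ • twist F N y := by
      rw [(hdiff y hNy).1, (hdiff y hNy).2]
      match_scalars <;> field_simp <;> linarith
    rw [hhyp.isRoot_iff hOo hy, h1, h2, relTrace_smul_smul hNy.injective.self_of_nhds
      hNy.exists_twist_eq (inv_ne_zero hs)]
    refine ⟨(smul_right_injective _ (inv_ne_zero hs)).comp hNy.injective.self_of_nhds, ?_⟩
    have h3 := hNy.lorForm_meanCurvature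
    rw [(hO y hy).2.2.2.2.2] at h3
    linarith
  · intro y hy
    have hI := (hO y hy).2.2.2.2.1
    have hsc := Real.sin_sq_add_cos_sq (θ y)
    rw [nullLift_eq]
    simp only [rotate, arccot_cos_div_sin hI.1 hI.2]
    refine Prod.ext ?_ rfl
    simp only [hφ, hν, rotate]
    match_scalars
    · linarith
    · ring

theorem IsSpacelikeOn.nondegenerate {k : WithTop ℕ∞} (h : IsSpacelikeOn k F U) {y : M}
    (hy : y ∈ U) (v : EuclideanSpace ℝ (Fin n))
    (hv : ∀ w : EuclideanSpace ℝ (Fin n), lorForm n (diff F y v) (diff F y w) = 0) : v = 0 := by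
  by_contra hv0
  exact (h.spacelike y hy v hv0).ne' (hv v)

/-- Scaled to vertical part 1, the continuous field ξ coincides with the C⁴ null field through its
value at x, by local uniqueness. -/
theorem isLocallyNullLift_of_nullNormal (hU : IsOpen U) (h : IsMarginallyTrappedOn 5 F U)
    (hx : x ∈ U) {O : Set M} {ξ : M → Euc n × ℝ} (hO : IsOpen O) (hxO : x ∈ O)
    (hξ : IsNullNormalOn F ξ O) (hH : ∀ y ∈ O, lorForm n (meanCurvatureL F y) (ξ y) = 0) :
    IsLocallyNullLift F x := by
  have hF : ContMDiffAt (𝓡 n) 𝓘(ℝ, Euc n × ℝ) 5 F x :=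
    h.1.contMDiffOn.contMDiffAt (hU.mem_nhds hx)
  have hdir : ∀ y ∈ O, (ξ y).2 ≠ 0 ∧ NullDir (F y).1 ((ξ y).2⁻¹ • (ξ y).1) (diff F y) := by
    intro y hy
    have h1 := hξ.2 y hy
    have h2 := mem_normalSpace.1 h1.2.2
    exact nullDir_of_null h1.1 h1.2.1 h2.1 h2.2
  obtain ⟨N, -, hN4, hN, huniq⟩ := exists_nullField (k := 4) (by norm_num) hF
    (by filter_upwards [hU.mem_nhds hx] with y hy using h.1.mem y hy) (hdir x hxO).2
    ((hdir x hxO).2.injective_reduced (h.1.nondegenerate hx))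
  have hξc : ContinuousAt ξ x := hξ.1.continuousAt (hO.mem_nhds hxO)
  have heq := huniq (fun y => (ξ y).2⁻¹ • (ξ y).1)
    ((hξc.snd.inv₀ (hdir x hxO).1).smul hξc.fst) rfl
    (by filter_upwards [hO.mem_nhds hxO] with y hy using (hdir y hy).2)
  refine hN.isLocallyNullLift hF hN4 ?_
  filter_upwards [heq, hO.mem_nhds hxO] with y hy hyO
  have h1 : (N y, (1 : ℝ)) = (ξ y).2⁻¹ • ξ y := by
    rw [← hy]
    exact Prod.ext rfl (by simp [(hdir y hyO).1])
  rw [h1, map_smul, hH y hyO, smul_zero]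

/-- H spans one null line at x, so its product with the other null direction is nonzero at x and
nearby. Nullity of H then forces orthogonality to the first field on a neighbourhood. -/
theorem isLocallyNullLift_of_meanCurvature_ne_zero (hU : IsOpen U)
    (h : IsMarginallyTrappedOn 5 F U) (hx : x ∈ U) (hne : meanCurvatureL F x ≠ 0) :
    IsLocallyNullLift F x := by
  have hF : ContMDiffAt (𝓡 n) 𝓘(ℝ, Euc n × ℝ) 5 F x :=
    h.1.contMDiffOn.contMDiffAt (hU.mem_nhds hx)
  have hunit : ∀ᶠ y in 𝓝 x, ‖(F y).1‖ = 1 := by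
    filter_upwards [hU.mem_nhds hx] with y hy using h.1.mem y hy
  have hmem := mem_normalSpace.1 (meanCurvature_mem (F := F) x)
  set ζ := meanCurvatureL F x with hζdef
  obtain ⟨hζ2, hdir⟩ := nullDir_of_null hne (h.2 x hx) hmem.1 hmem.2
  obtain ⟨N, hNx, hN4, hN, -⟩ := exists_nullField (k := 4) (by norm_num) hF hunit hdir
    (hdir.injective_reduced (h.1.nondegenerate hx))
  rw [← hNx] at hdir
  obtain ⟨q, hq, hqne, -⟩ := hdir.exists_other hN.inner_base hN.inner_base_diff
    hN.injective.self_of_nhds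
  obtain ⟨N', hN'x, -, hN', -⟩ := exists_nullField (k := 4) (by norm_num) hF hunit hq
    (hq.injective_reduced (h.1.nondegenerate hx))
  have hζ : ζ = ζ.2 • (N x, 1) := by
    rw [hNx]
    exact Prod.ext (by simp [smul_smul, hζ2]) (by simp)
  have hNN' : N x ≠ N' x := by
    intro h0
    rw [hN'x] at h0
    rw [← h0, hdir.null] at hqne
    exact hqne rfl
  have htr : relTrace (reduced (diff F x) (N' x)) (twist F N' x) ≠ 0 := by
    rw [← neg_ne_zero, ← hN'.lorForm_meanCurvature, ← hζdef, hζ, map_smul, LinearMap.smul_apply,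
      hN'x]
    exact mul_ne_zero hζ2 hqne
  refine hN.isLocallyNullLift hF hN4 ?_
  filter_upwards [hN.eventually, hN'.eventually, hN'.eventually_relTrace_ne_zero htr,
    hU.mem_nhds hx,
    (hN.field_contMDiffAt.continuousAt.sub hN'.field_contMDiffAt.continuousAt).eventually_ne
      (sub_ne_zero.2 hNN')] with y h1 h2 h3 h4 h5
  refine ((null_iff h1.nullDir.self_of_nhds h2.nullDir.self_of_nhds (sub_ne_zero.1 h5)
    h1.inner_base h1.inner_base_diff h1.injective.self_of_nhds (meanCurvature_mem y)).1
    (h.2 y h4)).resolve_right ?_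
  rw [h2.lorForm_meanCurvature, neg_eq_zero]
  exact h3

/-- Where H vanishes identically any null field will do, and spacelikeness provides one. -/
theorem isLocallyNullLift_of_eventually_meanCurvature_eq_zero (hU : IsOpen U)
    (h : IsMarginallyTrappedOn 5 F U) (hx : x ∈ U)
    (h0 : ∀ᶠ y in 𝓝 x, meanCurvatureL F y = 0) : IsLocallyNullLift F x := by
  have hF : ContMDiffAt (𝓡 n) 𝓘(ℝ, Euc n × ℝ) 5 F x :=
    h.1.contMDiffOn.contMDiffAt (hU.mem_nhds hx)
  have hunit : ∀ᶠ y in 𝓝 x, ‖(F y).1‖ = 1 := by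
    filter_upwards [hU.mem_nhds hx] with y hy using h.1.mem y hy
  obtain ⟨q, hq⟩ := exists_nullDir (inner_base_diff (hF.of_le (by norm_num)) hunit)
    (h.1.spacelike x hx)
  obtain ⟨N, -, hN4, hN, -⟩ := exists_nullField (k := 4) (by norm_num) hF hunit hq
    (hq.injective_reduced (h.1.nondegenerate hx))
  refine hN.isLocallyNullLift hF hN4 ?_
  filter_upwards [h0] with y hy
  rw [hy, map_zero, LinearMap.zero_apply]

/-- A point without a neighbourhood on which H = 0 is a limit of points with H ≠ 0. -/
theorem exists_open_dense_isLocallyNullLift (hU : IsOpen U) (h : IsMarginallyTrappedOn 5 F U) :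
    ∃ O : Set M, IsOpen O ∧ O ⊆ U ∧ U ⊆ closure O ∧
      (∀ x ∈ U, meanCurvatureL F x ≠ 0 → x ∈ O) ∧ ∀ x ∈ O, IsLocallyNullLift F x := by
  refine ⟨{x | x ∈ U ∧ IsLocallyNullLift F x}, ?_, fun x hx => hx.1, fun x hx => ?_,
    fun x hx hne => ⟨hx, isLocallyNullLift_of_meanCurvature_ne_zero hU h hx hne⟩, fun x hx => hx.2⟩
  · rw [isOpen_iff_mem_nhds]
    rintro x ⟨hx, O, hO, hxO, hlift⟩
    filter_upwards [hU.mem_nhds hx, hO.mem_nhds hxO] with y hy hyO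
    exact ⟨hy, O, hO, hyO, hlift⟩
  · by_cases h0 : ∀ᶠ y in 𝓝 x, meanCurvatureL F y = 0
    · exact subset_closure
        ⟨hx, isLocallyNullLift_of_eventually_meanCurvature_eq_zero hU h hx h0⟩
    · rw [mem_closure_iff_frequently]
      rw [Filter.not_eventually] at h0
      refine (h0.and_eventually (hU.mem_nhds hx)).mono fun y hy => ?_
      exact ⟨hy.2, isLocallyNullLift_of_meanCurvature_ne_zero hU h hy.2 hy.1⟩

end Converse

/-! ### Surfaces -/

section Surface

variable {n : ℕ} {M : Type*} [TopologicalSpace M] [ChartedSpace (EuclideanSpace ℝ (Fin n)) M]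
  [IsManifold (𝓡 n) ∞ M]
variable {φ ν : M → Euc n} {x : M} {U : Set M} {κ₁ κ₂ : M → ℝ}

/-- The roots `a ± √(a² + 1)` of the polynomial of a surface. -/
def surfaceRoot (ε : ℝ) (a : M → ℝ) (x : M) : ℝ := a x + ε * √(a x ^ 2 + 1)

/-- For s = a + ε√(a² + 1) one has 1 + s² = 2(a² + 1 + εa√(a² + 1)), the normalising factor of the
explicit formula. -/
theorem surfaceLift_eq_nullLift {ε : ℝ} (hε : ε ^ 2 = 1) (φ ν : M → Euc n) (a : M → ℝ) :
    surfaceLift ε φ ν a = nullLift φ ν (surfaceRoot ε a) := by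
  funext y
  have h1 : 1 + surfaceRoot ε a y ^ 2 = 2 * (a y ^ 2 + 1 + ε * (a y * √(a y ^ 2 + 1))) := by
    have := Real.sq_sqrt (show 0 ≤ a y ^ 2 + 1 by positivity)
    rw [surfaceRoot]
    linear_combination ε ^ 2 * this + (a y ^ 2 + 1) * hε
  rw [nullLift, h1, Real.sqrt_mul zero_le_two]
  rfl

theorem IsHypersurfaceOn.roots_surface (hn : n = 2) (h : IsHypersurfaceOn φ ν U) (hU : IsOpen U)
    (hx : x ∈ U) (hH : meanCurvatureS φ x ≠ 0)
    (hκ : principalCurvatures φ ν x = {κ₁ x, κ₂ x}) (hne : κ₁ x ≠ κ₂ x) :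
    {t | (trapPoly φ ν x).IsRoot t} =
      {surfaceRoot 1 (surfaceParam κ₁ κ₂) x, surfaceRoot (-1) (surfaceParam κ₁ κ₂) x} := by
  have hs := h.isShapePair hU hx
  have hK : hs.finite.toFinset = {κ₁ x, κ₂ x} := by
    ext μ
    rw [Set.Finite.mem_toFinset]
    change μ ∈ principalCurvatures φ ν x ↔ _
    rw [hκ]
    simp
  have hm : ∀ κ ∈ hs.finite.toFinset,
      0 < shapeMult (diff (n := n) φ x) (diff (n := n) ν x) κ := fun κ hκ =>
    shapeMult_pos (hs.finite.mem_toFinset.1 hκ)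
  have hsum := hs.sum_mult
  have hH' := (h.meanCurvature_eq_zero_iff hU hx).not.1 hH
  have hroot := h.trapPoly_eq hU hx
  rw [hK] at hm hsum hH' hroot
  rw [Finset.sum_pair hne, finrank_euclideanSpace_fin] at hsum
  have hm1 := hm (κ₁ x) (by simp)
  have hm2 := hm (κ₂ x) (by simp)
  have e1 : shapeMult (diff (n := n) φ x) (diff (n := n) ν x) (κ₁ x) = 1 := by omega
  have e2 : shapeMult (diff (n := n) φ x) (diff (n := n) ν x) (κ₂ x) = 1 := by omega
  rw [Finset.sum_pair hne, e1, e2] at hH'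
  have hκ0 : κ₁ x + κ₂ x ≠ 0 := by simpa using hH'
  ext t
  simp only [Set.mem_ofPred_eq, Set.mem_insert_iff, Set.mem_singleton_iff]
  rw [IsRoot.def, hroot, eval_weightedPoly, Finset.sum_pair hne, e1, e2,
    Finset.erase_insert (by simpa using hne), Finset.pair_comm,
    Finset.erase_insert (by simpa using hne.symm), Finset.prod_singleton, Finset.prod_singleton]
  set a := surfaceParam κ₁ κ₂ x with ha
  have ha' : a * (κ₁ x + κ₂ x) = κ₁ x * κ₂ x - 1 := by
    rw [ha, surfaceParam]
    field_simp
  have hsq := Real.sq_sqrt (show 0 ≤ a ^ 2 + 1 by positivity)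
  -- Both multiplicities are 1, so the polynomial is (κ₁ + κ₂)(t² - 2at - 1).
  have hfac : ((1 : ℕ) : ℝ) * (κ₁ x * t + 1) * (t - κ₂ x) +
      ((1 : ℕ) : ℝ) * (κ₂ x * t + 1) * (t - κ₁ x) =
      (κ₁ x + κ₂ x) * ((t - (a + 1 * √(a ^ 2 + 1))) * (t - (a + -1 * √(a ^ 2 + 1)))) := by
    push_cast
    linear_combination (2 * t) * ha' + (κ₁ x + κ₂ x) * hsq
  rw [hfac, mul_eq_zero, or_iff_right hκ0, mul_eq_zero, sub_eq_zero, sub_eq_zero]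
  rfl

/-- κ₁ and κ₂ are arbitrary functions and may be exchanged from point to point. Continuity of the
explicit roots comes instead from their being the maximum and minimum of the two continuous root
functions. -/
theorem IsHypersurfaceOn.isRootFunctionOn_surfaceRoot (hn : n = 2) (h : IsHypersurfaceOn φ ν U)
    (hU : IsOpen U) (hH : ∀ x ∈ U, meanCurvatureS φ x ≠ 0)
    (hκ : ∀ x ∈ U, principalCurvatures φ ν x = {κ₁ x, κ₂ x} ∧ κ₁ x ≠ κ₂ x) :
    IsRootFunctionOn φ ν (surfaceRoot 1 (surfaceParam κ₁ κ₂)) U ∧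
      IsRootFunctionOn φ ν (surfaceRoot (-1) (surfaceParam κ₁ κ₂)) U := by
  have hroots := fun x (hx : x ∈ U) =>
    h.roots_surface hn hU hx (hH x hx) (hκ x hx).1 (hκ x hx).2
  obtain ⟨s, hs, hsr⟩ := h.exists_rootFunctions (by omega) hU (q := 2) fun x hx => by
    rw [(h.encard_roots (by omega) hU hx).2 (hH x hx), (hκ x hx).1, Set.ncard_pair (hκ x hx).2]
  have hle : ∀ x, surfaceRoot (-1) (surfaceParam κ₁ κ₂) x ≤
      surfaceRoot 1 (surfaceParam κ₁ κ₂) x := fun x => by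
    have := Real.sqrt_nonneg (surfaceParam κ₁ κ₂ x ^ 2 + 1)
    simp only [surfaceRoot]
    linarith
  have hminmax : ∀ x ∈ U,
      surfaceRoot 1 (surfaceParam κ₁ κ₂) x = max (s 0 x) (s 1 x) ∧
      surfaceRoot (-1) (surfaceParam κ₁ κ₂) x = min (s 0 x) (s 1 x) := by
    intro x hx
    have hx' := hle x
    have h1 := (hs x hx).2.trans (hroots x hx)
    set r₁ := surfaceRoot 1 (surfaceParam κ₁ κ₂) x
    set r₂ := surfaceRoot (-1) (surfaceParam κ₁ κ₂) x
    have h2 : ∀ i, s i x = r₁ ∨ s i x = r₂ := fun i => by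
      have : s i x ∈ ({r₁, r₂} : Set ℝ) := h1 ▸ ⟨i, rfl⟩
      simpa using this
    have h3 : s 0 x ≠ s 1 x := fun h4 => by
      have := (hs x hx).1 h4
      simp at this
    rcases h2 0 with h4 | h4 <;> rcases h2 1 with h5 | h5
    · exact absurd (h4.trans h5.symm) h3
    · rw [h4, h5, max_eq_left hx', min_eq_right hx']; exact ⟨rfl, rfl⟩
    · rw [h4, h5, max_eq_right hx', min_eq_left hx']; exact ⟨rfl, rfl⟩
    · exact absurd (h4.trans h5.symm) h3
  refine ⟨⟨(ContinuousOn.sup (hsr 0).1 (hsr 1).1).congr fun x hx => (hminmax x hx).1, fun x hx => ?_⟩,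
    ⟨(ContinuousOn.inf (hsr 0).1 (hsr 1).1).congr fun x hx => (hminmax x hx).2, fun x hx => ?_⟩⟩
  · change _ ∈ {t | (trapPoly φ ν x).IsRoot t}
    rw [hroots x hx]
    exact Or.inl rfl
  · change _ ∈ {t | (trapPoly φ ν x).IsRoot t}
    rw [hroots x hx]
    exact Or.inr rfl

end Surface

end MarginallyTrapped

end

/-! ### Assembly of the four statements -/

open MarginallyTrapped in
theorem theorem3 (n : ℕ) (hn : 1 ≤ n) {M : Type*} [TopologicalSpace M]
    [ChartedSpace (EuclideanSpace ℝ (Fin n)) M] [IsManifold (𝓡 n) ∞ M]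
    (U : Set M) (hU : IsOpen U) :
    -- null second fundamental form
    (2 ≤ n → ∀ F : M → Euc n × ℝ, IsNondegenerateOn 2 F U →
      HasNullSecondFormOn F U → IsTotallyGeodesicOn F U) ∧
    -- hypersurfaces of the sphere
    (∀ φ ν : M → Euc n, IsHypersurfaceOn φ ν U →
      -- number of roots
      (∀ x ∈ U,
        (meanCurvatureS φ x = 0 →
          {s | (trapPoly φ ν x).IsRoot s}.encard
            = (((principalCurvatures φ ν x).ncard - 1 : ℕ) : ℕ∞)) ∧
        (meanCurvatureS φ x ≠ 0 →
          {s | (trapPoly φ ν x).IsRoot s}.encard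
            = ((principalCurvatures φ ν x).ncard : ℕ∞))) ∧
      -- every continuous root gives a marginally trapped immersion
      (∀ s : M → ℝ, IsRootFunctionOn φ ν s U →
        IsMarginallyTrappedOn 2 (nullLift φ ν s) U) ∧
      -- when there are `p` distinct principal curvatures everywhere, the roots are `p - 1`
      -- (minimal case) or `p` continuous functions, with their marginally trapped immersions
      (∀ p : ℕ, (∀ x ∈ U, (principalCurvatures φ ν x).encard = (p : ℕ∞)) →
        ((∀ x ∈ U, meanCurvatureS φ x = 0) →
          ∃ s : Fin (p - 1) → M → ℝ,
            (∀ x ∈ U, Function.Injective (fun i => s i x) ∧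
              Set.range (fun i => s i x) = {t | (trapPoly φ ν x).IsRoot t}) ∧
            ∀ i, IsRootFunctionOn φ ν (s i) U ∧
              IsMarginallyTrappedOn 2 (nullLift φ ν (s i)) U) ∧
        ((∀ x ∈ U, meanCurvatureS φ x ≠ 0) →
          ∃ s : Fin p → M → ℝ,
            (∀ x ∈ U, Function.Injective (fun i => s i x) ∧
              Set.range (fun i => s i x) = {t | (trapPoly φ ν x).IsRoot t}) ∧
            ∀ i, IsRootFunctionOn φ ν (s i) U ∧
              IsMarginallyTrappedOn 2 (nullLift φ ν (s i)) U))) ∧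
    -- converse
    (∀ F : M → Euc n × ℝ, IsMarginallyTrappedOn 5 F U →
      (∀ x ∈ U, ∀ (N : Set M) (ξ : M → Euc n × ℝ), IsOpen N → x ∈ N → N ⊆ U →
        IsNullNormalOn F ξ N → (∀ y ∈ N, lorForm n (meanCurvatureL F y) (ξ y) = 0) →
        IsLocallyNullLift F x) ∧
      ∃ O : Set M, IsOpen O ∧ O ⊆ U ∧ U ⊆ closure O ∧
        (∀ x ∈ U, meanCurvatureL F x ≠ 0 → x ∈ O) ∧ ∀ x ∈ O, IsLocallyNullLift F x) ∧
    -- surfaces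
    (n = 2 → ∀ φ ν : M → Euc n, IsHypersurfaceOn φ ν U →
      (∀ x ∈ U, meanCurvatureS φ x ≠ 0) →
      ∀ κ₁ κ₂ : M → ℝ,
        (∀ x ∈ U, principalCurvatures φ ν x = {κ₁ x, κ₂ x} ∧ κ₁ x ≠ κ₂ x) →
        IsMarginallyTrappedOn 2 (surfaceLift 1 φ ν (surfaceParam κ₁ κ₂)) U ∧
        IsMarginallyTrappedOn 2 (surfaceLift (-1) φ ν (surfaceParam κ₁ κ₂)) U) := by
  refine ⟨fun hn2 F hF hnull => isTotallyGeodesicOn_of_null hn2 hU hF hnull,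
    fun φ ν h => ⟨fun x hx => h.encard_roots hn hU hx,
      fun s hs => h.isMarginallyTrappedOn_nullLift hn hU hs, fun p hp => ?_⟩,
    fun F hF => ⟨fun x hx O ξ hO hxO _ hξ hH =>
      isLocallyNullLift_of_nullNormal hU hF hx hO hxO hξ hH,
      exists_open_dense_isLocallyNullLift hU hF⟩,
    fun hn2 φ ν h hH κ₁ κ₂ hκ => ?_⟩
  · have hp' : ∀ x ∈ U, (principalCurvatures φ ν x).ncard = p := fun x hx => by
      rw [Set.ncard, hp x hx, ENat.toNat_natCast]
    constructor
    · intro hH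
      obtain ⟨s, hs, hsr⟩ := h.exists_rootFunctions hn hU (q := p - 1) fun x hx => by
        rw [(h.encard_roots hn hU hx).1 (hH x hx), hp' x hx]
      exact ⟨s, hs, fun i => ⟨hsr i, h.isMarginallyTrappedOn_nullLift hn hU (hsr i)⟩⟩
    · intro hH
      obtain ⟨s, hs, hsr⟩ := h.exists_rootFunctions hn hU (q := p) fun x hx => by
        rw [(h.encard_roots hn hU hx).2 (hH x hx), hp' x hx]
      exact ⟨s, hs, fun i => ⟨hsr i, h.isMarginallyTrappedOn_nullLift hn hU (hsr i)⟩⟩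
  · obtain ⟨h1, h2⟩ := h.isRootFunctionOn_surfaceRoot hn2 hU hH hκ
    rw [surfaceLift_eq_nullLift (by norm_num), surfaceLift_eq_nullLift (by norm_num)]
    exact ⟨h.isMarginallyTrappedOn_nullLift hn hU h1, h.isMarginallyTrappedOn_nullLift hn hU h2⟩
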